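/- Let $\lambda>0$ and let $\mathscr O=\{x\in\mathbb R^2:|x|<1\}$. Write $H^{(1)}_n=J_n+iY_n$ and $H^{(2)}_n=J_n-iY_n$ for the Hankel functions of integer order $n\ge 0$. For each $\omega\in\mathbb S^1$ there is a unique function $u(\lambda,\cdot,\omega)\in C^\infty(\mathbb R^2\setminus\mathscr O)$ such that $(-\Delta-\lambda^2)u=0$ for $|x|>1$, $u=-e^{i\lambda\langle x,\omega\rangle}$ for $|x|=1$, and, uniformly in the direction $x/|x|$ as $|x|\to\infty$, $$u(\lambda,x,\omega)=e^{-\pi i/4}\sqrt{2\pi/(\lambda|x|)}\;e^{i\lambda|x|}\,b(\lambda,x/|x|,\omega)+O(|x|^{-3/2})$$ for some $b(\lambda,\cdot,\omega)\in C^\infty(\mathbb S^1)$; $b$ is then unique, and it is continuous on $\mathbb S^1\times\mathbb S^1$. The scattering matrix is the bounded operator $S(\lambda)=I+A(\lambda)$ on $L^2(\mathbb S^1)$, where $A(\lambda)f(\theta)=\int_{\mathbb S^1}b(\lambda,\theta,\omega)f(\omega)\,d\omega$ and $d\omega$ is arclength. Let $\det S(\lambda)=\det(I+A(\lambda))$ be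 its Fredholm determinant. A scattering phase is a continuous function $\sigma:[0,\infty)\to\mathbb R$ with $\sigma(0)=0$ and $e^{2\pi i\sigma(\lambda)}=\det S(\lambda)$ for all $\lambda>0$, that is, $\sigma=\frac1{2\pi i}\log\det S$. Such a $\sigma$ exists. Moreover, the following hold for every $\lambda>0$. 1. For every integer $n\ge0$, $H^{(1)}_n(\lambda)\ne0$ and $H^{(2)}_n(\lambda)\neq 0$. 2. For $n\in\mathbb Z$, $\cos(n\theta)$ and (if $n\ne0$) $\sin(n\theta)$ are eigenfunctions of $S(\lambda)$ with eigenvalue $$-\frac{H^{(2)}_{|n|}(\lambda)}{H^{(1)}_{|n|}(\lambda)}.$$ Equivalently, with the reflection $Jf(\omega)=f(-\omega)$, they are eigenfunctions of $S(\lambda)J$ with eigenvalue $(-1)^{n+1}H^{(2)}_{|n|}(\lambda)/H^{(1)}_{|n|}(\lambda)$. 3. Every scattering phase $\sigma$ is differentiable at $\lambda$, and $$\sigma'(\lambda)=\frac1{2\pi i}\sum_{n\in\mathbb Z}\left(\frac{(H^{(2)}_{|n|})'(\lambda)}{H^{(2)}_{|n|}(\lambda)}-\frac{(H^{(1)}_{|n|})'(\lambda)}{H^{(1)}_{|n|}(\lambda)}\right)=-\frac{2}{\pi^2\lambda}\sum_{n\in\mathbb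 Z}\frac1{H^{(1)}_{|n|}(\lambda)H^{(2)}_{|n|}(\lambda)},$$ where both series converge absolutely. -/

import Mathlib

open MeasureTheory

namespace DiskScattering

noncomputable section

/-! ### Bessel and Hankel functions of integer order `n ≥ 0` on the positive half-line -/

/-- The Bessel function of the first kind,
`J_n(x) = ∑_k (-1)^k (x/2)^(2k+n) / (k! (k+n)!)`. -/
def besselJ (n : ℕ) (x : ℝ) : ℝ :=
  ∑' k : ℕ, (-1 : ℝ) ^ k * (x / 2) ^ (2 * k + n) / ((k.factorial : ℝ) * ((k + n).factorial : ℝ))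

/-- The digamma function at a positive integer: `ψ(m+1) = -γ + (1 + 1/2 + ⋯ + 1/m)`. -/
def digammaSucc (m : ℕ) : ℝ := -Real.eulerMascheroniConstant + (harmonic m : ℝ)

/-- The Bessel function of the second kind, of integer order `n ≥ 0`, for `x > 0`,
`Y_n(x) = (2/π) log(x/2) J_n(x) - (1/π) ∑_{k<n} (n-k-1)!/k! (x/2)^(2k-n)
  - (1/π) ∑_k (ψ(k+1) + ψ(n+k+1)) (-1)^k (x/2)^(2k+n) / (k! (k+n)!)`. -/
def besselY (n : ℕ) (x : ℝ) : ℝ :=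
  2 / Real.pi * Real.log (x / 2) * besselJ n x
    - 1 / Real.pi * ∑ k ∈ Finset.range n,
        ((n - k - 1).factorial : ℝ) / (k.factorial : ℝ) * (x / 2) ^ (2 * (k : ℤ) - (n : ℤ))
    - 1 / Real.pi * ∑' k : ℕ, (digammaSucc k + digammaSucc (n + k)) *
        ((-1 : ℝ) ^ k * (x / 2) ^ (2 * k + n) / ((k.factorial : ℝ) * ((k + n).factorial : ℝ)))

/-- The Hankel function `H_n^{(1)} = J_n + i Y_n`. -/
def hankel1 (n : ℕ) (x : ℝ) : ℂ := (besselJ n x : ℂ) + Complex.I * (besselY n x : ℂ)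

/-- The Hankel function `H_n^{(2)} = J_n - i Y_n`. -/
def hankel2 (n : ℕ) (x : ℝ) : ℂ := (besselJ n x : ℂ) - Complex.I * (besselY n x : ℂ)

/-! ### The circle and its `L²` space -/

instance factTwoPiPos : Fact (0 < 2 * Real.pi) := ⟨Real.two_pi_pos⟩

/-- The unit circle, parametrized by the angle; `volume` is arclength, of total mass `2π`. -/
abbrev S1 : Type := AddCircle (2 * Real.pi)

/-- The point `(cos θ, sin θ)` of the plane, the plane being identified with `ℂ`
as a real inner product space. -/
def dir (θ : S1) : ℂ := (AddCircle.toCircle θ : ℂ)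

theorem dir_coe (t : ℝ) : dir (t : S1) = Complex.mk (Real.cos t) (Real.sin t) := by
  have h : (2 * Real.pi) ≠ 0 := Real.two_pi_pos.ne'
  rw [dir, AddCircle.toCircle_apply_mk, div_self h, one_mul, Circle.coe_exp]
  apply Complex.ext
  · simp [Complex.exp_ofReal_mul_I_re]
  · simp [Complex.exp_ofReal_mul_I_im]

/-- The Hilbert space `L²(S¹)` of complex-valued functions. -/
abbrev L2S1 : Type := Lp ℂ 2 (volume : Measure S1)

/-- The function `θ ↦ cos (n θ)`. -/
def cosFun (n : ℤ) : C(S1, ℂ) where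
  toFun θ := (((fourier n θ : ℂ).re : ℝ) : ℂ)
  continuous_toFun :=
    Complex.continuous_ofReal.comp (Complex.continuous_re.comp (fourier n).continuous)

/-- The function `θ ↦ sin (n θ)`. -/
def sinFun (n : ℤ) : C(S1, ℂ) where
  toFun θ := (((fourier n θ : ℂ).im : ℝ) : ℂ)
  continuous_toFun :=
    Complex.continuous_ofReal.comp (Complex.continuous_im.comp (fourier n).continuous)

theorem fourier_two_pi (n : ℤ) (t : ℝ) :
    (fourier n (t : S1) : ℂ) = Complex.exp (((n * t : ℝ) : ℂ) * Complex.I) := by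
  rw [fourier_coe_apply]
  congr 1
  have h : (Real.pi : ℂ) ≠ 0 := by exact_mod_cast Real.pi_ne_zero
  push_cast
  field_simp

theorem cosFun_coe (n : ℤ) (t : ℝ) : cosFun n (t : S1) = (Real.cos (n * t) : ℂ) := by
  change (((fourier n (t : S1) : ℂ).re : ℝ) : ℂ) = _
  rw [fourier_two_pi, Complex.exp_ofReal_mul_I_re]

theorem sinFun_coe (n : ℤ) (t : ℝ) : sinFun n (t : S1) = (Real.sin (n * t) : ℂ) := by
  change (((fourier n (t : S1) : ℂ).im : ℝ) : ℂ) = _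
  rw [fourier_two_pi, Complex.exp_ofReal_mul_I_im]

/-- `cos (n θ)` as an element of `L²(S¹)`. -/
def cosMode (n : ℤ) : L2S1 := ContinuousMap.toLp 2 volume ℂ (cosFun n)

/-- `sin (n θ)` as an element of `L²(S¹)`. -/
def sinMode (n : ℤ) : L2S1 := ContinuousMap.toLp 2 volume ℂ (sinFun n)

/-- The reflection `(J f)(θ) = f(θ + π)`, that is, `f(ω) ↦ f(-ω)`, on `L²(S¹)`. -/
def reflection : L2S1 →L[ℂ] L2S1 :=
  (Lp.compMeasurePreservingₗᵢ ℂ (fun θ : S1 => θ + ((Real.pi : ℝ) : S1))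
    (measurePreserving_add_right volume ((Real.pi : ℝ) : S1))).toContinuousLinearMap

/-! ### Scattering by the unit disk with the Dirichlet condition -/

/-- `u` is an outgoing solution, at frequency `lam > 0`, of
`(-Δ - lam²) u = 0` outside the closed unit disk, `u = -exp(i lam ⟨x, ω⟩)` on the unit circle,
smooth up to the boundary, with smooth outgoing profile `b`:
`u(x) = exp(-π i/4) √(2π/(lam |x|)) exp(i lam |x|) b(x/|x|) + O(|x|^(-3/2))`. -/
structure IsOutgoingSolution (lam : ℝ) (ω : S1) (u : ℂ → ℂ) (b : S1 → ℂ) : Prop where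
  smooth : ContDiffOn ℝ ((⊤ : ℕ∞) : WithTop ℕ∞) u (Metric.ball (0 : ℂ) 1)ᶜ
  helmholtz : ∀ x : ℂ, 1 < ‖x‖ → -(Laplacian.laplacian u x) - (lam : ℂ) ^ 2 * u x = 0
  boundary : ∀ x : ℂ, ‖x‖ = 1 →
    u x = -Complex.exp (Complex.I * ((lam * inner ℝ x (dir ω) : ℝ) : ℂ))
  profile_smooth : ContDiff ℝ ((⊤ : ℕ∞) : WithTop ℕ∞) (fun t : ℝ => b (t : S1))
  outgoing : ∃ C R : ℝ, 0 < R ∧ ∀ r : ℝ, R ≤ r → ∀ θ : S1,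
    ‖u ((r : ℂ) * dir θ) -
        Complex.exp (-(Real.pi : ℂ) * Complex.I / 4) *
          (Real.sqrt (2 * Real.pi / (lam * r)) : ℂ) *
          Complex.exp (Complex.I * ((lam * r : ℝ) : ℂ)) * b θ‖
      ≤ C * r ^ (-(3 / 2) : ℝ)

open Classical in
/-- The scattering amplitude `b(lam, θ, ω) = A(lam, θ, ω)`: the profile, in the direction `θ`, of
the outgoing solution for the incident direction `ω`. -/
def amplitude (lam : ℝ) (θ ω : S1) : ℂ :=
  if h : ∃ v : (ℂ → ℂ) × (S1 → ℂ), IsOutgoingSolution lam ω v.1 v.2 then h.choose.2 θ else 0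

/-- `T` is the integral operator on `L²(S¹)` with kernel `k`. -/
def IsIntegralOperator (k : S1 → S1 → ℂ) (T : L2S1 →L[ℂ] L2S1) : Prop :=
  ∀ f : L2S1, ∀ᵐ θ : S1, T f θ = ∫ ω : S1, k θ ω * f ω

open Classical in
/-- The bounded integral operator on `L²(S¹)` with kernel `k` (it is unique if it exists). -/
def integralOperator (k : S1 → S1 → ℂ) : L2S1 →L[ℂ] L2S1 :=
  if h : ∃ T : L2S1 →L[ℂ] L2S1, IsIntegralOperator k T then h.choose else 0

/-- The scattering matrix `S(lam) = I + A(lam)`. -/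
def scatteringMatrix (lam : ℝ) : L2S1 →L[ℂ] L2S1 :=
  ContinuousLinearMap.id ℂ L2S1 + integralOperator (amplitude lam)

/-- The Fredholm determinant `det (I + K)` of an integral operator `K` on the circle with
continuous kernel `k`, by Fredholm's formula
`∑_m (1/m!) ∫ ⋯ ∫ det (k(θ_i, θ_j))_{i,j ≤ m} dθ_1 ⋯ dθ_m`. -/
def fredholmDet (k : S1 → S1 → ℂ) : ℂ :=
  ∑' m : ℕ, (1 / (m.factorial : ℂ)) *
    ∫ t : Fin m → S1, Matrix.det (Matrix.of fun i j : Fin m => k (t i) (t j))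

/-- `det S(lam)`. -/
def scatteringDet (lam : ℝ) : ℂ := fredholmDet (amplitude lam)

/-- `σ` is the scattering phase `σ(lam) = (1/(2πi)) log det S(lam)` on `[0, ∞)`, the branch of the
logarithm being fixed by continuity and `σ(0) = 0`. -/
structure IsScatteringPhase (σ : ℝ → ℝ) : Prop where
  continuousOn : ContinuousOn σ (Set.Ici 0)
  zero : σ 0 = 0
  exp_eq : ∀ lam : ℝ, 0 < lam →
    Complex.exp (2 * (Real.pi : ℂ) * Complex.I * (σ lam : ℂ)) = scatteringDet lam

end

end DiskScattering

namespace DiskScattering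

noncomputable section

open Filter Topology

/-! ### Power series with factorially bounded coefficients -/

/-! The disk is rotation invariant, so everything diagonalises in the angular modes `e^{inθ}`. By
Jacobi–Anger (`hasSum_jacobi_anger`) the plane wave on the circle has coefficients `i^|n| J_|n|(λ)`.
Dividing by `H_|n|^{(1)}(λ)` and attaching the outgoing modes `H_n^{(1)}(λr) e^{inφ}` produces the
scattered wave. Since `H_n^{(1)} ~ (-i)^n` times a fixed outgoing wave at infinity, the amplitude is
the convolution kernel with coefficients `c_n = -J_|n| / (π H_|n|^{(1)})` (`amplitude_eq`). As `2J =
H^{(1)} + H^{(2)}`, the eigenvalue `1 + 2π c_n` of `S(λ)` is `-H_|n|^{(2)} / H_|n|^{(1)}`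
(`one_add_ampCoeff`).

Zeros of the Hankel functions are excluded by the Wronskian of `J_n` and `Y_n`. Uniqueness of the
outgoing solution is also modal: each Fourier coefficient of a difference of solutions satisfies
Bessel's equation in `r`, hence is `α H_n^{(1)} + β H_n^{(2)}`. The radiation condition kills `β`,
and the Dirichlet condition together with `H_n^{(1)}(λ) ≠ 0` kills `α` (`radial_eq_zero`,
`eq_zero_of_helmholtz`).

For a convolution kernel, Fredholm's series is the expansion of `∏ (1 + 2π c_n)` in elementary
symmetric sums (`fredholmDet_convolution`), so `det S` is the product of the eigenvalues. Each
eigenvalue is unimodular and tends to `1` as `λ → 0`, so it has a continuous phase vanishing at `0`.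
The Wronskian gives the derivative of that phase as `-2 / (π² λ |H_n^{(1)}|²)`. The phases sum
locally uniformly to a scattering phase, and any other one differs from it by a continuous
integer-valued function on the positive half-line.

Two analytic inputs feed this. For fixed `λ`, the polar part of `Y_n` makes `|H_n^{(1)}|` grow
factorially (`norm_hankel1_succ_ge`), so `c_n` decays roughly like `1/(n!)²`. This beats the crude
bounds `C^{n+1} n!` of `exists_hankel1_bounds`, which come from the upward recurrence. The
asymptotics of orders `0` and `1` that start the recurrence come from a Laplace-type integral,
identified with the series definition of `H_0^{(1)}` by comparing logarithmic behaviour at `0`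
(`hankel_eq_hankelIntegral`). -/

theorem summable_of_factorial_bound {c : ℕ → ℝ} {K : ℝ} (hc : ∀ k, |c k| ≤ K / k.factorial)
    (z : ℝ) : Summable fun k => c k * z ^ k := by
  refine Summable.of_norm_bounded (g := fun k => K * (|z| ^ k / k.factorial))
    ((Real.summable_pow_div_factorial |z|).mul_left K) fun k => ?_
  rw [Real.norm_eq_abs, abs_mul, abs_pow]
  calc |c k| * |z| ^ k ≤ K / k.factorial * |z| ^ k := by gcongr; exact hc k
    _ = _ := by ring

/-- The bound `K / k!` survives formal differentiation because `(k+1) / (k+1)! = 1 / k!`. On a ball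
of radius `R` the differentiated series is therefore dominated by an exponential series. -/
theorem hasDerivAt_tsum_pow_of_factorial_bound {c : ℕ → ℝ} {K : ℝ}
    (hc : ∀ k, |c k| ≤ K / k.factorial) (z : ℝ) :
    HasDerivAt (fun z => ∑' k, c k * z ^ k) (∑' k : ℕ, ((k : ℝ) + 1) * c (k + 1) * z ^ k) z := by
  have hK : 0 ≤ K := by simpa using (abs_nonneg _).trans (hc 0)
  set R : ℝ := |z| + 1
  have hR : 0 ≤ R := by positivity
  have hb : ∀ k : ℕ, |((k : ℝ) + 1) * c (k + 1)| ≤ K / k.factorial := by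
    intro k
    rw [abs_mul, abs_of_nonneg (by positivity : (0 : ℝ) ≤ (k : ℝ) + 1)]
    refine (mul_le_mul_of_nonneg_left (hc (k + 1)) (by positivity)).trans (le_of_eq ?_)
    rw [Nat.factorial_succ]
    push_cast
    field_simp
  have hsum : Summable fun k : ℕ => K * (R ^ (k - 1) / (k - 1).factorial) := by
    rw [← summable_nat_add_iff 1]
    simpa using (Real.summable_pow_div_factorial R).mul_left K
  have h := hasDerivAt_tsum_of_isPreconnected (g := fun (k : ℕ) (y : ℝ) => c k * y ^ k)
    (g' := fun (k : ℕ) (y : ℝ) => c k * (k * y ^ (k - 1))) hsum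
    Metric.isOpen_ball (convex_ball (0 : ℝ) R).isPreconnected
    (fun k y _ => (hasDerivAt_pow k y).const_mul (c k))
    (fun k y hy => by
      rw [mem_ball_zero_iff, Real.norm_eq_abs] at hy
      rcases k with _ | k
      · simpa using hK
      · rw [Real.norm_eq_abs, ← mul_assoc, abs_mul, abs_pow]
        have := hb k
        simp only [Nat.add_sub_cancel, Nat.cast_add, Nat.cast_one]
        rw [mul_comm (c (k + 1))]
        calc |((k : ℝ) + 1) * c (k + 1)| * |y| ^ k ≤ K / k.factorial * R ^ k := by gcongr
          _ = _ := by ring)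
    (y₀ := 0) (by simp [R]; positivity) (summable_of_factorial_bound hc 0)
    (y := z) (by simp [R])
  refine h.congr_deriv ?_
  have hs : Summable fun k : ℕ => c k * (k * z ^ (k - 1)) := by
    rw [← summable_nat_add_iff 1]
    refine (summable_of_factorial_bound hb z).congr fun k => ?_
    simp only [Nat.add_sub_cancel, Nat.cast_add, Nat.cast_one]
    ring
  rw [hs.tsum_eq_zero_add]
  simp only [CharP.cast_eq_zero, zero_mul, mul_zero, zero_add, Nat.add_sub_cancel, Nat.cast_add,
    Nat.cast_one]
  exact tsum_congr fun k => by ring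

/-! ### The entire series behind the Bessel functions -/

/-- The coefficients of `besselPhi`. -/
def phiCoeff (n k : ℕ) : ℝ := (-1 : ℝ) ^ k / ((k.factorial : ℝ) * ((k + n).factorial : ℝ))

/-- The entire function `φ_n` with `J_n(x) = (x/2)^n φ_n((x/2)^2)`. -/
def besselPhi (n : ℕ) (z : ℝ) : ℝ := ∑' k, phiCoeff n k * z ^ k

/-- The coefficients of `besselChi`. -/
def chiCoeff (n k : ℕ) : ℝ := (digammaSucc k + digammaSucc (n + k)) * phiCoeff n k

/-- The digamma series of `Y_n`, divided by `(x/2)^n`, as a function of `(x/2)^2`. -/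
def besselChi (n : ℕ) (z : ℝ) : ℝ := ∑' k, chiCoeff n k * z ^ k

/-- The finite sum in `Y_n`, divided by `(x/2)^n`, as a function of `(x/2)^2`. -/
def besselPolar (n : ℕ) (z : ℝ) : ℝ :=
  ∑ k ∈ Finset.range n, ((n - k - 1).factorial : ℝ) / (k.factorial : ℝ) * z ^ ((k : ℤ) - (n : ℤ))

/-- The function `υ_n` with `π Y_n(x) = (x/2)^n υ_n((x/2)^2)` for `x > 0`. -/
def besselUpsilon (n : ℕ) (z : ℝ) : ℝ :=
  Real.log z * besselPhi n z - besselPolar n z - besselChi n z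

theorem abs_phiCoeff (n k : ℕ) :
    |phiCoeff n k| = 1 / ((k.factorial : ℝ) * ((k + n).factorial : ℝ)) := by
  rw [phiCoeff, abs_div, abs_pow, abs_neg, abs_one, one_pow, abs_of_nonneg (by positivity)]

theorem abs_phiCoeff_le (n k : ℕ) : |phiCoeff n k| ≤ 1 / n.factorial / k.factorial := by
  rw [abs_phiCoeff, div_div, mul_comm]
  gcongr
  omega

theorem abs_digammaSucc_le (m : ℕ) : |digammaSucc m| ≤ m + 1 := by
  have h1 : (0 : ℝ) ≤ harmonic m := by
    have : (0 : ℚ) ≤ harmonic m := Finset.sum_nonneg fun i _ => by positivity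
    exact_mod_cast this
  have h2 : ((harmonic m : ℚ) : ℝ) ≤ m := by
    have : harmonic m ≤ (m : ℚ) := by
      calc harmonic m ≤ ∑ i ∈ Finset.range m, (1 : ℚ) := by
            refine Finset.sum_le_sum fun i _ => ?_
            exact inv_le_one_of_one_le₀ (by simp)
        _ = m := by simp
    exact_mod_cast this
  have h3 := Real.eulerMascheroniConstant_lt_two_thirds
  have h4 := Real.one_half_lt_eulerMascheroniConstant
  rw [digammaSucc, abs_le]
  have : (0 : ℝ) ≤ m := Nat.cast_nonneg m
  constructor <;> linarith

/-- The digamma values grow at most linearly, and the factor `(k+n)!` in the denominator absorbs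
them through `m + 1 ≤ 2 m!`. The constant does not depend on `n`. -/
theorem abs_chiCoeff_le (n k : ℕ) : |chiCoeff n k| ≤ 4 / k.factorial := by
  have h1 := abs_digammaSucc_le k
  have h2 := abs_digammaSucc_le (n + k)
  have h3 : |digammaSucc k + digammaSucc (n + k)| ≤ 2 * ((k + n : ℕ) + 1) := by
    refine (abs_add_le _ _).trans ?_
    push_cast at *
    have : (0 : ℝ) ≤ n := Nat.cast_nonneg n
    linarith
  rw [chiCoeff, abs_mul, abs_phiCoeff]
  have h4 : (((k + n : ℕ) : ℝ) + 1) ≤ 2 * ((k + n).factorial : ℝ) := by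
    have h5 := Nat.self_le_factorial (k + n)
    have h6 := Nat.factorial_pos (k + n)
    have : (k + n) + 1 ≤ 2 * (k + n).factorial := by omega
    exact_mod_cast this
  calc _ ≤ (2 * (2 * ((k + n).factorial : ℝ))) * (1 / ((k.factorial : ℝ) * (k + n).factorial)) := by
        gcongr
        exact h3.trans (by linarith)
    _ = _ := by field_simp; norm_num

theorem summable_besselPhi (n : ℕ) (z : ℝ) : Summable fun k => phiCoeff n k * z ^ k :=
  summable_of_factorial_bound (abs_phiCoeff_le n) z

theorem summable_besselChi (n : ℕ) (z : ℝ) : Summable fun k => chiCoeff n k * z ^ k :=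
  summable_of_factorial_bound (abs_chiCoeff_le n) z

theorem phiCoeff_succ (n k : ℕ) : ((k : ℝ) + 1) * phiCoeff n (k + 1) = -phiCoeff (n + 1) k := by
  rw [phiCoeff, phiCoeff, show k + 1 + n = k + (n + 1) by ring, Nat.factorial_succ k, pow_succ]
  push_cast
  field_simp

theorem digammaSucc_succ (m : ℕ) : digammaSucc (m + 1) = digammaSucc m + 1 / ((m : ℝ) + 1) := by
  rw [digammaSucc, digammaSucc, harmonic_succ]
  push_cast
  rw [one_div]
  ring

theorem hasDerivAt_besselPhi (n : ℕ) (z : ℝ) :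
    HasDerivAt (besselPhi n) (-besselPhi (n + 1) z) z := by
  refine (hasDerivAt_tsum_pow_of_factorial_bound (abs_phiCoeff_le n) z).congr_deriv ?_
  rw [besselPhi, ← tsum_neg]
  exact tsum_congr fun k => by rw [phiCoeff_succ]; ring

theorem besselPhi_zero (n : ℕ) : besselPhi n 0 = 1 / n.factorial := by
  rw [besselPhi, tsum_eq_single 0 fun k hk => by simp [hk]]
  simp [phiCoeff]

theorem besselPhi_sub (n : ℕ) (z : ℝ) :
    besselPhi n z - 1 / n.factorial = z * ∑' k : ℕ, phiCoeff n (k + 1) * z ^ k := by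
  rw [besselPhi, (summable_besselPhi n z).tsum_eq_zero_add, ← tsum_mul_left]
  simp only [phiCoeff, pow_zero, zero_add, Nat.factorial_zero, Nat.cast_one, one_mul, mul_one,
    add_sub_cancel_left]
  exact tsum_congr fun k => by ring

/-- The extra term comes from `ψ(k+2) = ψ(k+1) + 1/(k+1)`: the increments `1/(k+1)` reassemble into
the shifted series of `besselPhi_sub`. -/
theorem hasDerivAt_besselChi (n : ℕ) {z : ℝ} (hz : z ≠ 0) :
    HasDerivAt (besselChi n)
      (-besselChi (n + 1) z + (besselPhi n z - 1 / n.factorial) / z) z := by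
  refine (hasDerivAt_tsum_pow_of_factorial_bound (abs_chiCoeff_le n) z).congr_deriv ?_
  rw [besselPhi_sub, mul_div_cancel_left₀ _ hz, besselChi, ← tsum_neg, ← Summable.tsum_add]
  · refine tsum_congr fun k => ?_
    have hk : ((k : ℝ) + 1) ≠ 0 := by positivity
    have h := phiCoeff_succ n k
    rw [chiCoeff, chiCoeff, digammaSucc_succ, show n + 1 + k = n + (k + 1) by ring]
    have h' : phiCoeff (n + 1) k = -(((k : ℝ) + 1) * phiCoeff n (k + 1)) := by rw [h, neg_neg]
    rw [h']
    field_simp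
    ring
  · exact (summable_besselChi (n + 1) z).neg
  · have := (summable_nat_add_iff 1).2 (summable_besselPhi n z)
    refine (this.mul_left z⁻¹).congr fun k => ?_
    rw [pow_succ]
    field_simp

theorem besselPolar_succ (n : ℕ) (z : ℝ) : besselPolar (n + 1) z =
    ∑ k ∈ Finset.range n, ((n - k).factorial : ℝ) / (k.factorial : ℝ) * z ^ ((k : ℤ) - n - 1)
      + 1 / n.factorial * z⁻¹ := by
  rw [besselPolar, Finset.sum_range_succ]
  congr 1
  · refine Finset.sum_congr rfl fun k hk => ?_
    have hk' := Finset.mem_range.1 hk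
    rw [show n + 1 - k - 1 = n - k by omega]
    congr 2
    push_cast
    ring
  · simp

theorem hasDerivAt_besselPolar (n : ℕ) {z : ℝ} (hz : z ≠ 0) :
    HasDerivAt (besselPolar n) (-besselPolar (n + 1) z + 1 / (n.factorial * z)) z := by
  have h : HasDerivAt (besselPolar n) (∑ k ∈ Finset.range n,
      ((n - k - 1).factorial : ℝ) / (k.factorial : ℝ) *
        ((((k : ℤ) - (n : ℤ) : ℤ) : ℝ) * z ^ ((k : ℤ) - (n : ℤ) - 1))) z := by
    unfold besselPolar
    exact HasDerivAt.fun_sum fun k _ => (hasDerivAt_zpow _ z (Or.inl hz)).const_mul _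
  convert h using 1
  rw [besselPolar_succ, neg_add, ← Finset.sum_neg_distrib, one_div, one_div, mul_inv]
  rw [neg_add_cancel_right]
  refine Finset.sum_congr rfl fun k hk => ?_
  have hk' := Finset.mem_range.1 hk
  -- Writing `n = k + m + 1` removes the truncated subtraction, so that `(m+1)! = (m+1) m!` matches
  -- the exponent `k - n = -(m+1)`.
  obtain ⟨m, rfl⟩ : ∃ m, n = k + m + 1 := ⟨n - k - 1, by omega⟩
  rw [show k + m + 1 - k = m + 1 by omega, show m + 1 - 1 = m by omega, Nat.factorial_succ]
  push_cast
  ring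

/-- The three inhomogeneous terms cancel: `φ_n / z` from the logarithm, `1/(n! z)` from the polar
part and `(φ_n - 1/n!)/z` from the digamma series. Hence `υ_n` obeys the same ladder relation as
`φ_n`. -/
theorem hasDerivAt_besselUpsilon (n : ℕ) {z : ℝ} (hz : z ≠ 0) :
    HasDerivAt (besselUpsilon n) (-besselUpsilon (n + 1) z) z := by
  have h := (((Real.hasDerivAt_log hz).mul (hasDerivAt_besselPhi n z)).sub
    (hasDerivAt_besselPolar n hz)).sub (hasDerivAt_besselChi n hz)
  refine h.congr_deriv ?_
  rw [besselUpsilon]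
  field_simp
  ring

theorem besselPhi_recurrence (n : ℕ) (z : ℝ) :
    ((n : ℝ) + 1) * besselPhi (n + 1) z = besselPhi n z + z * besselPhi (n + 2) z := by
  have hs : Summable fun k : ℕ => (k : ℝ) * phiCoeff (n + 1) k * z ^ k := by
    rw [← summable_nat_add_iff 1]
    refine ((summable_besselPhi (n + 2) z).mul_left (-z)).congr fun k => ?_
    have := phiCoeff_succ (n + 1) k
    push_cast
    rw [this]
    ring
  have h1 : ∑' k : ℕ, (k : ℝ) * phiCoeff (n + 1) k * z ^ k = -(z * besselPhi (n + 2) z) := by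
    rw [hs.tsum_eq_zero_add, besselPhi, ← tsum_mul_left, ← tsum_neg]
    simp only [CharP.cast_eq_zero, zero_mul, zero_add]
    refine tsum_congr fun k => ?_
    have := phiCoeff_succ (n + 1) k
    push_cast
    rw [this]
    ring
  have h2 : ((n : ℝ) + 1) * besselPhi (n + 1) z +
      ∑' k : ℕ, (k : ℝ) * phiCoeff (n + 1) k * z ^ k = besselPhi n z := by
    rw [besselPhi, besselPhi, ← tsum_mul_left,
      ← ((summable_besselPhi (n + 1) z).mul_left _).tsum_add hs]
    refine tsum_congr fun k => ?_
    rw [phiCoeff, phiCoeff, show k + (n + 1) = k + n + 1 by ring, Nat.factorial_succ]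
    push_cast
    field_simp
    ring
  rw [h1] at h2
  linarith

/-- All coefficients of index at least `1` cancel. The defect `1/(n+1)!` is the constant
coefficient, where only the `1/(n+1)` in `ψ(n+2) - ψ(n+1)` is left over. `besselPolar_recurrence`
has the opposite defect, so `υ_n` satisfies the homogeneous recurrence. -/
theorem besselChi_recurrence (n : ℕ) (z : ℝ) :
    ((n : ℝ) + 1) * besselChi (n + 1) z =
      besselChi n z + z * besselChi (n + 2) z + 1 / (n + 1).factorial := by
  have h1 := ((summable_besselChi (n + 1) z).mul_left ((n : ℝ) + 1)).tsum_eq_zero_add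
  have h2 := (summable_besselChi n z).tsum_eq_zero_add
  have s1 := (summable_nat_add_iff 1).2 ((summable_besselChi (n + 1) z).mul_left ((n : ℝ) + 1))
  have s2 := (summable_nat_add_iff 1).2 (summable_besselChi n z)
  have s3 := (summable_besselChi (n + 2) z).mul_left z
  have h3 : ∑' k : ℕ, (((n : ℝ) + 1) * (chiCoeff (n + 1) (k + 1) * z ^ (k + 1)) -
      chiCoeff n (k + 1) * z ^ (k + 1) - z * (chiCoeff (n + 2) k * z ^ k)) = 0 := by
    rw [← tsum_zero (β := ℕ)]
    refine tsum_congr fun k => ?_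
    have e0 : n + 1 + (k + 1) = (n + k + 1) + 1 := by ring
    have e1 : n + (k + 1) = n + k + 1 := by ring
    have e2 : n + 2 + k = (n + k + 1) + 1 := by ring
    have c1 : phiCoeff (n + 2) k = -(((k : ℝ) + 1) * phiCoeff (n + 1) (k + 1)) := by
      rw [phiCoeff_succ, neg_neg]
    have c2 : phiCoeff n (k + 1) = ((n : ℝ) + k + 2) * phiCoeff (n + 1) (k + 1) := by
      rw [phiCoeff, phiCoeff, show k + 1 + (n + 1) = k + 1 + n + 1 by ring,
        Nat.factorial_succ (k + 1 + n)]
      push_cast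
      field_simp
      ring
    rw [chiCoeff, chiCoeff, chiCoeff, c1, c2, e0, e1, e2, digammaSucc_succ k,
      digammaSucc_succ (n + k + 1)]
    push_cast
    field_simp
    ring
  rw [(s1.sub s2).tsum_sub s3, s1.tsum_sub s2,
    tsum_mul_left (f := fun k => chiCoeff (n + 2) k * z ^ k)] at h3
  rw [besselChi, besselChi, besselChi, ← tsum_mul_left, h1, h2]
  have h4 : ((n : ℝ) + 1) * (chiCoeff (n + 1) 0 * z ^ 0) =
      chiCoeff n 0 * z ^ 0 + 1 / (n + 1).factorial := by
    simp only [chiCoeff, phiCoeff, add_zero, zero_add, digammaSucc_succ, Nat.factorial_succ n]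
    push_cast
    field_simp
    ring
  linarith

theorem besselPolar_recurrence (n : ℕ) {z : ℝ} (hz : z ≠ 0) :
    ((n : ℝ) + 1) * besselPolar (n + 1) z =
      besselPolar n z + z * besselPolar (n + 2) z - 1 / (n + 1).factorial := by
  have h2 : z * besselPolar (n + 2) z = ∑ k ∈ Finset.range (n + 1),
      (((n + 1 - k).factorial : ℝ) / k.factorial) * z ^ ((k : ℤ) - (n + 1)) +
        1 / (n + 1).factorial := by
    rw [besselPolar_succ, mul_add, Finset.mul_sum]
    congr 1
    · refine Finset.sum_congr rfl fun k _ => ?_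
      rw [zpow_sub_one₀ hz]
      push_cast
      field_simp
    · field_simp
  -- Shifting the index by one and adding a term with coefficient `k = 0` puts the sum over the same
  -- range and powers as the other two.
  have h1 : besselPolar n z = ∑ k ∈ Finset.range (n + 1),
      ((k : ℝ) * (n - k).factorial / k.factorial) * z ^ ((k : ℤ) - (n + 1)) := by
    rw [Finset.sum_range_succ', besselPolar]
    simp only [CharP.cast_eq_zero, zero_mul, zero_div, add_zero]
    refine Finset.sum_congr rfl fun k _ => ?_
    rw [show n - k - 1 = n - (k + 1) by omega, Nat.factorial_succ]
    push_cast
    rw [show (k : ℤ) + 1 - (n + 1) = k - n by ring]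
    field_simp
  rw [h1, h2, besselPolar, Finset.mul_sum, ← add_assoc, add_sub_cancel_right,
    ← Finset.sum_add_distrib]
  refine Finset.sum_congr rfl fun k hk => ?_
  obtain ⟨m, rfl⟩ : ∃ m, n = k + m := ⟨n - k, by have := Finset.mem_range.1 hk; omega⟩
  rw [show k + m + 1 - k - 1 = m by omega, show k + m + 1 - k = m + 1 by omega,
    show k + m - k = m by omega, Nat.factorial_succ]
  push_cast
  ring

theorem besselUpsilon_recurrence (n : ℕ) {z : ℝ} (hz : z ≠ 0) :
    ((n : ℝ) + 1) * besselUpsilon (n + 1) z =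
      besselUpsilon n z + z * besselUpsilon (n + 2) z := by
  have h1 := besselPhi_recurrence n z
  have h2 := besselChi_recurrence n z
  have h3 := besselPolar_recurrence n hz
  simp only [besselUpsilon]
  linear_combination Real.log z * h1 - h2 - h3

theorem besselJ_eq (n : ℕ) (x : ℝ) : besselJ n x = (x / 2) ^ n * besselPhi n ((x / 2) ^ 2) := by
  rw [besselJ, besselPhi, ← tsum_mul_left]
  refine tsum_congr fun k => ?_
  rw [phiCoeff, pow_add, pow_mul]
  ring

theorem besselY_eq (n : ℕ) {x : ℝ} (hx : 0 < x) :
    besselY n x = 1 / Real.pi * ((x / 2) ^ n * besselUpsilon n ((x / 2) ^ 2)) := by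
  have hx2 : 0 < x / 2 := by positivity
  have h1 : ∑' k : ℕ, (digammaSucc k + digammaSucc (n + k)) *
        ((-1 : ℝ) ^ k * (x / 2) ^ (2 * k + n) / ((k.factorial : ℝ) * ((k + n).factorial : ℝ)))
      = (x / 2) ^ n * besselChi n ((x / 2) ^ 2) := by
    rw [besselChi, ← tsum_mul_left]
    refine tsum_congr fun k => ?_
    rw [chiCoeff, phiCoeff, pow_add, pow_mul]
    ring
  have h2 : ∑ k ∈ Finset.range n,
        ((n - k - 1).factorial : ℝ) / (k.factorial : ℝ) * (x / 2) ^ (2 * (k : ℤ) - (n : ℤ))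
      = (x / 2) ^ n * besselPolar n ((x / 2) ^ 2) := by
    rw [besselPolar, Finset.mul_sum]
    refine Finset.sum_congr rfl fun k _ => ?_
    have : (x / 2) ^ (2 * (k : ℤ) - (n : ℤ)) =
        (x / 2) ^ n * ((x / 2) ^ 2) ^ ((k : ℤ) - (n : ℤ)) := by
      rw [← zpow_natCast (x / 2) n, ← zpow_natCast (x / 2) 2, ← zpow_mul, ← zpow_add₀ hx2.ne']
      congr 1
      push_cast
      ring
    rw [this]
    ring
  rw [besselY, h1, h2, besselJ_eq, besselUpsilon, Real.log_pow]
  push_cast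
  ring

/-! ### Wronskian, recurrences, derivatives -/

theorem besselPolar_nonneg (n : ℕ) {z : ℝ} (hz : 0 < z) : 0 ≤ besselPolar n z :=
  Finset.sum_nonneg fun k _ => by positivity

theorem continuous_besselPhi (n : ℕ) : Continuous (besselPhi n) :=
  continuous_iff_continuousAt.2 fun z => (hasDerivAt_besselPhi n z).continuousAt

theorem continuous_besselChi (n : ℕ) : Continuous (besselChi n) :=
  continuous_iff_continuousAt.2 fun z =>
    (hasDerivAt_tsum_pow_of_factorial_bound (abs_chiCoeff_le n) z).continuousAt

theorem eq_of_hasDerivAt_zero_Ioi {E : Type*} [NormedAddCommGroup E] [NormedSpace ℝ E] {f : ℝ → E}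
    {a : ℝ} (hf : ∀ x ∈ Set.Ioi a, HasDerivAt f 0 x) {x y : ℝ} (hx : x ∈ Set.Ioi a)
    (hy : y ∈ Set.Ioi a) : f x = f y :=
  (convex_Ioi a).is_const_of_fderivWithin_eq_zero (𝕜 := ℝ)
    (fun z hz => (hf z hz).differentiableAt.differentiableWithinAt)
    (fun z hz => by
      have h0 : HasFDerivWithinAt f (0 : ℝ →L[ℝ] E) (Set.Ioi a) z := by
        simpa using (hf z hz).hasFDerivAt.hasFDerivWithinAt (s := Set.Ioi a)
      exact h0.fderivWithin (isOpen_Ioi.uniqueDiffWithinAt hz)) hx hy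

/-- The recurrences make the quantity independent of `n`, and for `n = 0` its derivative vanishes.
The constant is read off at `z → 0+`: the logarithms cancel in the cross product, and only the polar
term `1/z` of `υ_1` contributes in the limit. -/
theorem besselPhi_upsilon_wronskian (n : ℕ) {z : ℝ} (hz : 0 < z) :
    z ^ (n + 1) * (besselPhi (n + 1) z * besselUpsilon n z -
      besselPhi n z * besselUpsilon (n + 1) z) = 1 := by
  induction n with
  | zero =>
    set V : ℝ → ℝ := fun z => z * (besselPhi 1 z * besselUpsilon 0 z -
      besselPhi 0 z * besselUpsilon 1 z) with hV
    have hd : ∀ z ∈ Set.Ioi (0 : ℝ), HasDerivAt V 0 z := by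
      intro z hz
      have hz' : z ≠ 0 := (Set.mem_Ioi.1 hz).ne'
      have h := (hasDerivAt_id z).mul
        (((hasDerivAt_besselPhi 1 z).mul (hasDerivAt_besselUpsilon 0 hz')).sub
          ((hasDerivAt_besselPhi 0 z).mul (hasDerivAt_besselUpsilon 1 hz')))
      refine h.congr_deriv ?_
      have r1 := besselPhi_recurrence 0 z
      have r2 := besselUpsilon_recurrence 0 hz'
      norm_num at r1 r2
      simp only [id, zero_add, Nat.reduceAdd, Pi.mul_apply, Pi.sub_apply]
      linear_combination (besselUpsilon 0 z) * r1 - besselPhi 0 z * r2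
    have hW : ∀ z ∈ Set.Ioi (0 : ℝ), V z = besselPhi 0 z +
        z * (besselPhi 0 z * besselChi 1 z - besselPhi 1 z * besselChi 0 z) := by
      intro z hz
      have hz' : z ≠ 0 := (Set.mem_Ioi.1 hz).ne'
      simp only [hV, besselUpsilon, besselPolar]
      simp
      field_simp
      ring
    have hlim : Tendsto V (𝓝[>] 0) (𝓝 1) := by
      have hc : Continuous fun z => besselPhi 0 z +
          z * (besselPhi 0 z * besselChi 1 z - besselPhi 1 z * besselChi 0 z) := by
        have := continuous_besselPhi
        have := continuous_besselChi
        fun_prop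
      have := (hc.tendsto 0).mono_left (nhdsWithin_le_nhds (s := Set.Ioi 0))
      simp only [besselPhi_zero, Nat.factorial_zero, Nat.cast_one, div_one, zero_mul,
        add_zero] at this
      refine this.congr' ?_
      filter_upwards [self_mem_nhdsWithin] with z hz using (hW z hz).symm
    have : Tendsto V (𝓝[>] 0) (𝓝 (V z)) :=
      tendsto_const_nhds.congr' (by
        filter_upwards [self_mem_nhdsWithin] with w hw using
          eq_of_hasDerivAt_zero_Ioi hd hz hw)
    simpa [hV] using tendsto_nhds_unique this hlim
  | succ n ih =>
    rw [← ih]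
    have r1 := besselPhi_recurrence n z
    have r2 := besselUpsilon_recurrence n hz.ne'
    linear_combination z ^ (n + 1) * (besselPhi (n + 1) z * r2 - besselUpsilon (n + 1) z * r1)

theorem hasDerivAt_half_pow_mul {f : ℕ → ℝ → ℝ} (n : ℕ) {x : ℝ} (hx : 0 < x)
    (hf : HasDerivAt (f n) (-f (n + 1) ((x / 2) ^ 2)) ((x / 2) ^ 2)) :
    HasDerivAt (fun x => (x / 2) ^ n * f n ((x / 2) ^ 2))
      (n / x * ((x / 2) ^ n * f n ((x / 2) ^ 2)) -
        (x / 2) ^ (n + 1) * f (n + 1) ((x / 2) ^ 2)) x := by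
  have h2 : HasDerivAt (fun x : ℝ => x / 2) (1 / 2) x := (hasDerivAt_id x).div_const 2
  have h3 := h2.fun_pow 2
  have h := (h2.fun_pow n).fun_mul (hf.comp x h3)
  refine h.congr_deriv ?_
  rcases n with _ | n
  · simp
    ring
  · simp only [Nat.add_sub_cancel, Function.comp]
    push_cast
    field_simp
    ring

theorem hasDerivAt_besselJ (n : ℕ) {x : ℝ} (hx : 0 < x) :
    HasDerivAt (besselJ n) (n / x * besselJ n x - besselJ (n + 1) x) x := by
  rw [besselJ_eq, besselJ_eq, funext (besselJ_eq n)]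
  exact hasDerivAt_half_pow_mul n hx (hasDerivAt_besselPhi n _)

theorem hasDerivAt_besselY (n : ℕ) {x : ℝ} (hx : 0 < x) :
    HasDerivAt (besselY n) (n / x * besselY n x - besselY (n + 1) x) x := by
  rw [besselY_eq n hx, besselY_eq (n + 1) hx]
  have h := (hasDerivAt_half_pow_mul n hx
    (hasDerivAt_besselUpsilon n (by positivity))).const_mul (1 / Real.pi)
  refine (h.congr_of_eventuallyEq ?_).congr_deriv (by ring)
  filter_upwards [lt_mem_nhds hx] with y hy using besselY_eq n hy

theorem besselJ_recurrence (n : ℕ) {x : ℝ} (hx : 0 < x) :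
    2 * ((n : ℝ) + 1) / x * besselJ (n + 1) x = besselJ n x + besselJ (n + 2) x := by
  have h := besselPhi_recurrence n ((x / 2) ^ 2)
  rw [besselJ_eq, besselJ_eq, besselJ_eq]
  generalize besselPhi n ((x / 2) ^ 2) = a at h ⊢
  generalize besselPhi (n + 1) ((x / 2) ^ 2) = b at h ⊢
  generalize besselPhi (n + 2) ((x / 2) ^ 2) = c at h ⊢
  field_simp
  linear_combination (x / 2) ^ n * x * h

theorem besselY_recurrence (n : ℕ) {x : ℝ} (hx : 0 < x) :
    2 * ((n : ℝ) + 1) / x * besselY (n + 1) x = besselY n x + besselY (n + 2) x := by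
  have h := besselUpsilon_recurrence n (z := (x / 2) ^ 2) (by positivity)
  rw [besselY_eq _ hx, besselY_eq _ hx, besselY_eq _ hx]
  have := Real.pi_pos
  generalize besselUpsilon n ((x / 2) ^ 2) = a at h ⊢
  generalize besselUpsilon (n + 1) ((x / 2) ^ 2) = b at h ⊢
  generalize besselUpsilon (n + 2) ((x / 2) ^ 2) = c at h ⊢
  field_simp
  linear_combination (x / 2) ^ n * x * h

theorem besselJ_besselY_wronskian (n : ℕ) {x : ℝ} (hx : 0 < x) :
    besselJ (n + 1) x * besselY n x - besselJ n x * besselY (n + 1) x = 2 / (Real.pi * x) := by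
  have h := besselPhi_upsilon_wronskian n (z := (x / 2) ^ 2) (by positivity)
  rw [besselJ_eq, besselJ_eq, besselY_eq _ hx, besselY_eq _ hx]
  have := Real.pi_pos
  rw [← pow_mul] at h
  generalize besselPhi n ((x / 2) ^ 2) = a at h ⊢
  generalize besselPhi (n + 1) ((x / 2) ^ 2) = b at h ⊢
  generalize besselUpsilon n ((x / 2) ^ 2) = c at h ⊢
  generalize besselUpsilon (n + 1) ((x / 2) ^ 2) = d at h ⊢
  field_simp
  linear_combination 2 * h

theorem star_hankel1 (n : ℕ) (x : ℝ) : (starRingEnd ℂ) (hankel1 n x) = hankel2 n x := by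
  simp [hankel1, hankel2, sub_eq_add_neg]

theorem hankel1_re (n : ℕ) (x : ℝ) : (hankel1 n x).re = besselJ n x := by simp [hankel1]

theorem hankel1_im (n : ℕ) (x : ℝ) : (hankel1 n x).im = besselY n x := by simp [hankel1]

/-- For real argument a zero would be a common zero of `J_n` and `Y_n`, contradicting their nonzero
Wronskian. -/
theorem hankel1_ne_zero (n : ℕ) {x : ℝ} (hx : 0 < x) : hankel1 n x ≠ 0 := by
  intro h
  have h1 : besselJ n x = 0 := by rw [← hankel1_re, h, Complex.zero_re]
  have h2 : besselY n x = 0 := by rw [← hankel1_im, h, Complex.zero_im]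
  have h3 := besselJ_besselY_wronskian n hx
  rw [h1, h2] at h3
  have : 0 < 2 / (Real.pi * x) := by positivity
  simp only [mul_zero, zero_mul, sub_self] at h3
  linarith

theorem hankel2_ne_zero (n : ℕ) {x : ℝ} (hx : 0 < x) : hankel2 n x ≠ 0 := by
  rw [← star_hankel1]
  simpa using hankel1_ne_zero n hx

theorem norm_hankel2 (n : ℕ) (x : ℝ) : ‖hankel2 n x‖ = ‖hankel1 n x‖ := by
  rw [← star_hankel1, RCLike.norm_conj]

theorem hankel1_mul_hankel2 (n : ℕ) (x : ℝ) :
    hankel1 n x * hankel2 n x = ((‖hankel1 n x‖ ^ 2 : ℝ) : ℂ) := by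
  rw [← star_hankel1, Complex.mul_conj, Complex.normSq_eq_norm_sq]

theorem hankel1_add_hankel2 (n : ℕ) (x : ℝ) :
    hankel1 n x + hankel2 n x = 2 * besselJ n x := by
  simp [hankel1, hankel2]
  ring

theorem abs_besselY_le_norm_hankel1 (n : ℕ) (x : ℝ) : |besselY n x| ≤ ‖hankel1 n x‖ := by
  rw [← hankel1_im]; exact Complex.abs_im_le_norm _

theorem hasDerivAt_hankel1 (n : ℕ) {x : ℝ} (hx : 0 < x) :
    HasDerivAt (hankel1 n) (n / x * hankel1 n x - hankel1 (n + 1) x) x := by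
  have h := (hasDerivAt_besselJ n hx).ofReal_comp.add
    ((hasDerivAt_besselY n hx).ofReal_comp.const_mul Complex.I)
  refine h.congr_deriv ?_
  simp only [hankel1]
  push_cast
  ring

theorem hasDerivAt_hankel2 (n : ℕ) {x : ℝ} (hx : 0 < x) :
    HasDerivAt (hankel2 n) (n / x * hankel2 n x - hankel2 (n + 1) x) x := by
  have h := (hasDerivAt_besselJ n hx).ofReal_comp.sub
    ((hasDerivAt_besselY n hx).ofReal_comp.const_mul Complex.I)
  refine h.congr_deriv ?_
  simp only [hankel2]
  push_cast
  ring

theorem hankel1_recurrence (n : ℕ) {x : ℝ} (hx : 0 < x) :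
    2 * ((n : ℂ) + 1) / x * hankel1 (n + 1) x = hankel1 n x + hankel1 (n + 2) x := by
  have h1 : (2 * ((n : ℂ) + 1) / x * besselJ (n + 1) x : ℂ) = besselJ n x + besselJ (n + 2) x := by
    exact_mod_cast congrArg (fun t : ℝ => (t : ℂ)) (besselJ_recurrence n hx)
  have h2 : (2 * ((n : ℂ) + 1) / x * besselY (n + 1) x : ℂ) = besselY n x + besselY (n + 2) x := by
    exact_mod_cast congrArg (fun t : ℝ => (t : ℂ)) (besselY_recurrence n hx)
  simp only [hankel1]
  linear_combination h1 + Complex.I * h2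

theorem hankel_wronskian (n : ℕ) {x : ℝ} (hx : 0 < x) :
    hankel1 (n + 1) x * hankel2 n x - hankel1 n x * hankel2 (n + 1) x
      = -(4 * Complex.I / (Real.pi * x)) := by
  have h : (besselJ (n + 1) x * besselY n x - besselJ n x * besselY (n + 1) x : ℂ)
      = 2 / (Real.pi * x) := by
    exact_mod_cast congrArg (fun t : ℝ => (t : ℂ)) (besselJ_besselY_wronskian n hx)
  simp only [hankel1, hankel2]
  linear_combination (-2 * Complex.I) * h

/-! ### Bounds -/

theorem abs_tsum_pow_le_of_factorial_bound {c : ℕ → ℝ} {K : ℝ}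
    (hc : ∀ k, |c k| ≤ K / k.factorial) (z : ℝ) : |∑' k, c k * z ^ k| ≤ K * Real.exp |z| := by
  have hs : HasSum (fun k : ℕ => K * (|z| ^ k / k.factorial)) (K * Real.exp |z|) := by
    rw [Real.exp_eq_exp_ℝ]
    exact (NormedSpace.expSeries_div_hasSum_exp (𝔸 := ℝ) |z|).mul_left K
  rw [← Real.norm_eq_abs]
  refine tsum_of_norm_bounded hs fun k => ?_
  rw [Real.norm_eq_abs, abs_mul, abs_pow]
  calc |c k| * |z| ^ k ≤ K / k.factorial * |z| ^ k := by gcongr; exact hc k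
    _ = _ := by ring

theorem abs_besselPhi_le (n : ℕ) (z : ℝ) : |besselPhi n z| ≤ Real.exp |z| / n.factorial :=
  (abs_tsum_pow_le_of_factorial_bound (abs_phiCoeff_le n) z).trans (le_of_eq (by ring))

theorem abs_besselChi_le (n : ℕ) (z : ℝ) : |besselChi n z| ≤ 4 * Real.exp |z| :=
  abs_tsum_pow_le_of_factorial_bound (abs_chiCoeff_le n) z

theorem abs_besselJ_le (n : ℕ) {x : ℝ} (hx : 0 ≤ x) :
    |besselJ n x| ≤ (x / 2) ^ n * Real.exp ((x / 2) ^ 2) / n.factorial := by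
  rw [besselJ_eq, abs_mul, abs_of_nonneg (by positivity : 0 ≤ (x / 2) ^ n), mul_div_assoc]
  gcongr
  refine (abs_besselPhi_le n _).trans (le_of_eq ?_)
  rw [abs_of_nonneg (by positivity)]

/-- The logarithm alone forces divergence to `-∞`. The polar part is nonnegative and enters with a
minus sign, so it can only help. -/
theorem tendsto_besselUpsilon_zero (n : ℕ) :
    Tendsto (besselUpsilon n) (𝓝[>] 0) atBot := by
  have h1 : Tendsto (fun z => Real.log z * besselPhi n z) (𝓝[>] 0) atBot := by
    refine Tendsto.atBot_mul_pos (C := besselPhi n 0) ?_ Real.tendsto_log_nhdsGT_zero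
      (((continuous_besselPhi n).tendsto 0).mono_left nhdsWithin_le_nhds)
    rw [besselPhi_zero]
    positivity
  have h2 : Tendsto (fun z => -besselChi n z) (𝓝[>] 0) (𝓝 (-besselChi n 0)) :=
    ((continuous_besselChi n).neg.tendsto 0).mono_left nhdsWithin_le_nhds
  refine tendsto_atBot_mono' _ ?_ (h1.atBot_add h2)
  filter_upwards [self_mem_nhdsWithin] with z hz
  have := besselPolar_nonneg n hz
  rw [besselUpsilon]
  linarith

theorem tendsto_half_sq_nhdsGT_zero :
    Tendsto (fun x : ℝ => (x / 2) ^ 2) (𝓝[>] 0) (𝓝[>] 0) := by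
  refine tendsto_nhdsWithin_iff.2 ⟨?_, ?_⟩
  · have : Continuous fun x : ℝ => (x / 2) ^ 2 := by fun_prop
    simpa using (this.tendsto 0).mono_left (nhdsWithin_le_nhds (s := Set.Ioi 0))
  · filter_upwards [self_mem_nhdsWithin] with x hx
    have : (0 : ℝ) < x := hx
    exact Set.mem_Ioi.2 (by positivity)

/-- Since `|H_n^{(1)}| ≥ |Y_n|`, the ratio is bounded by `|J_n / Y_n| = π |φ_n / υ_n|`. This is what
sends every eigenvalue to `1` at zero frequency. -/
theorem tendsto_besselJ_div_hankel1_zero (n : ℕ) :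
    Tendsto (fun x => (besselJ n x : ℂ) / hankel1 n x) (𝓝[>] 0) (𝓝 0) := by
  have hz := tendsto_half_sq_nhdsGT_zero
  have h1 : Tendsto (fun x : ℝ => Real.pi * besselPhi n ((x / 2) ^ 2) /
      besselUpsilon n ((x / 2) ^ 2)) (𝓝[>] 0) (𝓝 0) :=
    ((((continuous_besselPhi n).const_mul Real.pi).tendsto 0).mono_left
      nhdsWithin_le_nhds |>.div_atBot (tendsto_besselUpsilon_zero n)).comp hz
  have h1' := h1.norm
  rw [norm_zero] at h1'
  refine squeeze_zero_norm' ?_ h1'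
  have h2 : ∀ᶠ x in 𝓝[>] (0 : ℝ), besselUpsilon n ((x / 2) ^ 2) < 0 :=
    ((tendsto_besselUpsilon_zero n).comp hz).eventually_lt_atBot 0
  filter_upwards [self_mem_nhdsWithin, h2] with x hx hu
  have hx' : (0 : ℝ) < x := hx
  have hpi := Real.pi_pos
  have h3 := abs_besselY_le_norm_hankel1 n x
  have h4 : 0 < |besselY n x| := by
    rw [besselY_eq n hx']
    refine abs_pos.2 (mul_ne_zero (by positivity) (mul_ne_zero (by positivity) hu.ne))
  rw [norm_div, Complex.norm_real, Real.norm_eq_abs]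
  refine (div_le_div_of_nonneg_left (abs_nonneg _) h4 h3).trans (le_of_eq ?_)
  rw [← abs_div, besselJ_eq, besselY_eq n hx', Real.norm_eq_abs]
  congr 1
  generalize besselPhi n ((x / 2) ^ 2) = a
  generalize besselUpsilon n ((x / 2) ^ 2) = b
  field_simp

/-- For large order the `k = 0` term `n! z^{-(n+1)}` of the polar part of `Y_{n+1}` dominates the
rest. The threshold for `n` is uniform over `0 < x ≤ X`, which later allows bounds down to `x = 0`.
-/
theorem norm_hankel1_succ_ge (X : ℝ) : ∀ᶠ n : ℕ in atTop, ∀ x : ℝ, 0 < x → x ≤ X →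
    (n.factorial : ℝ) / (2 * Real.pi) * (2 / x) ^ (n + 1) ≤ ‖hankel1 (n + 1) x‖ := by
  set Z : ℝ := max 1 ((X / 2) ^ 2)
  have hZ1 : 1 ≤ Z := le_max_left _ _
  -- The constant `5` is `1` for the logarithmic term plus `4` for the digamma series.
  have hlim : Tendsto (fun n : ℕ => 5 * Real.exp Z * Z ^ 2 * (Z ^ n / n.factorial)) atTop
      (𝓝 (5 * Real.exp Z * Z ^ 2 * 0)) :=
    (FloorSemiring.tendsto_pow_div_factorial_atTop Z).const_mul _
  rw [mul_zero] at hlim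
  filter_upwards [hlim.eventually_lt_const (show (0 : ℝ) < 1 / 2 by norm_num)] with n hn x hx hxX
  have hbig : 5 * Real.exp Z * Z ^ (n + 2) ≤ n.factorial / 2 := by
    have hf : (0 : ℝ) < n.factorial := by positivity
    have : 5 * Real.exp Z * Z ^ 2 * (Z ^ n / n.factorial) =
        5 * Real.exp Z * Z ^ (n + 2) / n.factorial := by ring
    rw [this, div_lt_iff₀ hf] at hn
    linarith
  set z := (x / 2) ^ 2 with hz
  have hz0 : 0 < z := by positivity
  have hzZ : z ≤ Z := le_trans (by rw [hz]; gcongr) (le_max_right _ _)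
  have hexp : Real.exp |z| ≤ Real.exp Z := by rw [abs_of_pos hz0]; gcongr
  -- One factor of `z^{n+1}` is spent on taming the logarithm near `0`.
  have hlog : |Real.log z * z| ≤ Z ^ 2 := by
    rcases le_total z 1 with h | h
    · exact (Real.abs_log_mul_self_lt z hz0 h).le.trans (one_le_pow₀ hZ1)
    · rw [abs_of_nonneg (mul_nonneg (Real.log_nonneg h) hz0.le), sq]
      have := Real.log_le_sub_one_of_pos hz0
      gcongr
      linarith
  have hφ : |z ^ (n + 1) * (Real.log z * besselPhi (n + 1) z)| ≤ Real.exp Z * Z ^ (n + 2) := by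
    rw [show z ^ (n + 1) * (Real.log z * besselPhi (n + 1) z) =
      z ^ n * (Real.log z * z) * besselPhi (n + 1) z by ring, abs_mul, abs_mul,
      abs_of_nonneg (by positivity : 0 ≤ z ^ n)]
    have h1 : |besselPhi (n + 1) z| ≤ Real.exp Z := by
      refine (abs_besselPhi_le (n + 1) z).trans ?_
      refine (div_le_self (by positivity) ?_).trans hexp
      exact_mod_cast Nat.factorial_pos (n + 1)
    calc z ^ n * |Real.log z * z| * |besselPhi (n + 1) z| ≤ Z ^ n * Z ^ 2 * Real.exp Z := by gcongr
      _ = _ := by ring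
  have hχ : |z ^ (n + 1) * besselChi (n + 1) z| ≤ 4 * Real.exp Z * Z ^ (n + 2) := by
    rw [abs_mul, abs_of_nonneg (by positivity : 0 ≤ z ^ (n + 1))]
    have h1 : |besselChi (n + 1) z| ≤ 4 * Real.exp Z :=
      (abs_besselChi_le (n + 1) z).trans (by gcongr)
    calc z ^ (n + 1) * |besselChi (n + 1) z| ≤ Z ^ (n + 2) * (4 * Real.exp Z) := by
          gcongr
          calc z ^ (n + 1) ≤ Z ^ (n + 1) := by gcongr
            _ ≤ Z ^ (n + 2) := pow_le_pow_right₀ hZ1 (by omega)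
      _ = _ := by ring
  have hP : (n.factorial : ℝ) ≤ z ^ (n + 1) * besselPolar (n + 1) z := by
    have h1 : ((n + 1 - 0 - 1).factorial : ℝ) / (Nat.factorial 0 : ℝ) *
        z ^ (((0 : ℕ) : ℤ) - ((n + 1 : ℕ) : ℤ)) ≤ besselPolar (n + 1) z :=
      Finset.single_le_sum (f := fun k : ℕ => ((n + 1 - k - 1).factorial : ℝ) / (k.factorial : ℝ) *
        z ^ ((k : ℤ) - ((n + 1 : ℕ) : ℤ))) (fun k _ => by positivity)
        (Finset.mem_range.2 (Nat.succ_pos n))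
    have h2 := mul_le_mul_of_nonneg_left h1 (by positivity : 0 ≤ z ^ (n + 1))
    refine le_trans (le_of_eq ?_) h2
    rw [Nat.cast_zero, zero_sub, zpow_neg, zpow_natCast]
    simp
    field_simp
  have hU : (n.factorial : ℝ) / 2 ≤ z ^ (n + 1) * |besselUpsilon (n + 1) z| := by
    have h1 := neg_abs_le (besselUpsilon (n + 1) z)
    have h2 : z ^ (n + 1) * besselUpsilon (n + 1) z =
      z ^ (n + 1) * (Real.log z * besselPhi (n + 1) z) - z ^ (n + 1) * besselPolar (n + 1) z -
        z ^ (n + 1) * besselChi (n + 1) z := by rw [besselUpsilon]; ring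
    have h3 := mul_le_mul_of_nonneg_left h1 (by positivity : 0 ≤ z ^ (n + 1))
    have h4 := le_abs_self (z ^ (n + 1) * (Real.log z * besselPhi (n + 1) z))
    have h5 := neg_abs_le (z ^ (n + 1) * besselChi (n + 1) z)
    linarith
  refine le_trans ?_ (abs_besselY_le_norm_hankel1 (n + 1) x)
  have hpi := Real.pi_pos
  rw [besselY_eq _ hx, ← hz, abs_mul, abs_mul, abs_of_pos (by positivity : 0 < 1 / Real.pi),
    abs_of_pos (by positivity : 0 < (x / 2) ^ (n + 1))]
  calc (n.factorial : ℝ) / (2 * Real.pi) * (2 / x) ^ (n + 1)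
      = 1 / Real.pi * ((2 / x) ^ (n + 1) * (n.factorial / 2)) := by field_simp
    _ ≤ 1 / Real.pi * ((2 / x) ^ (n + 1) * (z ^ (n + 1) * |besselUpsilon (n + 1) z|)) := by gcongr
    _ = _ := by
      rw [← mul_assoc ((2 / x) ^ (n + 1)), ← mul_pow, hz,
        show 2 / x * (x / 2) ^ 2 = x / 2 by field_simp]

/-! ### The integral representation of `H_0^{(1)}` -/

/-- The square root `√(2i - t²)` in the first quadrant. -/
def hankelRoot (t : ℝ) : ℂ := Complex.exp (Complex.log (2 * Complex.I - (t : ℂ) ^ 2) / 2)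

theorem two_I_sub_sq_im (t : ℝ) : (2 * Complex.I - (t : ℂ) ^ 2).im = 2 := by
  have h : ((t : ℂ) ^ 2).im = 0 := by rw [← Complex.ofReal_pow, Complex.ofReal_im]
  simp [h]

theorem two_I_sub_sq_mem (t : ℝ) : 2 * Complex.I - (t : ℂ) ^ 2 ∈ Complex.slitPlane :=
  Or.inr (by rw [two_I_sub_sq_im]; norm_num)

theorem hankelRoot_ne_zero (t : ℝ) : hankelRoot t ≠ 0 := Complex.exp_ne_zero _

theorem hankelRoot_sq (t : ℝ) : hankelRoot t ^ 2 = 2 * Complex.I - (t : ℂ) ^ 2 := by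
  rw [hankelRoot, ← Complex.exp_nat_mul]
  push_cast
  rw [mul_div_cancel₀ _ (two_ne_zero), Complex.exp_log (Complex.slitPlane_ne_zero
    (two_I_sub_sq_mem t))]

theorem hankelRoot_re_nonneg (t : ℝ) : 0 ≤ (hankelRoot t).re := by
  rw [hankelRoot, Complex.exp_re]
  refine mul_nonneg (Real.exp_pos _).le (Real.cos_nonneg_of_mem_Icc ?_)
  have h1 := Complex.neg_pi_lt_arg (2 * Complex.I - (t : ℂ) ^ 2)
  have h2 := Complex.arg_le_pi (2 * Complex.I - (t : ℂ) ^ 2)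
  have h3 : (Complex.log (2 * Complex.I - (t : ℂ) ^ 2) / 2).im =
      (2 * Complex.I - (t : ℂ) ^ 2).arg / 2 := by
    rw [← Complex.log_im]
    simp
  rw [h3]
  constructor <;> linarith

theorem hankelRoot_re_mul_im (t : ℝ) : (hankelRoot t).re * (hankelRoot t).im = 1 := by
  have h := congrArg Complex.im (hankelRoot_sq t)
  rw [two_I_sub_sq_im, sq, Complex.mul_im] at h
  linarith

theorem hankelRoot_re_pos (t : ℝ) : 0 < (hankelRoot t).re := by
  rcases (hankelRoot_re_nonneg t).lt_or_eq with h | h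
  · exact h
  · have := hankelRoot_re_mul_im t
    rw [← h, zero_mul] at this
    norm_num at this

theorem hankelRoot_im_pos (t : ℝ) : 0 < (hankelRoot t).im := by
  have h1 := hankelRoot_re_pos t
  have h2 := hankelRoot_re_mul_im t
  by_contra h
  nlinarith

/-- The imaginary part of `2i - t²` is always `2`. The resulting bound `1` on the inverse root lets
pure Gaussians dominate every moment integrand. -/
theorem one_le_norm_hankelRoot (t : ℝ) : 1 ≤ ‖hankelRoot t‖ := by
  have h1 : (2 : ℝ) ≤ ‖hankelRoot t‖ ^ 2 := by
    rw [← norm_pow, hankelRoot_sq, ← two_I_sub_sq_im t]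
    exact (le_abs_self _).trans (Complex.abs_im_le_norm _)
  nlinarith [norm_nonneg (hankelRoot t)]

theorem norm_inv_hankelRoot_le (t : ℝ) : ‖(hankelRoot t)⁻¹‖ ≤ 1 := by
  rw [norm_inv]
  exact inv_le_one_of_one_le₀ (one_le_norm_hankelRoot t)

theorem hasDerivAt_hankelRoot (t : ℝ) : HasDerivAt hankelRoot (-t / hankelRoot t) t := by
  have h1 : HasDerivAt (fun t : ℝ => 2 * Complex.I - (t : ℂ) ^ 2) (-(2 * (t : ℂ))) t := by
    have := ((hasDerivAt_id t).ofReal_comp.pow 2).const_sub (2 * Complex.I)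
    simpa using this
  have h2 := (((HasDerivAt.clog_real h1 (two_I_sub_sq_mem t)).div_const 2).cexp)
  refine h2.congr_deriv ?_
  change hankelRoot t * _ = _
  rw [← hankelRoot_sq]
  have := hankelRoot_ne_zero t
  field_simp

theorem continuous_hankelRoot : Continuous hankelRoot :=
  continuous_iff_continuousAt.2 fun t => (hasDerivAt_hankelRoot t).continuousAt

theorem continuous_inv_hankelRoot : Continuous fun t => (hankelRoot t)⁻¹ :=
  continuous_hankelRoot.inv₀ hankelRoot_ne_zero

theorem hasDerivAt_inv_hankelRoot (t : ℝ) :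
    HasDerivAt (fun t => (hankelRoot t)⁻¹) (t / hankelRoot t ^ 3) t := by
  refine ((hasDerivAt_hankelRoot t).fun_inv (hankelRoot_ne_zero t)).congr_deriv ?_
  have := hankelRoot_ne_zero t
  field_simp

theorem hankelRoot_neg (t : ℝ) : hankelRoot (-t) = hankelRoot t := by simp [hankelRoot]

/-- The derivative `t / hankelRoot t ^ 3` is at most `|t|` in norm. The second-order error turns
into the remainder `O(x^(-3/2))` after Gaussian integration. -/
theorem norm_inv_hankelRoot_sub_le (t : ℝ) :
    ‖(hankelRoot t)⁻¹ - (hankelRoot 0)⁻¹‖ ≤ t ^ 2 := by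
  have h := (convex_uIcc 0 t).norm_image_sub_le_of_norm_hasDerivWithin_le (𝕜 := ℝ)
    (f := fun t => (hankelRoot t)⁻¹) (f' := fun t : ℝ => (t : ℂ) / hankelRoot t ^ 3) (C := |t|)
    (fun s _ => (hasDerivAt_inv_hankelRoot s).hasDerivWithinAt)
    (fun s hs => by
      rw [norm_div, norm_pow, Complex.norm_real, Real.norm_eq_abs]
      have h1 : |s| ≤ |t| := by simpa using Set.abs_sub_left_of_mem_uIcc hs
      exact (div_le_self (abs_nonneg _) (one_le_pow₀ (one_le_norm_hankelRoot s))).trans h1)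
    Set.left_mem_uIcc Set.right_mem_uIcc
  simpa [← sq] using h

/-- The moments `∫ t^(2k) exp(-x t²) (2i - t²)^(-1/2) dt`. -/
def hankelMoment (k : ℕ) (x : ℝ) : ℂ :=
  ∫ t : ℝ, ((t ^ (2 * k) * Real.exp (-x * t ^ 2) : ℝ) : ℂ) * (hankelRoot t)⁻¹

/-! ### Integrability, differentiation and the differential equation of the moments -/

theorem integrable_even_pow_mul_exp (k : ℕ) {x : ℝ} (hx : 0 < x) :
    Integrable fun t : ℝ => t ^ (2 * k) * Real.exp (-x * t ^ 2) := by
  have := integrable_rpow_mul_exp_neg_mul_sq hx (s := ((2 * k : ℕ) : ℝ))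
    (by have : (0 : ℝ) ≤ ((2 * k : ℕ) : ℝ) := Nat.cast_nonneg _
        linarith)
  simpa only [Real.rpow_natCast] using this

theorem integrable_hankelMoment (k : ℕ) {x : ℝ} (hx : 0 < x) : Integrable fun t : ℝ =>
    ((t ^ (2 * k) * Real.exp (-x * t ^ 2) : ℝ) : ℂ) * (hankelRoot t)⁻¹ :=
  (integrable_even_pow_mul_exp k hx).ofReal.mul_bdd (c := 1)
    continuous_inv_hankelRoot.aestronglyMeasurable (ae_of_all _ norm_inv_hankelRoot_le)

theorem hasDerivAt_hankelMoment (k : ℕ) {x : ℝ} (hx : 0 < x) :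
    HasDerivAt (hankelMoment k) (-hankelMoment (k + 1) x) x := by
  have h := (hasDerivAt_integral_of_dominated_loc_of_deriv_le (μ := volume) (𝕜 := ℝ)
    (F := fun (x t : ℝ) => ((t ^ (2 * k) * Real.exp (-x * t ^ 2) : ℝ) : ℂ) * (hankelRoot t)⁻¹)
    (F' := fun (x t : ℝ) => -(((t ^ (2 * (k + 1)) * Real.exp (-x * t ^ 2) : ℝ) : ℂ) *
      (hankelRoot t)⁻¹))
    (bound := fun t => t ^ (2 * (k + 1)) * Real.exp (-(x / 2) * t ^ 2)) (x₀ := x)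
    (Ioi_mem_nhds (by linarith : x / 2 < x)) ?_ (integrable_hankelMoment k hx) ?_ ?_
    (integrable_even_pow_mul_exp (k + 1) (by positivity)) ?_).2
  · refine h.congr_deriv ?_
    rw [hankelMoment, ← integral_neg]
  · filter_upwards [lt_mem_nhds hx] with y hy
    exact (integrable_hankelMoment k hy).aestronglyMeasurable
  · exact (integrable_hankelMoment (k + 1) hx).aestronglyMeasurable.neg
  · refine ae_of_all _ fun t y hy => ?_
    have hy' : x / 2 < y := hy
    rw [norm_neg, norm_mul, Complex.norm_real, Real.norm_eq_abs, abs_mul, pow_mul,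
      abs_of_nonneg (by positivity : 0 ≤ (t ^ 2) ^ (k + 1)), Real.abs_exp]
    calc (t ^ 2) ^ (k + 1) * Real.exp (-y * t ^ 2) * ‖(hankelRoot t)⁻¹‖
        ≤ (t ^ 2) ^ (k + 1) * Real.exp (-(x / 2) * t ^ 2) * 1 := by
          gcongr
          exact norm_inv_hankelRoot_le t
      _ = _ := mul_one _
  · refine ae_of_all _ fun t y _ => ?_
    have h1 : HasDerivAt (fun y : ℝ => t ^ (2 * k) * Real.exp (-y * t ^ 2))
        (-(t ^ (2 * (k + 1)) * Real.exp (-y * t ^ 2))) y := by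
      have h2 : HasDerivAt (fun y : ℝ => -y * t ^ 2) (-1 * t ^ 2) y :=
        ((hasDerivAt_id y).neg).mul_const _
      refine (h2.exp.const_mul (t ^ (2 * k))).congr_deriv ?_
      ring
    refine (h1.ofReal_comp.mul_const ((hankelRoot t)⁻¹)).congr_deriv ?_
    push_cast
    ring

/-- The integrand is half the derivative of `exp(-x t²) t √(2i - t²)`, whose integral over the line
vanishes. With `M' = -M_1` and `M'' = M_2` for `M = hankelMoment 0`, the relation is Bessel's
equation of order `0` for `e^{ix} M`. -/
theorem hankelMoment_ode {x : ℝ} (hx : 0 < x) :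
    x * hankelMoment 2 x - 2 * Complex.I * x * hankelMoment 1 x - hankelMoment 1 x +
      Complex.I * hankelMoment 0 x = 0 := by
  have i0 := integrable_hankelMoment 0 hx
  have i1 := integrable_hankelMoment 1 hx
  have i2 := integrable_hankelMoment 2 hx
  have hd : ∀ t : ℝ, HasDerivAt (fun t : ℝ => ((Real.exp (-x * t ^ 2) : ℝ) : ℂ) *
      (t * hankelRoot t)) (2 * (x * (((t ^ (2 * 2) * Real.exp (-x * t ^ 2) : ℝ) : ℂ) *
        (hankelRoot t)⁻¹) - (2 * Complex.I * x + 1) *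
        (((t ^ (2 * 1) * Real.exp (-x * t ^ 2) : ℝ) : ℂ) * (hankelRoot t)⁻¹) + Complex.I *
        (((t ^ (2 * 0) * Real.exp (-x * t ^ 2) : ℝ) : ℂ) * (hankelRoot t)⁻¹))) t := by
    intro t
    have h1 : HasDerivAt (fun t : ℝ => Real.exp (-x * t ^ 2))
        (Real.exp (-x * t ^ 2) * (-x * (2 * t))) t := by
      have := ((hasDerivAt_pow 2 t).const_mul (-x)).exp
      simpa using this
    have h2 := h1.ofReal_comp.fun_mul
      (((hasDerivAt_id t).ofReal_comp).fun_mul (hasDerivAt_hankelRoot t))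
    refine h2.congr_deriv ?_
    have hne := hankelRoot_ne_zero t
    have hsq := hankelRoot_sq t
    push_cast
    simp only [id]
    field_simp
    linear_combination (1 - 2 * x * t ^ 2) * hsq
  have hI := ((i2.const_mul (x : ℂ)).sub (i1.const_mul (2 * Complex.I * x + 1))).add
    (i0.const_mul Complex.I)
  have hb : Integrable fun t : ℝ => ((Real.exp (-x * t ^ 2) : ℝ) : ℂ) * (t * hankelRoot t) := by
    -- The root is rewritten as `(2i - t²)` times its bounded inverse, so that integrability reduces
    -- to odd Gaussian moments.
    have h1 : Integrable fun t : ℝ => ((1 * (2 * Complex.I *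
      (((t * Real.exp (-x * t ^ 2) : ℝ) : ℂ))) - (((t ^ (3 : ℕ) * Real.exp (-x * t ^ 2) : ℝ) : ℂ))) *
        (hankelRoot t)⁻¹) := by
      refine Integrable.mul_bdd (c := 1) (Integrable.sub ?_ ?_)
        continuous_inv_hankelRoot.aestronglyMeasurable (ae_of_all _ norm_inv_hankelRoot_le)
      · exact ((integrable_mul_exp_neg_mul_sq hx).ofReal.const_mul _).const_mul _
      · have := integrable_rpow_mul_exp_neg_mul_sq hx (s := ((3 : ℕ) : ℝ)) (by norm_num)
        simp only [Real.rpow_natCast] at this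
        exact this.ofReal
    refine h1.congr (ae_of_all _ fun t => ?_)
    have hne := hankelRoot_ne_zero t
    have hsq := hankelRoot_sq t
    simp only
    push_cast
    field_simp
    linear_combination -(t : ℂ) * hsq
  have h := integral_eq_zero_of_hasDerivAt_of_integrable hd (hI.const_mul 2) hb
  rw [integral_const_mul, integral_add, integral_sub, integral_const_mul, integral_const_mul,
    integral_const_mul] at h
  · simp only [hankelMoment]
    linear_combination h / 2
  · exact i2.const_mul _
  · exact i1.const_mul _
  · exact (i2.const_mul _).sub (i1.const_mul _)
  · exact i0.const_mul _

/-! ### Behaviour of the moments at infinity -/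

theorem integral_sq_mul_exp_neg_mul_sq {x : ℝ} (hx : 0 < x) :
    ∫ t : ℝ, t ^ 2 * Real.exp (-x * t ^ 2) = Real.Gamma (3 / 2) * x ^ (-(3 / 2) : ℝ) := by
  have h1 := integral_comp_abs (f := fun t : ℝ => t ^ (2 : ℝ) * Real.exp (-x * t ^ (2 : ℝ)))
  rw [integral_rpow_mul_exp_neg_mul_rpow (by norm_num) (by norm_num) hx] at h1
  have h2 : ∀ t : ℝ, |t| ^ (2 : ℝ) = t ^ 2 := fun t => by
    rw [show (2 : ℝ) = ((2 : ℕ) : ℝ) by norm_num, Real.rpow_natCast, sq_abs]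
  simp only [h2] at h1
  rw [h1]
  norm_num
  ring

theorem norm_hankelMoment_one_le {x : ℝ} (hx : 0 < x) :
    ‖hankelMoment 1 x‖ ≤ Real.Gamma (3 / 2) * x ^ (-(3 / 2) : ℝ) := by
  rw [← integral_sq_mul_exp_neg_mul_sq hx]
  refine norm_integral_le_of_norm_le (integrable_even_pow_mul_exp 1 hx) (ae_of_all _ fun t => ?_)
  simp only [mul_one]
  rw [norm_mul, Complex.norm_real, Real.norm_of_nonneg (by positivity)]
  exact mul_le_of_le_one_right (by positivity) (norm_inv_hankelRoot_le t)

theorem norm_hankelMoment_zero_sub_le {x : ℝ} (hx : 0 < x) :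
    ‖hankelMoment 0 x - (Real.sqrt (Real.pi / x) : ℂ) * (hankelRoot 0)⁻¹‖ ≤
      Real.Gamma (3 / 2) * x ^ (-(3 / 2) : ℝ) := by
  have h1 : Integrable fun t : ℝ => ((t ^ (2 * 0) * Real.exp (-x * t ^ 2) : ℝ) : ℂ) :=
    (integrable_even_pow_mul_exp 0 hx).ofReal
  have h2 : (Real.sqrt (Real.pi / x) : ℂ) * (hankelRoot 0)⁻¹ =
      ∫ t : ℝ, ((t ^ (2 * 0) * Real.exp (-x * t ^ 2) : ℝ) : ℂ) * (hankelRoot 0)⁻¹ := by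
    rw [integral_mul_const, ← integral_gaussian]
    simp only [mul_zero, pow_zero, one_mul]
    rw [integral_complex_ofReal]
  rw [h2, hankelMoment, ← integral_sub (integrable_hankelMoment 0 hx) (h1.mul_const _),
    ← integral_sq_mul_exp_neg_mul_sq hx]
  refine norm_integral_le_of_norm_le (integrable_even_pow_mul_exp 1 hx) (ae_of_all _ fun t => ?_)
  simp only [mul_zero, pow_zero, one_mul]
  rw [← mul_sub, norm_mul, Complex.norm_real, Real.norm_of_nonneg (by positivity), mul_comm]
  gcongr
  exact norm_inv_hankelRoot_sub_le t

theorem hankelRoot_zero : hankelRoot 0 = Real.sqrt 2 * Complex.exp (Real.pi * Complex.I / 4) := by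
  have h : Complex.log (2 * Complex.I) = Real.log 2 + Real.pi / 2 * Complex.I := by
    have := Complex.log_ofReal_mul (r := 2) (x := Complex.I) (by norm_num) Complex.I_ne_zero
    rw [Complex.log_I] at this
    exact_mod_cast this
  rw [hankelRoot, Complex.ofReal_zero, zero_pow (by norm_num), sub_zero, h, add_div,
    Complex.exp_add]
  congr 1
  · rw [← Real.exp_log (show (0 : ℝ) < Real.sqrt 2 by positivity), Real.log_sqrt (by norm_num)]
    push_cast
    rfl
  · congr 1
    ring

/-! ### Logarithmic behaviour of the zeroth moment at the origin -/

theorem integral_log_mul_exp_neg :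
    ∫ s in Set.Ioi (0 : ℝ), Real.log s * Real.exp (-s) = -Real.eulerMascheroniConstant := by
  -- Differentiating Euler's integral at `s = 1` produces the logarithmic integral, and `Γ'(1) = -γ`
  -- evaluates it.
  have h1 := Complex.hasDerivAt_GammaIntegral (s := 1) (by norm_num)
  have h2 : HasDerivAt Complex.GammaIntegral (-(Real.eulerMascheroniConstant : ℂ)) 1 := by
    refine Complex.hasDerivAt_Gamma_one.congr_of_eventuallyEq ?_
    have : {s : ℂ | 0 < s.re} ∈ 𝓝 (1 : ℂ) :=
      (isOpen_lt continuous_const Complex.continuous_re).mem_nhds (by simp)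
    filter_upwards [this] with s hs using (Complex.Gamma_eq_integral hs).symm
  have h3 := h1.unique h2
  have h4 : ∫ t in Set.Ioi (0 : ℝ), (t : ℂ) ^ ((1 : ℂ) - 1) * (Real.log t * Real.exp (-t)) =
      ((∫ s in Set.Ioi (0 : ℝ), Real.log s * Real.exp (-s) : ℝ) : ℂ) := by
    rw [← integral_complex_ofReal]
    refine setIntegral_congr_fun measurableSet_Ioi fun t _ => ?_
    simp
  rw [h4] at h3
  exact_mod_cast h3

/-- A non-integrable function would have Bochner integral `0`, whereas the value just found is `-γ ≠
0`. -/
theorem integrableOn_log_mul_exp_neg :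
    IntegrableOn (fun s => Real.log s * Real.exp (-s)) (Set.Ioi 0) := by
  by_contra h
  have h1 := integral_undef h
  rw [integral_log_mul_exp_neg] at h1
  have := Real.one_half_lt_eulerMascheroniConstant
  linarith

/-- The substitutions `y = t²` and `s = x y` reduce it to the previous logarithmic integral, using
`log t = (log s - log x) / 2`. -/
theorem integral_mul_exp_neg_mul_sq_log {x : ℝ} (hx : 0 < x) :
    ∫ t in Set.Ioi (0 : ℝ), 2 * x * t * Real.exp (-x * t ^ 2) * Real.log t =
      -(Real.eulerMascheroniConstant + Real.log x) / 2 := by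
  set g : ℝ → ℝ := fun y => x * (Real.log y / 2 * Real.exp (-(x * y)))
  set k : ℝ → ℝ := fun s => (Real.log s - Real.log x) / 2 * Real.exp (-s)
  have h1 := integral_comp_rpow_Ioi_of_pos (g := g) (p := 2) (by norm_num)
  have h2 := integral_comp_mul_left_Ioi k 0 hx
  have h3 : ∫ y in Set.Ioi (0 : ℝ), g y = x * ∫ y in Set.Ioi (0 : ℝ), k (x * y) := by
    rw [← integral_const_mul]
    refine setIntegral_congr_fun measurableSet_Ioi fun y hy => ?_
    have hy' : (0 : ℝ) < y := hy
    simp only [g, k]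
    rw [Real.log_mul hx.ne' hy'.ne', add_sub_cancel_left]
  have h4 : ∫ s in Set.Ioi (0 : ℝ), k s =
      -(Real.eulerMascheroniConstant + Real.log x) / 2 := by
    have e1 : ∀ s, k s = 1 / 2 * (Real.log s * Real.exp (-s)) -
        Real.log x / 2 * Real.exp (-s) := fun s => by simp only [k]; ring
    simp only [e1]
    rw [integral_sub (integrableOn_log_mul_exp_neg.const_mul _)
      ((integrableOn_exp_neg_Ioi 0).const_mul _), integral_const_mul, integral_const_mul,
      integral_log_mul_exp_neg, integral_exp_neg_Ioi_zero]
    ring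
  rw [mul_zero, smul_eq_mul, h4] at h2
  rw [h2, ← mul_assoc, mul_inv_cancel₀ hx.ne', one_mul] at h3
  rw [← h3, ← h1]
  refine setIntegral_congr_fun measurableSet_Ioi fun t ht => ?_
  have ht' : (0 : ℝ) < t := ht
  simp only [g, smul_eq_mul]
  rw [show (2 : ℝ) - 1 = 1 by norm_num, Real.rpow_one, show (2 : ℝ) = ((2 : ℕ) : ℝ) by norm_num,
    Real.rpow_natCast, Real.log_pow]
  push_cast
  rw [neg_mul]
  ring

theorem integrableOn_mul_exp_neg_mul_sq_log {x : ℝ} (hx : 0 < x) :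
    IntegrableOn (fun t => 2 * x * t * Real.exp (-x * t ^ 2) * Real.log t) (Set.Ioi 0) := by
  have h0 := (integrable_even_pow_mul_exp 0 hx).add (integrable_even_pow_mul_exp 1 hx)
  refine Integrable.mono' (h0.const_mul (2 * x)).integrableOn
    (Measurable.aestronglyMeasurable (by fun_prop)) ?_
  refine (ae_restrict_mem measurableSet_Ioi).mono fun t ht => ?_
  have ht' : (0 : ℝ) < t := ht
  have hl : |Real.log t * t| ≤ 1 + t ^ 2 := by
    rcases le_total t 1 with h | h
    · exact (Real.abs_log_mul_self_lt t ht' h).le.trans (by nlinarith)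
    · rw [abs_of_nonneg (mul_nonneg (Real.log_nonneg h) ht'.le)]
      nlinarith [Real.log_le_sub_one_of_pos ht']
  rw [show 2 * x * t * Real.exp (-x * t ^ 2) * Real.log t =
    2 * x * Real.exp (-x * t ^ 2) * (Real.log t * t) by ring, norm_mul, Real.norm_eq_abs,
    abs_of_nonneg (by positivity), Real.norm_eq_abs]
  simp only [mul_zero, pow_zero, one_mul, mul_one, Pi.add_apply]
  calc 2 * x * Real.exp (-x * t ^ 2) * |Real.log t * t|
      ≤ 2 * x * Real.exp (-x * t ^ 2) * (1 + t ^ 2) := by gcongr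
    _ = _ := by ring

/-- The primitive of `(2i - t²)^(-1/2)` on `[0, ∞)` that vanishes at `0`. -/
def hankelPrimitive (t : ℝ) : ℂ :=
  -Complex.I * (Complex.log (t - Complex.I * hankelRoot t) -
    Complex.log (-Complex.I * hankelRoot 0))

theorem hankelPrimitive_zero : hankelPrimitive 0 = 0 := by simp [hankelPrimitive]

theorem sub_I_mul_hankelRoot_re (t : ℝ) :
    ((t : ℂ) - Complex.I * hankelRoot t).re = t + (hankelRoot t).im := by
  simp

/-- For `t ≥ 0` the real part of `t - i√(2i - t²)` is `t` plus the positive imaginary part of the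
root, so the argument of the logarithm never meets the cut. -/
theorem hasDerivAt_hankelPrimitive {t : ℝ} (ht : 0 ≤ t) :
    HasDerivAt hankelPrimitive ((hankelRoot t)⁻¹) t := by
  have hmem : (t : ℂ) - Complex.I * hankelRoot t ∈ Complex.slitPlane := by
    left
    rw [sub_I_mul_hankelRoot_re]
    have := hankelRoot_im_pos t
    linarith
  have h1 : HasDerivAt (fun t : ℝ => (t : ℂ) - Complex.I * hankelRoot t)
      (1 - Complex.I * (-t / hankelRoot t)) t :=
    ((hasDerivAt_id t).ofReal_comp).sub ((hasDerivAt_hankelRoot t).const_mul _)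
  have h2 := ((HasDerivAt.clog_real h1 hmem).sub_const
    (Complex.log (-Complex.I * hankelRoot 0))).const_mul (-Complex.I)
  refine h2.congr_deriv ?_
  have h3 := Complex.slitPlane_ne_zero hmem
  have h4 := hankelRoot_ne_zero t
  field_simp
  linear_combination -(t : ℂ) * Complex.I_sq

theorem norm_hankelPrimitive_le {t : ℝ} (ht : 0 ≤ t) : ‖hankelPrimitive t‖ ≤ t := by
  have h := (convex_Icc 0 t).norm_image_sub_le_of_norm_hasDerivWithin_le (𝕜 := ℝ)
    (f := hankelPrimitive) (f' := fun t : ℝ => (hankelRoot t)⁻¹) (C := 1)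
    (fun s hs => (hasDerivAt_hankelPrimitive hs.1).hasDerivWithinAt)
    (fun s _ => norm_inv_hankelRoot_le s)
    (Set.left_mem_Icc.2 ht) (Set.right_mem_Icc.2 ht)
  simpa [hankelPrimitive_zero, abs_of_nonneg ht] using h

/-- The constant in the asymptotics of `hankelPrimitive`. -/
def hankelConst : ℂ := Real.log 2 / 2 + Real.pi * Complex.I / 4

theorem log_neg_I_mul_hankelRoot_zero :
    Complex.log (-Complex.I * hankelRoot 0) = Real.log 2 - hankelConst := by
  have h : -Complex.I = Complex.exp (-(Real.pi / 2 * Complex.I)) := by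
    rw [Complex.exp_neg, Complex.exp_pi_div_two_mul_I, Complex.inv_I]
  have h2 : -Complex.I * hankelRoot 0 = ((Real.sqrt 2 : ℝ) : ℂ) *
      Complex.exp (-(Real.pi / 4 : ℝ) * Complex.I) := by
    rw [hankelRoot_zero, h, mul_left_comm, ← Complex.exp_add]
    congr 2
    push_cast
    ring
  have hpi := Real.pi_pos
  rw [h2, Complex.log_ofReal_mul (by positivity) (Complex.exp_ne_zero _), Complex.log_exp,
    Real.log_sqrt (by norm_num), hankelConst]
  · push_cast
    ring
  · simp
    linarith
  · simp
    linarith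

/-- For `t ≤ 2` crude bounds suffice. For `t ≥ 2` the argument of the logarithm is `2t(1 + w)` with
`|w| ≤ 1/t²`, so the error is `log(1 + w)`. The constant `10` is not optimised. -/
theorem norm_hankelPrimitive_add_le {t : ℝ} (ht : 0 < t) :
    ‖hankelPrimitive t + Complex.I * (Real.log t + hankelConst)‖ ≤ 10 / t := by
  rcases le_total t 2 with h | h
  · have h1 := norm_hankelPrimitive_le ht.le
    have h2 : ‖hankelConst‖ ≤ 3 / 2 := by
      refine (norm_add_le _ _).trans ?_
      have e1 : ‖(Real.log 2 / 2 : ℂ)‖ ≤ 1 / 2 := by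
        rw [norm_div, Complex.norm_real, Real.norm_of_nonneg (Real.log_nonneg (by norm_num))]
        have := Real.log_two_lt_d9
        norm_num at *
        linarith
      have e2 : ‖(Real.pi * Complex.I / 4 : ℂ)‖ ≤ 1 := by
        have := Real.pi_lt_four
        simp [abs_of_pos Real.pi_pos]
        linarith
      linarith
    have h3 : |Real.log t| ≤ 1 / t + 1 := by
      have e1 := Real.log_le_sub_one_of_pos ht
      have e2 := Real.one_sub_inv_le_log_of_pos ht
      have e3 : 0 < t⁻¹ := by positivity
      rw [one_div, abs_le]
      constructor <;> linarith
    have h4 : ‖Complex.I * ((Real.log t : ℂ) + hankelConst)‖ ≤ 1 / t + 1 + 3 / 2 := by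
      rw [norm_mul, Complex.norm_I, one_mul]
      refine (norm_add_le _ _).trans ?_
      rw [Complex.norm_real, Real.norm_eq_abs]
      linarith
    refine (norm_add_le _ _).trans ?_
    have h5 : 9 / t = 10 / t - 1 / t := by ring
    have h6 : 9 / 2 ≤ 9 / t := by
      rw [le_div_iff₀ ht]
      linarith
    linarith
  · set s : ℂ := (t : ℂ) - Complex.I * hankelRoot t with hs
    have ht0 : (t : ℂ) ≠ 0 := by exact_mod_cast ht.ne'
    have hre : t ≤ ‖s‖ := by
      have h1 := Complex.re_le_norm s
      rw [hs, sub_I_mul_hankelRoot_re] at h1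
      have := hankelRoot_im_pos t
      linarith
    set w : ℂ := (-Complex.I * hankelRoot t - t) / (2 * t) with hw
    have hsw : s = ((2 * t : ℝ) : ℂ) * (1 + w) := by
      rw [hs, hw]
      push_cast
      field_simp
      ring
    -- Multiplying by the conjugate expression: `(-iρ - t)(t - iρ) = -ρ² - t² = -2i` for the root
    -- `ρ`.
    have hmul : w * s = -Complex.I / t := by
      rw [hs, hw]
      field_simp
      linear_combination (hankelRoot t) ^ 2 * Complex.I_sq - hankelRoot_sq t
    have hwn : ‖w‖ ≤ 1 / t / t := by
      have h1 : ‖w‖ * ‖s‖ = 1 / t := by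
        rw [← norm_mul, hmul, norm_div, norm_neg, Complex.norm_I, Complex.norm_real,
          Real.norm_of_nonneg ht.le]
      rw [le_div_iff₀ ht, ← h1]
      gcongr
    have hw2 : ‖w‖ ≤ 1 / 2 := by
      refine hwn.trans ?_
      rw [div_div, div_le_div_iff₀ (by positivity) (by norm_num)]
      nlinarith
    have h1w : 1 + w ≠ 0 := by
      intro h0
      rw [h0, mul_zero] at hsw
      rw [hsw, norm_zero] at hre
      linarith
    have h2 : hankelPrimitive t + Complex.I * (Real.log t + hankelConst) =
        -Complex.I * Complex.log (1 + w) := by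
      rw [hankelPrimitive, ← hs, hsw, Complex.log_ofReal_mul (by positivity) h1w,
        Real.log_mul (by norm_num) ht.ne', log_neg_I_mul_hankelRoot_zero]
      push_cast
      ring
    rw [h2, norm_mul, norm_neg, Complex.norm_I, one_mul]
    refine (Complex.norm_log_one_add_half_le_self hw2).trans ?_
    calc 3 / 2 * ‖w‖ ≤ 3 / 2 * (1 / t / t) := by gcongr
      _ ≤ 3 / 2 * (1 / t / 1) := by gcongr; linarith
      _ ≤ 10 / t := by
        rw [div_one, ← mul_div_assoc]
        gcongr
        norm_num

/-- Evenness folds the integral onto the half-line, and integration by parts replaces the inverse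
root by its primitive. The new weight `2xt exp(-x t²)` has total mass `1`, which suits the limit `x
→ 0`. -/
theorem hankelMoment_zero_eq {x : ℝ} (hx : 0 < x) :
    hankelMoment 0 x = 2 * ∫ t in Set.Ioi (0 : ℝ),
      ((2 * x * t * Real.exp (-x * t ^ 2) : ℝ) : ℂ) * hankelPrimitive t ∧
    IntegrableOn (fun t : ℝ => ((2 * x * t * Real.exp (-x * t ^ 2) : ℝ) : ℂ) * hankelPrimitive t)
      (Set.Ioi 0) := by
  have hI : IntegrableOn (fun t : ℝ => ((2 * x * t * Real.exp (-x * t ^ 2) : ℝ) : ℂ) *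
      hankelPrimitive t) (Set.Ioi 0) := by
    refine Integrable.mono' ((integrable_even_pow_mul_exp 1 hx).const_mul (2 * x)).integrableOn
      ?_ ?_
    · refine ContinuousOn.aestronglyMeasurable (ContinuousOn.mul (Continuous.continuousOn
        (by fun_prop)) fun t ht => ?_) measurableSet_Ioi
      exact (hasDerivAt_hankelPrimitive (le_of_lt ht)).continuousAt.continuousWithinAt
    · refine (ae_restrict_mem measurableSet_Ioi).mono fun t ht => ?_
      have ht' : (0 : ℝ) < t := ht
      rw [norm_mul, Complex.norm_real, Real.norm_of_nonneg (by positivity)]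
      calc _ ≤ 2 * x * t * Real.exp (-x * t ^ 2) * t := by
            gcongr
            exact norm_hankelPrimitive_le ht'.le
        _ = _ := by ring
  refine ⟨?_, hI⟩
  have h0 := integrable_hankelMoment 0 hx
  have h1 : hankelMoment 0 x = 2 * ∫ t in Set.Ioi (0 : ℝ),
      ((t ^ (2 * 0) * Real.exp (-x * t ^ 2) : ℝ) : ℂ) * (hankelRoot t)⁻¹ := by
    rw [hankelMoment, ← intervalIntegral.integral_Iic_add_Ioi h0.integrableOn h0.integrableOn
      (b := 0)]
    have := integral_comp_neg_Ioi (0 : ℝ) fun t : ℝ =>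
      ((t ^ (2 * 0) * Real.exp (-x * t ^ 2) : ℝ) : ℂ) * (hankelRoot t)⁻¹
    rw [neg_zero] at this
    rw [← this]
    simp only [neg_sq, even_two_mul, Even.neg_pow, hankelRoot_neg]
    ring
  rw [h1]
  congr 1
  have hd : ∀ t ∈ Set.Ici (0 : ℝ), HasDerivAt
      (fun t : ℝ => ((Real.exp (-x * t ^ 2) : ℝ) : ℂ) * hankelPrimitive t)
      (((t ^ (2 * 0) * Real.exp (-x * t ^ 2) : ℝ) : ℂ) * (hankelRoot t)⁻¹ -
        ((2 * x * t * Real.exp (-x * t ^ 2) : ℝ) : ℂ) * hankelPrimitive t) t := by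
    intro t ht
    have h1 : HasDerivAt (fun t : ℝ => Real.exp (-x * t ^ 2))
        (Real.exp (-x * t ^ 2) * (-x * (2 * t))) t := by
      have := ((hasDerivAt_pow 2 t).const_mul (-x)).exp
      simpa using this
    refine (h1.ofReal_comp.fun_mul (hasDerivAt_hankelPrimitive ht)).congr_deriv ?_
    push_cast
    ring
  have hlim : Tendsto (fun t : ℝ => ((Real.exp (-x * t ^ 2) : ℝ) : ℂ) * hankelPrimitive t)
      atTop (𝓝 0) := by
    have h2 := (rpow_mul_exp_neg_mul_sq_isLittleO_exp_neg hx 1).isBigO.trans_tendsto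
      (by
        have := Real.tendsto_exp_neg_atTop_nhds_zero.comp
          (tendsto_id.const_mul_atTop (show (0 : ℝ) < 1 / 2 by norm_num))
        simpa [Function.comp_def] using this)
    refine squeeze_zero_norm' ?_ h2
    filter_upwards [eventually_ge_atTop 0] with t ht
    rw [norm_mul, Complex.norm_real, Real.norm_of_nonneg (by positivity), Real.rpow_one, mul_comm]
    gcongr
    exact norm_hankelPrimitive_le ht
  have h2 := integral_Ioi_of_hasDerivAt_of_tendsto' hd (h0.integrableOn.sub hI) hlim
  rw [integral_sub h0.integrableOn hI, hankelPrimitive_zero] at h2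
  simpa [sub_eq_zero] using h2

/-- The primitive is replaced by its asymptotic form `-i(log t + const)`, whose integral is
explicit. The error `10/t` integrated against `2xt exp(-x t²)`, with the outer factor `2`, gives `20
√(πx)`. -/
theorem norm_hankelMoment_zero_small {x : ℝ} (hx : 0 < x) :
    ‖hankelMoment 0 x - (Complex.I * (Real.eulerMascheroniConstant + Real.log x) -
      2 * Complex.I * hankelConst)‖ ≤ 20 * Real.sqrt (Real.pi * x) := by
  obtain ⟨h1, hI⟩ := hankelMoment_zero_eq hx
  have i1 : IntegrableOn (fun t : ℝ =>
      ((2 * x * t * Real.exp (-x * t ^ 2) * Real.log t : ℝ) : ℂ)) (Set.Ioi 0) :=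
    (integrableOn_mul_exp_neg_mul_sq_log hx).ofReal
  have i2 : IntegrableOn (fun t : ℝ => ((2 * x * t * Real.exp (-x * t ^ 2) : ℝ) : ℂ))
      (Set.Ioi 0) := by
    have : Integrable fun t : ℝ => ((2 * x * (t * Real.exp (-x * t ^ 2)) : ℝ) : ℂ) :=
      ((integrable_mul_exp_neg_mul_sq hx).const_mul (2 * x)).ofReal
    refine (this.integrableOn).congr_fun (fun t _ => ?_) measurableSet_Ioi
    push_cast
    ring
  have e1 : ∫ t in Set.Ioi (0 : ℝ), ((2 * x * t * Real.exp (-x * t ^ 2) * Real.log t : ℝ) : ℂ) =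
      -(Real.eulerMascheroniConstant + Real.log x) / 2 := by
    rw [integral_complex_ofReal, integral_mul_exp_neg_mul_sq_log hx]
    push_cast
    ring
  have e2 : ∫ t in Set.Ioi (0 : ℝ), ((2 * x * t * Real.exp (-x * t ^ 2) : ℝ) : ℂ) = 1 := by
    have := integral_mul_cexp_neg_mul_sq (b := x) (by simpa using hx)
    have e3 : ∀ t : ℝ, ((2 * x * t * Real.exp (-x * t ^ 2) : ℝ) : ℂ) =
      2 * x * ((t : ℂ) * Complex.exp (-x * (t : ℂ) ^ 2)) := fun t => by push_cast; ring
    simp only [e3]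
    rw [integral_const_mul, this]
    have : (x : ℂ) ≠ 0 := by exact_mod_cast hx.ne'
    field_simp
  have e4 : hankelMoment 0 x - (Complex.I * (Real.eulerMascheroniConstant + Real.log x) -
      2 * Complex.I * hankelConst) = 2 * ∫ t in Set.Ioi (0 : ℝ),
      ((2 * x * t * Real.exp (-x * t ^ 2) : ℝ) : ℂ) *
        (hankelPrimitive t + Complex.I * (Real.log t + hankelConst)) := by
    have e5 : ∀ t : ℝ, ((2 * x * t * Real.exp (-x * t ^ 2) : ℝ) : ℂ) *
        (hankelPrimitive t + Complex.I * (Real.log t + hankelConst)) =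
        ((2 * x * t * Real.exp (-x * t ^ 2) : ℝ) : ℂ) * hankelPrimitive t + (Complex.I *
        ((2 * x * t * Real.exp (-x * t ^ 2) * Real.log t : ℝ) : ℂ) +
        (Complex.I * hankelConst) * ((2 * x * t * Real.exp (-x * t ^ 2) : ℝ) : ℂ)) := fun t => by
      push_cast; ring
    have i3 : IntegrableOn (fun t : ℝ => Complex.I *
        ((2 * x * t * Real.exp (-x * t ^ 2) * Real.log t : ℝ) : ℂ) +
        (Complex.I * hankelConst) * ((2 * x * t * Real.exp (-x * t ^ 2) : ℝ) : ℂ)) (Set.Ioi 0) :=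
      (i1.const_mul _).add (i2.const_mul _)
    simp only [e5]
    rw [integral_add hI i3, integral_add (i1.const_mul _) (i2.const_mul _), integral_const_mul,
      integral_const_mul, e1, e2, h1]
    ring
  rw [e4, norm_mul]
  have e6 : ‖∫ t in Set.Ioi (0 : ℝ), ((2 * x * t * Real.exp (-x * t ^ 2) : ℝ) : ℂ) *
        (hankelPrimitive t + Complex.I * (Real.log t + hankelConst))‖ ≤
      ∫ t in Set.Ioi (0 : ℝ), 20 * x * Real.exp (-x * t ^ 2) := by
    refine norm_integral_le_of_norm_le
      ((integrable_exp_neg_mul_sq hx).const_mul (20 * x)).integrableOn ?_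
    refine (ae_restrict_mem measurableSet_Ioi).mono fun t ht => ?_
    have ht' : (0 : ℝ) < t := ht
    rw [norm_mul, Complex.norm_real, Real.norm_of_nonneg (by positivity)]
    calc _ ≤ 2 * x * t * Real.exp (-x * t ^ 2) * (10 / t) := by
          gcongr
          exact norm_hankelPrimitive_add_le ht'
      _ = _ := by field_simp; norm_num
  rw [integral_const_mul, integral_gaussian_Ioi] at e6
  have e7 : x * Real.sqrt (Real.pi / x) = Real.sqrt (Real.pi * x) := by
    rw [show Real.pi * x = x ^ 2 * (Real.pi / x) by field_simp, Real.sqrt_mul (by positivity),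
      Real.sqrt_sq hx.le]
  rw [Complex.norm_two]
  calc 2 * _ ≤ 2 * (20 * x * (Real.sqrt (Real.pi / x) / 2)) := by gcongr
    _ = 20 * (x * Real.sqrt (Real.pi / x)) := by ring
    _ = _ := by rw [e7]

/-! ### Solutions of Bessel's equation and the asymptotics of the Hankel functions -/

theorem hankel2_recurrence (n : ℕ) {x : ℝ} (hx : 0 < x) :
    2 * ((n : ℂ) + 1) / x * hankel2 (n + 1) x = hankel2 n x + hankel2 (n + 2) x := by
  have h := congrArg (starRingEnd ℂ) (hankel1_recurrence n hx)
  simpa [star_hankel1, Complex.conj_ofNat] using h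

theorem hasDerivAt_hankel1_succ (n : ℕ) {x : ℝ} (hx : 0 < x) :
    HasDerivAt (hankel1 (n + 1)) (hankel1 n x - (n + 1) / x * hankel1 (n + 1) x) x := by
  refine (hasDerivAt_hankel1 (n + 1) hx).congr_deriv ?_
  have h := hankel1_recurrence n hx
  push_cast
  linear_combination h

theorem hasDerivAt_hankel2_succ (n : ℕ) {x : ℝ} (hx : 0 < x) :
    HasDerivAt (hankel2 (n + 1)) (hankel2 n x - (n + 1) / x * hankel2 (n + 1) x) x := by
  refine (hasDerivAt_hankel2 (n + 1) hx).congr_deriv ?_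
  have h := hankel2_recurrence n hx
  push_cast
  linear_combination h

/-- Abel's identity for the first-order system satisfied by the pair of orders `(n, n+1)`. -/
theorem hasDerivAt_mul_casoratian {n : ℕ} {x : ℝ} (hx : x ≠ 0) {f g p q : ℝ → ℂ}
    (hf : HasDerivAt f (n / x * f x - g x) x)
    (hg : HasDerivAt g (f x - (n + 1) / x * g x) x)
    (hp : HasDerivAt p (n / x * p x - q x) x)
    (hq : HasDerivAt q (p x - (n + 1) / x * q x) x) :
    HasDerivAt (fun x : ℝ => (x : ℂ) * (f x * q x - g x * p x)) 0 x := by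
  have hx' : (x : ℂ) ≠ 0 := by exact_mod_cast hx
  refine ((hasDerivAt_id x).ofReal_comp.fun_mul
    ((hf.fun_mul hq).fun_sub (hg.fun_mul hp))).congr_deriv ?_
  simp only [id, Complex.ofReal_one]
  field_simp
  ring

/-- The Casoratians of `(f, g)` with the two Hankel pairs are constant, and Cramer's rule solves for
`(f, g)` because `hankel_wronskian` never vanishes. The factors `π/(4i)` in the witnesses invert the
Wronskian. -/
theorem exists_eq_hankel_of_hasDerivAt {n : ℕ} {a : ℝ} (ha : 0 ≤ a) {f g : ℝ → ℂ}
    (hf : ∀ x, a < x → HasDerivAt f (n / x * f x - g x) x)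
    (hg : ∀ x, a < x → HasDerivAt g (f x - (n + 1) / x * g x) x) :
    ∃ α β : ℂ, ∀ x, a < x → f x = α * hankel1 n x + β * hankel2 n x ∧
      g x = α * hankel1 (n + 1) x + β * hankel2 (n + 1) x := by
  set P : ℝ → ℂ := fun x => (x : ℂ) * (f x * hankel1 (n + 1) x - g x * hankel1 n x)
  set Q : ℝ → ℂ := fun x => (x : ℂ) * (f x * hankel2 (n + 1) x - g x * hankel2 n x)
  have hP : ∀ x ∈ Set.Ioi a, HasDerivAt P 0 x := fun x hx =>
    hasDerivAt_mul_casoratian (ha.trans_lt hx).ne' (hf x hx) (hg x hx)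
      (hasDerivAt_hankel1 n (ha.trans_lt hx)) (hasDerivAt_hankel1_succ n (ha.trans_lt hx))
  have hQ : ∀ x ∈ Set.Ioi a, HasDerivAt Q 0 x := fun x hx =>
    hasDerivAt_mul_casoratian (ha.trans_lt hx).ne' (hf x hx) (hg x hx)
      (hasDerivAt_hankel2 n (ha.trans_lt hx)) (hasDerivAt_hankel2_succ n (ha.trans_lt hx))
  have hmem : a + 1 ∈ Set.Ioi a := Set.mem_Ioi.2 (by linarith)
  have hpi : (Real.pi : ℂ) ≠ 0 := by exact_mod_cast Real.pi_ne_zero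
  refine ⟨Real.pi / (4 * Complex.I) * Q (a + 1), -(Real.pi / (4 * Complex.I) * P (a + 1)),
    fun x hx => ?_⟩
  have hx0 : 0 < x := ha.trans_lt hx
  have hx' : (x : ℂ) ≠ 0 := by exact_mod_cast hx0.ne'
  rw [← eq_of_hasDerivAt_zero_Ioi hP (Set.mem_Ioi.2 hx) hmem,
    ← eq_of_hasDerivAt_zero_Ioi hQ (Set.mem_Ioi.2 hx) hmem]
  have hW := hankel_wronskian n hx0
  simp only [P, Q]
  have hW' : (x : ℂ) * Real.pi * (hankel1 (n + 1) x * hankel2 n x -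
      hankel1 n x * hankel2 (n + 1) x) = -(4 * Complex.I) := by
    rw [hW]
    field_simp
  constructor
  · field_simp
    linear_combination f x * hW'
  · field_simp
    linear_combination g x * hW'

/-- The integral representation of `H_0^{(1)}`. -/
def hankelIntegral (x : ℝ) : ℂ := 2 / Real.pi * (Complex.exp (Complex.I * x) * hankelMoment 0 x)

/-- The integral representation of `H_1^{(1)}`. -/
def hankelIntegralOne (x : ℝ) : ℂ :=
  2 / Real.pi * (Complex.exp (Complex.I * x) * (hankelMoment 1 x - Complex.I * hankelMoment 0 x))

theorem hasDerivAt_cexp_I_mul (x : ℝ) : HasDerivAt (fun x : ℝ => Complex.exp (Complex.I * x))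
    (Complex.exp (Complex.I * x) * Complex.I) x := by
  have := ((hasDerivAt_id x).ofReal_comp.const_mul Complex.I).cexp
  simpa using this

theorem hasDerivAt_hankelIntegral {x : ℝ} (hx : 0 < x) :
    HasDerivAt hankelIntegral (-hankelIntegralOne x) x := by
  refine (((hasDerivAt_cexp_I_mul x).fun_mul (hasDerivAt_hankelMoment 0 hx)).const_mul
    (2 / Real.pi : ℂ)).congr_deriv ?_
  rw [hankelIntegralOne]
  ring

theorem hasDerivAt_hankelIntegralOne {x : ℝ} (hx : 0 < x) :
    HasDerivAt hankelIntegralOne (hankelIntegral x - 1 / x * hankelIntegralOne x) x := by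
  refine (((hasDerivAt_cexp_I_mul x).fun_mul ((hasDerivAt_hankelMoment 1 hx).fun_sub
    ((hasDerivAt_hankelMoment 0 hx).const_mul Complex.I))).const_mul
      (2 / Real.pi : ℂ)).congr_deriv ?_
  have h := hankelMoment_ode hx
  have hx' : (x : ℂ) ≠ 0 := by exact_mod_cast hx.ne'
  have hpi : (Real.pi : ℂ) ≠ 0 := by exact_mod_cast Real.pi_ne_zero
  rw [hankelIntegralOne, hankelIntegral]
  field_simp
  simp only [Nat.reduceAdd]
  linear_combination -h - x * hankelMoment 0 x * Complex.I_sq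

theorem tendsto_besselPhi_sub_one_mul_log :
    Tendsto (fun z => (besselPhi 0 z - 1) * Real.log z) (𝓝[>] 0) (𝓝 0) := by
  have h1 := (hasDerivAt_iff_tendsto_slope_zero.1 (hasDerivAt_besselPhi 0 0)).mono_left
    (nhdsGT_le_nhdsNE 0)
  have h2 : Tendsto (fun z => z * Real.log z) (𝓝[>] 0) (𝓝 0) := by
    simpa using (Real.continuous_mul_log.tendsto 0).mono_left (nhdsWithin_le_nhds (s := Set.Ioi 0))
  have h3 := h1.mul h2
  rw [mul_zero] at h3
  refine h3.congr' ?_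
  filter_upwards [self_mem_nhdsWithin] with z hz
  have hz' : z ≠ 0 := (Set.mem_Ioi.1 hz).ne'
  rw [zero_add, besselPhi_zero, smul_eq_mul]
  simp
  field_simp

/-- Both functions equal `1 + (2i/π)(log(x/2) + γ) + o(1)` at the origin. For the integral, the `1`
and the `log 2` come from the two parts of `hankelConst`. -/
theorem tendsto_hankelIntegral_sub :
    Tendsto (fun x => hankelIntegral x - hankel1 0 x) (𝓝[>] 0) (𝓝 0) := by
  have hz := tendsto_half_sq_nhdsGT_zero
  set L : ℝ → ℂ := fun x => Complex.I * (Real.eulerMascheroniConstant + Real.log x) -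
    2 * Complex.I * hankelConst with hL
  have hE : Tendsto (fun x : ℝ => Complex.exp (Complex.I * x)) (𝓝[>] 0) (𝓝 1) := by
    have : Continuous fun x : ℝ => Complex.exp (Complex.I * x) := by fun_prop
    simpa using (this.tendsto 0).mono_left (nhdsWithin_le_nhds (s := Set.Ioi 0))
  have h1 : Tendsto (fun x : ℝ => hankelMoment 0 x - L x) (𝓝[>] 0) (𝓝 0) := by
    have h2 : Tendsto (fun x : ℝ => 20 * Real.sqrt (Real.pi * x)) (𝓝[>] 0) (𝓝 0) := by
      have : Continuous fun x : ℝ => 20 * Real.sqrt (Real.pi * x) := by fun_prop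
      simpa using (this.tendsto 0).mono_left (nhdsWithin_le_nhds (s := Set.Ioi 0))
    refine squeeze_zero_norm' ?_ h2
    filter_upwards [self_mem_nhdsWithin] with x hx using norm_hankelMoment_zero_small hx
  -- The factor `e^{ix} - 1` is `O(x)`, which beats the logarithm in `L`.
  have h2 : Tendsto (fun x : ℝ => (Complex.exp (Complex.I * x) - 1) * L x) (𝓝[>] 0) (𝓝 0) := by
    have e1 : Tendsto (fun x : ℝ => ((Complex.exp (Complex.I * x) - 1) / x)) (𝓝[>] 0)
        (𝓝 Complex.I) := by
      have := (hasDerivAt_iff_tendsto_slope_zero.1 (hasDerivAt_cexp_I_mul 0)).mono_left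
        (nhdsGT_le_nhdsNE 0)
      simp at this
      refine this.congr fun x => ?_
      rw [div_eq_inv_mul]
    have e2 : Tendsto (fun x : ℝ => (x : ℂ) * L x) (𝓝[>] 0) (𝓝 0) := by
      have e3 : Tendsto (fun x : ℝ => ((x * Real.log x : ℝ) : ℂ)) (𝓝[>] 0) (𝓝 0) := by
        have := (Complex.continuous_ofReal.comp Real.continuous_mul_log).tendsto 0
        simpa [Function.comp_def] using this.mono_left (nhdsWithin_le_nhds (s := Set.Ioi 0))
      have e4 : Tendsto (fun x : ℝ => (x : ℂ)) (𝓝[>] 0) (𝓝 0) := by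
        have := Complex.continuous_ofReal.tendsto 0
        simpa using this.mono_left (nhdsWithin_le_nhds (s := Set.Ioi 0))
      have := (e3.const_mul Complex.I).add (e4.mul_const
        (Complex.I * Real.eulerMascheroniConstant - 2 * Complex.I * hankelConst))
      simp only [mul_zero, zero_mul, add_zero] at this
      refine this.congr fun x => ?_
      simp only [hL]
      push_cast
      ring
    have := e1.mul e2
    rw [mul_zero] at this
    refine this.congr' ?_
    filter_upwards [self_mem_nhdsWithin] with x hx
    have hx' : (x : ℂ) ≠ 0 := by exact_mod_cast (Set.mem_Ioi.1 hx).ne'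
    field_simp
  have h3 : Tendsto (fun z : ℝ => ((1 - besselPhi 0 z : ℝ) : ℂ) + Complex.I / Real.pi *
      ((-((besselPhi 0 z - 1) * Real.log z) +
        (2 * Real.eulerMascheroniConstant + besselChi 0 z) : ℝ) : ℂ)) (𝓝[>] 0) (𝓝 0) := by
    have e1 : Tendsto (fun z => 1 - besselPhi 0 z) (𝓝[>] 0) (𝓝 0) := by
      have := ((continuous_besselPhi 0).tendsto 0).mono_left (nhdsWithin_le_nhds (s := Set.Ioi 0))
      rw [besselPhi_zero] at this
      simpa using this.const_sub 1
    have e2 : Tendsto (fun z => 2 * Real.eulerMascheroniConstant + besselChi 0 z) (𝓝[>] 0)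
        (𝓝 0) := by
      have h0 : besselChi 0 0 = -(2 * Real.eulerMascheroniConstant) := by
        rw [besselChi, tsum_eq_single 0 fun k hk => by simp [hk]]
        simp [chiCoeff, phiCoeff, digammaSucc]
        ring
      have := ((continuous_besselChi 0).tendsto 0).mono_left (nhdsWithin_le_nhds (s := Set.Ioi 0))
      rw [h0] at this
      simpa using this.const_add (2 * Real.eulerMascheroniConstant)
    have e3 := tendsto_besselPhi_sub_one_mul_log.neg.add e2
    have c1 := (Complex.continuous_ofReal.tendsto _).comp e1
    have c2 := ((Complex.continuous_ofReal.tendsto _).comp e3).const_mul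
      (Complex.I / Real.pi : ℂ)
    simpa using c1.add c2
  have h4 := (((hE.mul h1).add h2).const_mul (2 / Real.pi : ℂ)).add (h3.comp hz)
  simp only [mul_zero, add_zero] at h4
  refine h4.congr' ?_
  filter_upwards [self_mem_nhdsWithin] with x hx
  have hx0 : (0 : ℝ) < x := hx
  have hpi : (Real.pi : ℂ) ≠ 0 := by exact_mod_cast Real.pi_ne_zero
  have hlog : Real.log ((x / 2) ^ 2) = 2 * (Real.log x - Real.log 2) := by
    rw [Real.log_pow, Real.log_div hx0.ne' (by norm_num)]
    norm_num
  simp only [Function.comp_apply, hankelIntegral, hankel1, besselJ_eq, besselY_eq 0 hx0, hL,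
    hankelConst, besselUpsilon, besselPolar, hlog, pow_zero, Finset.range_zero, Finset.sum_empty]
  push_cast
  field_simp
  linear_combination (4 * (Real.pi : ℂ)) * Complex.I_sq

/-- The integral is some `α H^{(1)} + β H^{(2)}`, and its difference from `H^{(1)}` tends to `0` at
the origin. Since `Y_0` is unbounded there and `J_0 → 1`, the coefficients of `Y_0` and then of
`J_0` in the difference vanish. -/
theorem hankel_eq_hankelIntegral {x : ℝ} (hx : 0 < x) :
    hankel1 0 x = hankelIntegral x ∧ hankel1 1 x = hankelIntegralOne x := by
  obtain ⟨α, β, h⟩ := exists_eq_hankel_of_hasDerivAt (n := 0) le_rfl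
    (f := hankelIntegral) (g := hankelIntegralOne)
    (fun x hx => by simpa using hasDerivAt_hankelIntegral hx)
    (fun x hx => by simpa using hasDerivAt_hankelIntegralOne hx)
  have hJ : Tendsto (fun x => (besselJ 0 x : ℂ)) (𝓝[>] 0) (𝓝 1) := by
    have hc : Continuous fun x : ℝ => besselPhi 0 ((x / 2) ^ 2) :=
      (continuous_besselPhi 0).comp (by fun_prop)
    have := ((Complex.continuous_ofReal.comp hc).tendsto 0).mono_left
      (nhdsWithin_le_nhds (s := Set.Ioi 0))
    simp [besselPhi_zero] at this
    refine this.congr fun x => ?_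
    simp [besselJ_eq]
  have hz := tendsto_half_sq_nhdsGT_zero
  have hY : Tendsto (fun x => ((besselY 0 x : ℂ))⁻¹) (𝓝[>] 0) (𝓝 0) := by
    have e1 : Tendsto (fun x => Real.pi * (besselUpsilon 0 ((x / 2) ^ 2))⁻¹) (𝓝[>] 0) (𝓝 0) := by
      simpa using (((tendsto_besselUpsilon_zero 0).comp hz).inv_tendsto_atBot).const_mul Real.pi
    have := (Complex.continuous_ofReal.tendsto _).comp e1
    rw [Complex.ofReal_zero] at this
    refine this.congr' ?_
    filter_upwards [self_mem_nhdsWithin] with x hx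
    rw [besselY_eq 0 hx]
    simp [mul_comm]
  have hY0 : ∀ᶠ x in 𝓝[>] (0 : ℝ), besselY 0 x ≠ 0 := by
    filter_upwards [self_mem_nhdsWithin,
      ((tendsto_besselUpsilon_zero 0).comp hz).eventually_lt_atBot 0] with x hx h0
    rw [besselY_eq 0 hx]
    simp only [pow_zero, one_mul]
    exact mul_ne_zero (by positivity) h0.ne
  have hlim := tendsto_hankelIntegral_sub
  have hlim2 : Tendsto (fun x => (α - 1 + β) * (besselJ 0 x : ℂ) +
      Complex.I * (α - 1 - β) * besselY 0 x) (𝓝[>] 0) (𝓝 0) := by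
    refine hlim.congr' ?_
    filter_upwards [self_mem_nhdsWithin] with x hx
    rw [(h x hx).1, hankel1, hankel2]
    ring
  have k1 : Complex.I * (α - 1 - β) = 0 := by
    have e1 := hlim2.mul hY
    have e2 := ((hJ.mul hY).const_mul (α - 1 + β)).add_const (Complex.I * (α - 1 - β))
    rw [mul_zero] at e1
    rw [mul_zero, mul_zero, zero_add] at e2
    refine tendsto_nhds_unique (e2.congr' ?_) e1
    filter_upwards [hY0] with x hx
    have : (besselY 0 x : ℂ) ≠ 0 := by exact_mod_cast hx
    field_simp
  have k2 : α - 1 + β = 0 := by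
    rw [k1] at hlim2
    simp only [zero_mul, add_zero] at hlim2
    have := tendsto_nhds_unique (hJ.const_mul (α - 1 + β)) hlim2
    simpa using this
  have k3 : α - 1 - β = 0 := by simpa using k1
  have hβ : β = 0 := by linear_combination (k2 - k3) / 2
  have hα : α = 1 := by linear_combination (k2 + k3) / 2
  obtain ⟨h1, h2⟩ := h x hx
  rw [h1, h2, hα, hβ]
  simp

/-- The leading term of `H_0^{(1)}` at infinity. -/
def outgoingWave (x : ℝ) : ℂ :=
  (Real.sqrt (2 / (Real.pi * x)) : ℂ) * Complex.exp (Complex.I * x) *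
    Complex.exp (-(Real.pi : ℂ) * Complex.I / 4)

theorem norm_outgoingWave (x : ℝ) : ‖outgoingWave x‖ = Real.sqrt (2 / (Real.pi * x)) := by
  have h1 : ‖Complex.exp (Complex.I * x)‖ = 1 := by
    rw [mul_comm]; exact Complex.norm_exp_ofReal_mul_I x
  have h2 : ‖Complex.exp (-(Real.pi : ℂ) * Complex.I / 4)‖ = 1 := by
    have := Complex.norm_exp_ofReal_mul_I (-Real.pi / 4)
    rw [← this]
    congr 2
    push_cast
    ring
  rw [outgoingWave, norm_mul, norm_mul, h1, h2, mul_one, mul_one, Complex.norm_real,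
    Real.norm_of_nonneg (Real.sqrt_nonneg _)]

theorem norm_outgoingWave_le {x : ℝ} (hx : 0 < x) : ‖outgoingWave x‖ ≤ x ^ (-(1 / 2) : ℝ) := by
  rw [norm_outgoingWave, Real.rpow_neg hx.le, ← Real.sqrt_eq_rpow, ← Real.sqrt_inv]
  refine Real.sqrt_le_sqrt ?_
  rw [← div_div, inv_eq_one_div]
  gcongr
  rw [div_le_one Real.pi_pos]
  exact Real.two_le_pi

theorem norm_two_div_pi_mul_cexp_le (x : ℝ) (w : ℂ) :
    ‖2 / Real.pi * (Complex.exp (Complex.I * x) * w)‖ ≤ ‖w‖ := by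
  have h1 : ‖Complex.exp (Complex.I * x)‖ = 1 := by
    rw [mul_comm]; exact Complex.norm_exp_ofReal_mul_I x
  rw [norm_mul, norm_mul, h1, one_mul, norm_div, Complex.norm_two, Complex.norm_real,
    Real.norm_of_nonneg Real.pi_pos.le]
  refine mul_le_of_le_one_left (norm_nonneg _) ?_
  rw [div_le_one Real.pi_pos]
  exact Real.two_le_pi

theorem outgoingWave_eq {x : ℝ} (hx : 0 < x) : outgoingWave x = 2 / Real.pi *
    (Complex.exp (Complex.I * x) * ((Real.sqrt (Real.pi / x) : ℂ) * (hankelRoot 0)⁻¹)) := by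
  have h1 : Complex.exp (-(Real.pi : ℂ) * Complex.I / 4) =
      (Complex.exp (Real.pi * Complex.I / 4))⁻¹ := by
    rw [← Complex.exp_neg]
    congr 1
    ring
  have hpi := Real.pi_pos
  have h2 : Real.sqrt (2 / (Real.pi * x)) =
      2 / Real.pi * (Real.sqrt (Real.pi / x) / Real.sqrt 2) := by
    rw [← Real.sqrt_div (by positivity), ← Real.sqrt_sq (by positivity : 0 ≤ 2 / Real.pi),
      ← Real.sqrt_mul (by positivity)]
    congr 1
    field_simp
  rw [outgoingWave, h1, h2, hankelRoot_zero, mul_inv]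
  push_cast
  ring

theorem norm_hankel1_zero_sub_le {x : ℝ} (hx : 0 < x) :
    ‖hankel1 0 x - outgoingWave x‖ ≤ Real.Gamma (3 / 2) * x ^ (-(3 / 2) : ℝ) := by
  rw [(hankel_eq_hankelIntegral hx).1, outgoingWave_eq hx, hankelIntegral, ← mul_sub, ← mul_sub]
  exact (norm_two_div_pi_mul_cexp_le x _).trans (norm_hankelMoment_zero_sub_le hx)

theorem norm_hankel1_one_sub_le {x : ℝ} (hx : 0 < x) :
    ‖hankel1 1 x - -Complex.I * outgoingWave x‖ ≤
      2 * Real.Gamma (3 / 2) * x ^ (-(3 / 2) : ℝ) := by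
  have h : hankel1 1 x - -Complex.I * outgoingWave x =
      2 / Real.pi * (Complex.exp (Complex.I * x) * hankelMoment 1 x) +
        -Complex.I * (hankel1 0 x - outgoingWave x) := by
    rw [(hankel_eq_hankelIntegral hx).1, (hankel_eq_hankelIntegral hx).2, hankelIntegralOne,
      hankelIntegral]
    ring
  rw [h]
  refine (norm_add_le _ _).trans ?_
  have h1 := (norm_two_div_pi_mul_cexp_le x _).trans (norm_hankelMoment_one_le hx)
  have h2 := norm_hankel1_zero_sub_le hx
  rw [norm_mul (-Complex.I), norm_neg, Complex.norm_I, one_mul]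
  linarith

/-- Induction by the upward recurrence. The factor `2(n+1)/x` brings the factorial and an extra
`x⁻¹`, so that term belongs to the error. The leading term passes from order `n` to `n + 2` through
`(-i)^{n+2} = -(-i)^n`. -/
theorem exists_hankel1_bounds {a : ℝ} (ha : 0 < a) : ∃ C : ℝ, 1 ≤ C ∧ ∀ n : ℕ, ∀ x : ℝ, a ≤ x →
    ‖hankel1 n x‖ ≤ C ^ (n + 1) * n.factorial * x ^ (-(1 / 2) : ℝ) ∧
    ‖hankel1 n x - (-Complex.I) ^ n * outgoingWave x‖ ≤
      C ^ (n + 1) * n.factorial * x ^ (-(3 / 2) : ℝ) := by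
  set Γ := Real.Gamma (3 / 2)
  have hΓ : 0 < Γ := Real.Gamma_pos_of_pos (by norm_num)
  -- The summands serve separate steps: `1 + 2/a` the growth induction, `3` the error induction,
  -- `2Γ` and `1 + 2Γ/a` the orders `0` and `1`.
  set C : ℝ := 3 + 2 / a + 2 * Γ + 2 * Γ / a with hC
  have hC3 : 3 ≤ C := by
    have : 0 < 2 / a + 2 * Γ + 2 * Γ / a := by positivity
    linarith
  have hC0 : 0 ≤ C := by linarith
  have hC1 : 1 ≤ C := by linarith
  have hCC : C ≤ C ^ 2 := by nlinarith
  have hCa : 1 + 2 / a ≤ C := by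
    have : 0 < 2 * Γ + 2 * Γ / a := by positivity
    linarith
  have hCΓ : 2 * Γ ≤ C := by
    have : 0 < 2 / a + 2 * Γ / a := by positivity
    linarith
  have hCΓa : 1 + 2 * Γ / a ≤ C := by
    have : 0 < 2 / a + 2 * Γ := by positivity
    linarith
  have key : ∀ x : ℝ, a ≤ x → x ^ (-(3 / 2) : ℝ) = x⁻¹ * x ^ (-(1 / 2) : ℝ) := fun x hx => by
    have hx0 : 0 < x := ha.trans_le hx
    rw [← Real.rpow_neg_one, ← Real.rpow_add hx0]
    norm_num
  refine ⟨C, hC1, fun n => ?_⟩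
  induction n using Nat.twoStepInduction with
  | zero =>
    intro x hx
    have hx0 : 0 < x := ha.trans_le hx
    have h1 := norm_hankel1_zero_sub_le hx0
    have h2 := norm_outgoingWave_le hx0
    have h4 : x⁻¹ ≤ a⁻¹ := inv_anti₀ ha hx
    constructor
    · calc ‖hankel1 0 x‖ = ‖(hankel1 0 x - outgoingWave x) + outgoingWave x‖ := by simp
        _ ≤ Γ * (x⁻¹ * x ^ (-(1 / 2) : ℝ)) + x ^ (-(1 / 2) : ℝ) := by
          rw [← key x hx]
          exact (norm_add_le _ _).trans (add_le_add h1 h2)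
        _ ≤ Γ * (a⁻¹ * x ^ (-(1 / 2) : ℝ)) + x ^ (-(1 / 2) : ℝ) := by gcongr
        _ = (1 + Γ / a) * x ^ (-(1 / 2) : ℝ) := by ring
        _ ≤ C ^ (0 + 1) * (Nat.factorial 0) * x ^ (-(1 / 2) : ℝ) := by
          simp only [zero_add, pow_one, Nat.factorial_zero, Nat.cast_one, mul_one]
          gcongr
          have : 2 * Γ / a = Γ / a + Γ / a := by ring
          have : 0 < Γ / a := by positivity
          linarith
    · refine le_trans (by simpa using h1) ?_
      simp only [zero_add, pow_one, Nat.factorial_zero, Nat.cast_one, mul_one]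
      gcongr
      linarith
  | one =>
    intro x hx
    have hx0 : 0 < x := ha.trans_le hx
    have h1 := norm_hankel1_one_sub_le hx0
    have h2 := norm_outgoingWave_le hx0
    have h4 : x⁻¹ ≤ a⁻¹ := inv_anti₀ ha hx
    constructor
    · calc ‖hankel1 1 x‖ = ‖(hankel1 1 x - -Complex.I * outgoingWave x) +
            -Complex.I * outgoingWave x‖ := by simp
        _ ≤ 2 * Γ * (x⁻¹ * x ^ (-(1 / 2) : ℝ)) + x ^ (-(1 / 2) : ℝ) := by
          rw [← key x hx]
          refine (norm_add_le _ _).trans (add_le_add h1 ?_)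
          rwa [norm_mul, norm_neg, Complex.norm_I, one_mul]
        _ ≤ 2 * Γ * (a⁻¹ * x ^ (-(1 / 2) : ℝ)) + x ^ (-(1 / 2) : ℝ) := by gcongr
        _ = (1 + 2 * Γ / a) * x ^ (-(1 / 2) : ℝ) := by ring
        _ ≤ C ^ (1 + 1) * (Nat.factorial 1) * x ^ (-(1 / 2) : ℝ) := by
          simp only [Nat.reduceAdd, Nat.factorial_one, Nat.cast_one, mul_one]
          gcongr
          linarith
    · refine le_trans (by simpa using h1) ?_
      simp only [Nat.reduceAdd, Nat.factorial_one, Nat.cast_one, mul_one]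
      gcongr
      linarith
  | more n ih0 ih1 =>
    intro x hx
    have hx0 : 0 < x := ha.trans_le hx
    obtain ⟨a0, b0⟩ := ih0 x hx
    obtain ⟨a1, b1⟩ := ih1 x hx
    have hrec : hankel1 (n + 2) x = 2 * ((n : ℂ) + 1) / x * hankel1 (n + 1) x - hankel1 n x := by
      rw [hankel1_recurrence n hx0]; ring
    have hnorm : ‖2 * ((n : ℂ) + 1) / x‖ = 2 * ((n : ℝ) + 1) * x⁻¹ := by
      have : 2 * ((n : ℂ) + 1) / x = ((2 * ((n : ℝ) + 1) * x⁻¹ : ℝ) : ℂ) := by push_cast; ring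
      rw [this, Complex.norm_real, Real.norm_of_nonneg (by positivity)]
    have hfac : ((n : ℝ) + 1) * (n + 1).factorial ≤ (n + 2).factorial := by
      rw [Nat.factorial_succ (n + 1)]
      push_cast
      gcongr
      linarith
    have hfac0 : C ^ (n + 1) * (n.factorial : ℝ) ≤ C ^ (n + 2) * (n + 2).factorial := by
      gcongr
      · norm_num
      · omega
    have h4 : x⁻¹ ≤ a⁻¹ := inv_anti₀ ha hx
    have hpos : 0 < x ^ (-(1 / 2) : ℝ) := Real.rpow_pos_of_pos hx0 _
    have hpos3 : 0 < x ^ (-(3 / 2) : ℝ) := Real.rpow_pos_of_pos hx0 _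
    constructor
    · calc ‖hankel1 (n + 2) x‖ ≤ 2 * ((n : ℝ) + 1) * x⁻¹ * ‖hankel1 (n + 1) x‖ +
            ‖hankel1 n x‖ := by
            rw [hrec, ← hnorm, ← norm_mul]
            exact norm_sub_le _ _
        _ ≤ 2 * ((n : ℝ) + 1) * a⁻¹ * (C ^ (n + 1 + 1) * (n + 1).factorial *
            x ^ (-(1 / 2) : ℝ)) + C ^ (n + 1) * n.factorial * x ^ (-(1 / 2) : ℝ) := by gcongr
        _ = (2 / a * C ^ (n + 2) * (((n : ℝ) + 1) * (n + 1).factorial) +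
            C ^ (n + 1) * n.factorial) * x ^ (-(1 / 2) : ℝ) := by ring
        _ ≤ (2 / a * C ^ (n + 2) * (n + 2).factorial +
            C ^ (n + 2) * (n + 2).factorial) * x ^ (-(1 / 2) : ℝ) := by gcongr
        _ = (1 + 2 / a) * (C ^ (n + 2) * (n + 2).factorial * x ^ (-(1 / 2) : ℝ)) := by ring
        _ ≤ C * (C ^ (n + 2) * (n + 2).factorial * x ^ (-(1 / 2) : ℝ)) := by gcongr
        _ = _ := by ring
    · have hrec2 : hankel1 (n + 2) x - (-Complex.I) ^ (n + 2) * outgoingWave x =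
          2 * ((n : ℂ) + 1) / x * hankel1 (n + 1) x -
            (hankel1 n x - (-Complex.I) ^ n * outgoingWave x) := by
        rw [hrec, pow_add]
        linear_combination (-(-Complex.I) ^ n * outgoingWave x) * Complex.I_sq
      calc ‖hankel1 (n + 2) x - (-Complex.I) ^ (n + 2) * outgoingWave x‖
          ≤ 2 * ((n : ℝ) + 1) * x⁻¹ * ‖hankel1 (n + 1) x‖ +
            ‖hankel1 n x - (-Complex.I) ^ n * outgoingWave x‖ := by
            rw [hrec2, ← hnorm, ← norm_mul]
            exact norm_sub_le _ _
        _ ≤ 2 * ((n : ℝ) + 1) * x⁻¹ * (C ^ (n + 1 + 1) * (n + 1).factorial *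
            x ^ (-(1 / 2) : ℝ)) + C ^ (n + 1) * n.factorial * x ^ (-(3 / 2) : ℝ) := by gcongr
        _ = (2 * C ^ (n + 2) * (((n : ℝ) + 1) * (n + 1).factorial) +
            C ^ (n + 1) * n.factorial) * x ^ (-(3 / 2) : ℝ) := by rw [key x hx]; ring
        _ ≤ (2 * C ^ (n + 2) * (n + 2).factorial +
            C ^ (n + 2) * (n + 2).factorial) * x ^ (-(3 / 2) : ℝ) := by gcongr
        _ = 3 * (C ^ (n + 2) * (n + 2).factorial * x ^ (-(3 / 2) : ℝ)) := by ring
        _ ≤ C * (C ^ (n + 2) * (n + 2).factorial * x ^ (-(3 / 2) : ℝ)) := by gcongr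
        _ = _ := by ring

/-! ### Outgoing modes in the plane -/

/-- The Hankel function `H_n^{(1)}` of integer order `n`. -/
def hankelZ (n : ℤ) (x : ℝ) : ℂ :=
  if 0 ≤ n then hankel1 n.natAbs x else (-1) ^ n.natAbs * hankel1 n.natAbs x

theorem hankelZ_natCast (n : ℕ) (x : ℝ) : hankelZ n x = hankel1 n x := by simp [hankelZ]

theorem hankelZ_negSucc (n : ℕ) (x : ℝ) :
    hankelZ (Int.negSucc n) x = (-1) ^ (n + 1) * hankel1 (n + 1) x := by
  simp [hankelZ]

theorem hankelZ_neg_natCast (n : ℕ) (x : ℝ) : hankelZ (-(n : ℤ)) x = (-1) ^ n * hankel1 n x := by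
  rcases n with _ | n
  · simp [hankelZ]
  · rw [show (-((n + 1 : ℕ) : ℤ)) = Int.negSucc n from rfl, hankelZ_negSucc]

theorem norm_hankelZ (n : ℤ) (x : ℝ) : ‖hankelZ n x‖ = ‖hankel1 n.natAbs x‖ := by
  rw [hankelZ]
  split_ifs <;> simp

theorem hankelZ_recurrence (n : ℤ) {x : ℝ} (hx : 0 < x) :
    2 * (n : ℂ) / x * hankelZ n x = hankelZ (n - 1) x + hankelZ (n + 1) x := by
  rcases n with n | n
  · rcases n with _ | n
    · have h := hankelZ_neg_natCast 1 x
      simp only [Nat.cast_one] at h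
      have h' := hankelZ_natCast 1 x
      simp only [Nat.cast_one] at h'
      simp [h, h']
    · have h := hankel1_recurrence n hx
      have e1 : Int.ofNat (n + 1) - 1 = (n : ℤ) := by simp
      have e2 : Int.ofNat (n + 1) + 1 = ((n + 2 : ℕ) : ℤ) := by push_cast; rfl
      have e3 : Int.ofNat (n + 1) = ((n + 1 : ℕ) : ℤ) := rfl
      rw [e1, e2, e3, hankelZ_natCast, hankelZ_natCast, hankelZ_natCast]
      push_cast
      exact h
  · have h := hankel1_recurrence n hx
    have e1 : Int.negSucc n - 1 = Int.negSucc (n + 1) := by omega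
    have e2 : Int.negSucc n + 1 = -(n : ℤ) := by omega
    rw [e1, e2, hankelZ_negSucc, hankelZ_negSucc, hankelZ_neg_natCast]
    push_cast
    linear_combination (-1) ^ n * h

theorem hasDerivAt_hankelZ (n : ℤ) {x : ℝ} (hx : 0 < x) :
    HasDerivAt (hankelZ n) (n / x * hankelZ n x - hankelZ (n + 1) x) x := by
  rcases n with n | n
  · have h := hasDerivAt_hankel1 n hx
    have e : Int.ofNat n + 1 = ((n + 1 : ℕ) : ℤ) := by push_cast; rfl
    rw [e, hankelZ_natCast]
    have e1 : hankelZ (Int.ofNat n) = hankel1 n := funext fun y => hankelZ_natCast n y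
    rw [e1]
    simpa using h
  · have h := (hasDerivAt_hankel1_succ n hx).const_mul ((-1 : ℂ) ^ (n + 1))
    have e2 : Int.negSucc n + 1 = -(n : ℤ) := by omega
    have e1 : hankelZ (Int.negSucc n) = fun y => (-1 : ℂ) ^ (n + 1) * hankel1 (n + 1) y :=
      funext fun y => hankelZ_negSucc n y
    rw [e2, e1, hankelZ_neg_natCast]
    refine h.congr_deriv ?_
    push_cast
    ring

/-- The outgoing solution `H_n^{(1)}(λ r) e^{inφ}` of the Helmholtz equation on `ℂ ∖ {0}`. -/
def outgoingMode (lam : ℝ) (n : ℤ) (z : ℂ) : ℂ := hankelZ n (lam * ‖z‖) * (z / ‖z‖) ^ n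

theorem norm_outgoingMode (lam : ℝ) (n : ℤ) {z : ℂ} (hz : z ≠ 0) :
    ‖outgoingMode lam n z‖ = ‖hankel1 n.natAbs (lam * ‖z‖)‖ := by
  rw [outgoingMode, norm_mul, norm_hankelZ, norm_zpow, norm_div, Complex.norm_real, norm_norm,
    div_self (norm_ne_zero_iff.2 hz), one_zpow, mul_one]

/-- The real-linear map `v ↦ a v - b v̄` on `ℂ`. -/
def wirtinger (a b : ℂ) : ℂ →L[ℝ] ℂ :=
  a • ContinuousLinearMap.id ℝ ℂ - b • Complex.conjCLE.toContinuousLinearMap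

theorem wirtinger_apply (a b v : ℂ) : wirtinger a b v = a * v - b * (starRingEnd ℂ) v := rfl

theorem norm_wirtinger_le (a b : ℂ) : ‖wirtinger a b‖ ≤ ‖a‖ + ‖b‖ := by
  refine ContinuousLinearMap.opNorm_le_bound _ (by positivity) fun v => ?_
  rw [wirtinger_apply]
  refine (norm_sub_le _ _).trans ?_
  rw [norm_mul, norm_mul, RCLike.norm_conj]
  exact le_of_eq (by ring)

theorem hasFDerivAt_norm_complex {z : ℂ} (hz : z ≠ 0) :
    HasFDerivAt (fun z : ℂ => ‖z‖) ((1 / ‖z‖) • innerSL ℝ z) z := by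
  have h1 : HasFDerivAt (fun z : ℂ => ‖z‖ ^ 2) _ z := (hasFDerivAt_id z).norm_sq
  have hn : ‖z‖ ^ 2 ≠ 0 := pow_ne_zero 2 (norm_ne_zero_iff.2 hz)
  have h2 := h1.sqrt hn
  have e : (fun z : ℂ => Real.sqrt (‖z‖ ^ 2)) = fun z => ‖z‖ :=
    funext fun z => Real.sqrt_sq (norm_nonneg z)
  rw [e] at h2
  refine h2.congr_fderiv ?_
  rw [Real.sqrt_sq (norm_nonneg z)]
  ext v
  simp
  field_simp

/-- Ladder relations: up to the factors `±λ/2`, `∂_z` lowers the order and `∂_z̄` raises it.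
Derivatives of a superposition of modes are thus superpositions with shifted coefficients. -/
theorem hasFDerivAt_outgoingMode {lam : ℝ} (hlam : 0 < lam) (n : ℤ) {z : ℂ} (hz : z ≠ 0) :
    HasFDerivAt (outgoingMode lam n) (wirtinger (lam / 2 * outgoingMode lam (n - 1) z)
      (lam / 2 * outgoingMode lam (n + 1) z)) z := by
  have hr : 0 < ‖z‖ := norm_pos_iff.2 hz
  have hrc : (‖z‖ : ℂ) ≠ 0 := by exact_mod_cast hr.ne'
  have hl : (lam : ℂ) ≠ 0 := by exact_mod_cast hlam.ne'
  have hx : 0 < lam * ‖z‖ := mul_pos hlam hr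
  -- The mode is `G(|z|) z^n`. Dividing by `r^n` makes the radial derivative involve the order `n +
  -- 1` alone.
  set G : ℝ → ℂ := fun r => hankelZ n (lam * r) * (r : ℂ) ^ (-n)
  have hG : HasDerivAt G (-(lam * hankelZ (n + 1) (lam * ‖z‖) * (‖z‖ : ℂ) ^ (-n))) ‖z‖ := by
    have h1 : HasDerivAt (fun r : ℝ => lam * r) lam ‖z‖ := by
      simpa using (hasDerivAt_id ‖z‖).const_mul lam
    have h2 := (hasDerivAt_hankelZ n hx).scomp ‖z‖ h1
    have h3 := (hasDerivAt_zpow (-n) (‖z‖ : ℂ) (Or.inl hrc)).comp_ofReal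
    refine (h2.fun_mul h3).congr_deriv ?_
    simp only [Function.comp_apply, Complex.real_smul]
    rw [zpow_sub_one₀ hrc]
    push_cast
    field_simp
    ring
  have hf1 : HasFDerivAt (fun z : ℂ => G ‖z‖) _ z :=
    hG.hasFDerivAt.comp z (hasFDerivAt_norm_complex hz)
  have hf2 : HasFDerivAt (fun z : ℂ => z ^ n) _ z :=
    (hasDerivAt_zpow n z (Or.inl hz)).hasFDerivAt.restrictScalars ℝ
  have hf := hf1.fun_mul hf2
  have he : outgoingMode lam n = fun z => G ‖z‖ * z ^ n := by
    funext w
    simp only [outgoingMode, G]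
    rw [div_zpow, zpow_neg]
    ring
  rw [he]
  refine hf.congr_fderiv ?_
  ext1 v
  rw [wirtinger_apply]
  have hinner : ((inner ℝ z v : ℝ) : ℂ) = (z * (starRingEnd ℂ) v + (starRingEnd ℂ) z * v) / 2 := by
    rw [Complex.inner, Complex.re_eq_add_conj]
    simp
    ring
  have hzz : z * (starRingEnd ℂ) z = (‖z‖ : ℂ) ^ 2 := by
    rw [Complex.mul_conj, Complex.normSq_eq_norm_sq]
    push_cast
    ring
  have hrec := hankelZ_recurrence n hx
  simp only [add_apply, smul_apply,
    ContinuousLinearMap.comp_apply, ContinuousLinearMap.coe_restrictScalars',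
    ContinuousLinearMap.toSpanSingleton_apply, innerSL_apply_apply, Complex.real_smul, smul_eq_mul,
    outgoingMode, G]
  rw [div_zpow, div_zpow, zpow_sub_one₀ hz, zpow_add_one₀ hz, zpow_sub_one₀ hrc,
    zpow_add_one₀ hrc, zpow_neg]
  push_cast at hrec ⊢
  rw [hinner]
  have hrn : (‖z‖ : ℂ) ^ n ≠ 0 := zpow_ne_zero n hrc
  generalize hankelZ n (lam * ‖z‖) = A at *
  generalize hankelZ (n - 1) (lam * ‖z‖) = B at *
  generalize hankelZ (n + 1) (lam * ‖z‖) = D at *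
  field_simp at hrec ⊢
  linear_combination (‖z‖ : ℂ) * v * hrec - lam * D * v * hzz

/-- Coefficient families that decay faster than every `C^|n| |n|!` grows. -/
def FactorialDecay (a : ℤ → ℂ) : Prop :=
  ∀ C : ℝ, 1 ≤ C → Summable fun n : ℤ => ‖a n‖ * (C ^ n.natAbs * (n.natAbs.factorial : ℝ))

theorem pow_mul_factorial_le_of_natAbs_le {C : ℝ} (hC : 1 ≤ C) {m k : ℕ} (h : k ≤ m + 1) :
    C ^ k * (k.factorial : ℝ) ≤ C * ((2 * C) ^ m * m.factorial) := by
  have h1 : (k.factorial : ℝ) ≤ 2 ^ m * m.factorial := by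
    have h2 : k.factorial ≤ (m + 1).factorial := Nat.factorial_le h
    have h3 : m + 1 ≤ 2 ^ m := Nat.lt_two_pow_self
    have h4 : k.factorial ≤ 2 ^ m * m.factorial :=
      h2.trans (by rw [Nat.factorial_succ]; exact Nat.mul_le_mul_right _ h3)
    exact_mod_cast h4
  have h0 : 0 ≤ C := by linarith
  calc C ^ k * (k.factorial : ℝ) ≤ C ^ (m + 1) * (2 ^ m * m.factorial) := by
        gcongr
    _ = _ := by rw [mul_pow]; ring

/-- Moving to a neighbouring index costs a factor `m + 1 ≤ 2^m`, absorbed by doubling `C`. This is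
why the decay is demanded for all `C`. -/
theorem FactorialDecay.comp_add {a : ℤ → ℂ} (ha : FactorialDecay a) {s : ℤ} (hs : s.natAbs = 1) :
    FactorialDecay fun n => a (n + s) := by
  intro C hC
  have h1 := ((ha (2 * C) (by linarith)).mul_left C).comp_injective (add_left_injective s)
  refine h1.of_nonneg_of_le (fun n => by positivity) fun n => ?_
  simp only [Function.comp_apply]
  have := pow_mul_factorial_le_of_natAbs_le hC (m := (n + s).natAbs) (k := n.natAbs) (by omega)
  calc _ ≤ ‖a (n + s)‖ * (C * ((2 * C) ^ (n + s).natAbs * (n + s).natAbs.factorial)) := by gcongr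
    _ = _ := by ring

theorem FactorialDecay.shift_right {a : ℤ → ℂ} (ha : FactorialDecay a) :
    FactorialDecay fun n => a (n + 1) := ha.comp_add (by decide)

theorem FactorialDecay.shift_left {a : ℤ → ℂ} (ha : FactorialDecay a) :
    FactorialDecay fun n => a (n - 1) := ha.comp_add (s := -1) (by decide)

/-- The superposition of outgoing modes with the coefficients `a`. -/
def modeSeries (lam : ℝ) (a : ℤ → ℂ) (z : ℂ) : ℂ := ∑' n, a n * outgoingMode lam n z

theorem exists_norm_outgoingMode_le {lam : ℝ} (hlam : 0 < lam) {ε : ℝ} (hε : 0 < ε) :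
    ∃ C : ℝ, 1 ≤ C ∧ ∃ K : ℝ, 0 ≤ K ∧ ∀ (n : ℤ) (z : ℂ), ε ≤ ‖z‖ →
      ‖outgoingMode lam n z‖ ≤ K * (C ^ n.natAbs * (n.natAbs.factorial : ℝ)) := by
  obtain ⟨C, hC, h⟩ := exists_hankel1_bounds (mul_pos hlam hε)
  refine ⟨C, hC, C * (lam * ε) ^ (-(1 / 2) : ℝ), by positivity, fun n z hz => ?_⟩
  have hz0 : z ≠ 0 := norm_pos_iff.1 (hε.trans_le hz)
  rw [norm_outgoingMode lam n hz0]
  have h1 := (h n.natAbs (lam * ‖z‖) (by gcongr)).1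
  have h2 : (lam * ‖z‖) ^ (-(1 / 2) : ℝ) ≤ (lam * ε) ^ (-(1 / 2) : ℝ) :=
    Real.rpow_le_rpow_of_nonpos (by positivity) (by gcongr) (by norm_num)
  calc _ ≤ C ^ (n.natAbs + 1) * n.natAbs.factorial * (lam * ε) ^ (-(1 / 2) : ℝ) :=
        h1.trans (by gcongr)
    _ = _ := by ring

theorem FactorialDecay.summable_mul_of_bound {a : ℤ → ℂ} (ha : FactorialDecay a) {C K : ℝ}
    (hC : 1 ≤ C) {e : ℤ → ℂ} (he : ∀ n, ‖e n‖ ≤ K * (C ^ n.natAbs * (n.natAbs.factorial : ℝ))) :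
    Summable fun n => a n * e n := by
  refine Summable.of_norm_bounded ((ha C hC).mul_left K) fun n => ?_
  rw [norm_mul]
  calc _ ≤ ‖a n‖ * (K * (C ^ n.natAbs * (n.natAbs.factorial : ℝ))) := by gcongr; exact he n
    _ = _ := by ring

theorem FactorialDecay.summable_modeSeries {a : ℤ → ℂ} (ha : FactorialDecay a) {lam : ℝ}
    (hlam : 0 < lam) {z : ℂ} (hz : z ≠ 0) : Summable fun n => a n * outgoingMode lam n z := by
  obtain ⟨C, hC, K, hK, h⟩ := exists_norm_outgoingMode_le hlam (norm_pos_iff.2 hz)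
  exact ha.summable_mul_of_bound hC fun n => h n z le_rfl

/-- Termwise differentiation on a ball avoiding the origin. Reindexing then moves the shift from the
modes to the coefficients, so the derivative is again built from mode series. -/
theorem FactorialDecay.hasFDerivAt_modeSeries {a : ℤ → ℂ} (ha : FactorialDecay a) {lam : ℝ}
    (hlam : 0 < lam) {z : ℂ} (hz : z ≠ 0) :
    HasFDerivAt (modeSeries lam a) (wirtinger (lam / 2 * modeSeries lam (fun n => a (n + 1)) z)
      (lam / 2 * modeSeries lam (fun n => a (n - 1)) z)) z := by
  have hr : 0 < ‖z‖ := norm_pos_iff.2 hz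
  obtain ⟨C, hC, K, hK, h⟩ := exists_norm_outgoingMode_le hlam (half_pos hr)
  have hball : ∀ w ∈ Metric.ball z (‖z‖ / 2), ‖z‖ / 2 ≤ ‖w‖ := by
    intro w hw
    rw [Metric.mem_ball, dist_eq_norm] at hw
    have := norm_sub_norm_le z w
    rw [norm_sub_rev] at hw
    linarith
  have hne : ∀ w ∈ Metric.ball z (‖z‖ / 2), w ≠ 0 := fun w hw =>
    norm_pos_iff.1 ((half_pos hr).trans_le (hball w hw))
  have hu : Summable fun n : ℤ => lam * K * C *
      (‖a n‖ * ((2 * C) ^ n.natAbs * (n.natAbs.factorial : ℝ))) :=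
    (ha (2 * C) (by linarith)).mul_left _
  have hbound : ∀ (n s : ℤ) (w : ℂ), s.natAbs = 1 → w ∈ Metric.ball z (‖z‖ / 2) →
      ‖outgoingMode lam (n + s) w‖ ≤ K * (C * ((2 * C) ^ n.natAbs * n.natAbs.factorial)) := by
    intro n s w hs hw
    exact (h (n + s) w (hball w hw)).trans
      (mul_le_mul_of_nonneg_left (pow_mul_factorial_le_of_natAbs_le hC (by omega)) hK)
  have hd := hasFDerivAt_tsum_of_isPreconnected (𝕜 := ℝ)
    (f := fun (n : ℤ) (w : ℂ) => a n * outgoingMode lam n w)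
    (f' := fun (n : ℤ) (w : ℂ) => a n • wirtinger (lam / 2 * outgoingMode lam (n - 1) w)
      (lam / 2 * outgoingMode lam (n + 1) w)) hu Metric.isOpen_ball
    (convex_ball z (‖z‖ / 2)).isPreconnected
    (fun n w hw => (hasFDerivAt_outgoingMode hlam n (hne w hw)).const_mul (a n))
    (fun n w hw => by
      rw [norm_smul]
      have h1 := norm_wirtinger_le (lam / 2 * outgoingMode lam (n - 1) w)
        (lam / 2 * outgoingMode lam (n + 1) w)
      have h2 := hbound n (-1) w (by decide) hw
      have h3 := hbound n 1 w (by decide) hw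
      have h4 : ‖(lam / 2 : ℂ)‖ = lam / 2 := by
        rw [norm_div, Complex.norm_two, Complex.norm_real, Real.norm_of_nonneg hlam.le]
      rw [norm_mul, norm_mul, h4] at h1
      rw [← sub_eq_add_neg] at h2
      calc _ ≤ ‖a n‖ * (lam / 2 * (K * (C * ((2 * C) ^ n.natAbs * n.natAbs.factorial))) +
            lam / 2 * (K * (C * ((2 * C) ^ n.natAbs * n.natAbs.factorial)))) := by
            gcongr
            exact h1.trans (by gcongr)
        _ = _ := by ring)
    (Metric.mem_ball_self (half_pos hr)) (ha.summable_modeSeries hlam hz)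
    (Metric.mem_ball_self (half_pos hr))
  refine hd.congr_fderiv ?_
  have s1 := ha.shift_right.summable_modeSeries hlam hz
  have s2 := ha.shift_left.summable_modeSeries hlam hz
  have r1 : modeSeries lam (fun n => a (n + 1)) z = ∑' n, a n * outgoingMode lam (n - 1) z := by
    rw [modeSeries, ← (Equiv.subRight (1 : ℤ)).tsum_eq]
    simp
  have r2 : modeSeries lam (fun n => a (n - 1)) z = ∑' n, a n * outgoingMode lam (n + 1) z := by
    rw [modeSeries, ← (Equiv.addRight (1 : ℤ)).tsum_eq]
    simp
  have s1' : Summable fun n => a n * outgoingMode lam (n - 1) z := by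
    rw [← (Equiv.subRight (1 : ℤ)).summable_iff] at s1
    simpa [Function.comp_def] using s1
  have s2' : Summable fun n => a n * outgoingMode lam (n + 1) z := by
    rw [← (Equiv.addRight (1 : ℤ)).summable_iff] at s2
    simpa [Function.comp_def] using s2
  have hterm : ∀ n, a n • wirtinger (lam / 2 * outgoingMode lam (n - 1) z)
      (lam / 2 * outgoingMode lam (n + 1) z) =
      (lam / 2 * (a n * outgoingMode lam (n - 1) z)) • ContinuousLinearMap.id ℝ ℂ -
      (lam / 2 * (a n * outgoingMode lam (n + 1) z)) • Complex.conjCLE.toContinuousLinearMap := by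
    intro n
    ext1 v
    rw [smul_apply, wirtinger_apply]
    simp
    ring
  simp only [hterm]
  rw [Summable.tsum_sub ((s1'.mul_left _).smul_const _) ((s2'.mul_left _).smul_const _),
    ((s1'.mul_left _).tsum_smul_const _), ((s2'.mul_left _).tsum_smul_const _), tsum_mul_left,
    tsum_mul_left, ← r1, ← r2, wirtinger]

theorem FactorialDecay.contDiffOn_modeSeries {a : ℤ → ℂ} (ha : FactorialDecay a) {lam : ℝ}
    (hlam : 0 < lam) (k : ℕ) : ContDiffOn ℝ k (modeSeries lam a) {0}ᶜ := by
  induction k generalizing a with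
  | zero =>
    refine contDiffOn_zero.2 fun z hz => ?_
    exact (ha.hasFDerivAt_modeSeries hlam hz).continuousAt.continuousWithinAt
  | succ k ih =>
    push_cast
    refine (contDiffOn_succ_iff_fderiv_of_isOpen isOpen_compl_singleton).2 ⟨fun z hz =>
      (ha.hasFDerivAt_modeSeries hlam hz).differentiableAt.differentiableWithinAt, by simp, ?_⟩
    have h : ContDiffOn ℝ k (fun z => wirtinger (lam / 2 * modeSeries lam (fun n => a (n + 1)) z)
      (lam / 2 * modeSeries lam (fun n => a (n - 1)) z)) {0}ᶜ :=
      ((contDiffOn_const.mul (ih ha.shift_right)).smul contDiffOn_const).sub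
        ((contDiffOn_const.mul (ih ha.shift_left)).smul contDiffOn_const)
    exact h.congr fun z hz => (ha.hasFDerivAt_modeSeries hlam hz).fderiv

/-- The Laplacian is `4 ∂_z ∂_z̄`. The two shifts undo each other and leave `4 · (λ/2) · (-λ/2) =
-λ²`, while the double shifts cancel between the two coordinate directions. -/
theorem FactorialDecay.laplacian_modeSeries {a : ℤ → ℂ} (ha : FactorialDecay a) {lam : ℝ}
    (hlam : 0 < lam) {z : ℂ} (hz : z ≠ 0) :
    Laplacian.laplacian (modeSeries lam a) z = -(lam : ℂ) ^ 2 * modeSeries lam a z := by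
  have hev : (fderiv ℝ (modeSeries lam a)) =ᶠ[𝓝 z] fun z =>
      wirtinger (lam / 2 * modeSeries lam (fun n => a (n + 1)) z)
        (lam / 2 * modeSeries lam (fun n => a (n - 1)) z) := by
    filter_upwards [isOpen_compl_singleton.mem_nhds hz] with w hw
    exact (ha.hasFDerivAt_modeSeries hlam hw).fderiv
  have d1 := (ha.shift_right.hasFDerivAt_modeSeries hlam hz).const_mul (lam / 2 : ℂ)
  have d2 := (ha.shift_left.hasFDerivAt_modeSeries hlam hz).const_mul (lam / 2 : ℂ)
  have d3 := (d1.smul_const (ContinuousLinearMap.id ℝ ℂ)).sub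
    (d2.smul_const Complex.conjCLE.toContinuousLinearMap)
  have d4 : fderiv ℝ (fderiv ℝ (modeSeries lam a)) z = _ := hev.fderiv_eq.trans d3.fderiv
  rw [InnerProductSpace.laplacian_eq_iteratedFDeriv_complexPlane]
  simp only [iteratedFDeriv_two_apply, d4]
  simp [wirtinger_apply]
  linear_combination (lam : ℂ) ^ 2 / 4 * (modeSeries lam (fun n => a (n + 1 + 1)) z +
    2 * modeSeries lam a z + modeSeries lam (fun n => a (n - 1 - 1)) z) * Complex.I_sq

/-! ### Expansion of plane waves -/

/-- The bijection `(j, k) ↦ (j - k, min j k)`. -/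
def natProdEquivIntProd : ℕ × ℕ ≃ ℤ × ℕ where
  toFun p := ((p.1 : ℤ) - p.2, min p.1 p.2)
  invFun q := (q.2 + q.1.toNat, q.2 + (-q.1).toNat)
  left_inv p := by
    ext
    · simp
      omega
    · simp
      omega
  right_inv q := by
    ext
    · simp
    · simp
      omega

theorem summable_besselJ_series (n : ℕ) (x : ℝ) : Summable fun k : ℕ =>
    (-1 : ℝ) ^ k * (x / 2) ^ (2 * k + n) / ((k.factorial : ℝ) * ((k + n).factorial : ℝ)) := by
  refine ((summable_besselPhi n ((x / 2) ^ 2)).mul_left ((x / 2) ^ n)).congr fun k => ?_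
  rw [phiCoeff, pow_add, pow_mul]
  ring

/-- Terms of the two exponential series are indexed by the difference `n` and the minimum `m` of
their exponents. One of `n.toNat`, `(-n).toNat` is zero, so the factorials are `m!` and `(m+|n|)!`,
as in the series of `J_|n|`. -/
theorem jacobi_anger_term (x : ℝ) {t : ℂ} (ht : t ≠ 0) (n : ℤ) (m : ℕ) :
    (Complex.I * x / 2 * t) ^ (m + n.toNat) / ((m + n.toNat).factorial : ℂ) *
      ((Complex.I * x / 2 * t⁻¹) ^ (m + (-n).toNat) / ((m + (-n).toNat).factorial : ℂ)) =
    Complex.I ^ n.natAbs * t ^ n * (((-1 : ℝ) ^ m * (x / 2) ^ (2 * m + n.natAbs) /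
      ((m.factorial : ℝ) * ((m + n.natAbs).factorial : ℝ)) : ℝ) : ℂ) := by
  obtain ⟨p, q, hp, hq, habs, hn, hpq⟩ : ∃ p q : ℕ, n.toNat = p ∧ (-n).toNat = q ∧
      n.natAbs = p + q ∧ n = (p : ℤ) - q ∧ (p = 0 ∨ q = 0) :=
    ⟨n.toNat, (-n).toNat, rfl, rfl, by omega, by omega, by omega⟩
  have hI : Complex.I ^ m * Complex.I ^ m = (-1) ^ m := by
    rw [← mul_pow, Complex.I_mul_I]
  have hfac : ((m + p).factorial : ℂ) * (m + q).factorial =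
      m.factorial * (m + (p + q)).factorial := by
    rcases hpq with h | h <;> simp [h, mul_comm]
  have hz : t ^ n = t ^ p * t⁻¹ ^ q := by
    rw [hn, zpow_sub₀ ht, zpow_natCast, zpow_natCast, inv_pow, div_eq_mul_inv]
  have ht' : t ^ m * t⁻¹ ^ m = 1 := by rw [← mul_pow, mul_inv_cancel₀ ht, one_pow]
  rw [hp, hq, habs, hz, div_mul_div_comm, hfac]
  push_cast
  rw [mul_div_assoc', ← hI]
  congr 1
  rw [mul_pow, mul_pow, mul_div_assoc, mul_pow, mul_pow]
  linear_combination (Complex.I ^ (m + p) * Complex.I ^ (m + q) * ((x : ℂ) / 2) ^ (m + p) *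
    ((x : ℂ) / 2) ^ (m + q) * t ^ p * t⁻¹ ^ q) * ht'

/-- The Jacobi–Anger expansion. -/
theorem hasSum_jacobi_anger (x : ℝ) {t : ℂ} (ht : ‖t‖ = 1) :
    HasSum (fun n : ℤ => Complex.I ^ n.natAbs * besselJ n.natAbs x * t ^ n)
      (Complex.exp (Complex.I * ((x * t.re : ℝ) : ℂ))) := by
  have ht0 : t ≠ 0 := norm_ne_zero_iff.1 (by rw [ht]; norm_num)
  have hexp : ∀ z : ℂ, HasSum (fun k : ℕ => z ^ k / k.factorial) (Complex.exp z) := fun z => by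
    rw [Complex.exp_eq_exp_ℂ]
    exact NormedSpace.expSeries_div_hasSum_exp (𝔸 := ℂ) z
  have hnorm : ∀ z : ℂ, Summable fun k : ℕ => ‖z ^ k / k.factorial‖ := fun z =>
    NormedSpace.norm_expSeries_div_summable z
  have hsum := summable_mul_of_summable_norm (hnorm (Complex.I * x / 2 * t))
    (hnorm (Complex.I * x / 2 * t⁻¹))
  have h1 := (hexp (Complex.I * x / 2 * t)).mul (hexp (Complex.I * x / 2 * t⁻¹)) hsum
  have hre : Complex.I * x / 2 * t + Complex.I * x / 2 * t⁻¹ =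
      Complex.I * ((x * t.re : ℝ) : ℂ) := by
    have h2 : t⁻¹ = (starRingEnd ℂ) t := by
      rw [Complex.inv_def, Complex.normSq_eq_norm_sq, ht]
      simp
    rw [h2]
    push_cast
    rw [Complex.re_eq_add_conj]
    ring
  rw [← Complex.exp_add, hre] at h1
  have h3 : HasSum (fun q : ℤ × ℕ => Complex.I ^ q.1.natAbs * t ^ q.1 *
      (((-1 : ℝ) ^ q.2 * (x / 2) ^ (2 * q.2 + q.1.natAbs) /
        ((q.2.factorial : ℝ) * ((q.2 + q.1.natAbs).factorial : ℝ)) : ℝ) : ℂ))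
      (Complex.exp (Complex.I * ((x * t.re : ℝ) : ℂ))) :=
    (natProdEquivIntProd.symm.hasSum_iff.2 h1).congr_fun fun q =>
      (jacobi_anger_term x ht0 q.1 q.2).symm
  refine h3.prod_fiberwise fun n => ?_
  have h2 := (Complex.hasSum_ofReal.2 (summable_besselJ_series n.natAbs x).hasSum).mul_left
    (Complex.I ^ n.natAbs * t ^ n)
  rw [← besselJ, mul_right_comm] at h2
  exact h2

/-! ### The scattering coefficients -/

/-- The Fourier coefficients `-J_{|n|} / (π H_{|n|}^{(1)})` of the scattering amplitude. -/
def ampCoeff (lam : ℝ) (n : ℤ) : ℂ :=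
  -(besselJ n.natAbs lam / (Real.pi * hankel1 n.natAbs lam))

theorem factorialDecay_of_natAbs {a : ℤ → ℂ} {f : ℕ → ℂ} (ha : ∀ n, a n = f n.natAbs)
    (hf : ∀ C : ℝ, 1 ≤ C → Summable fun n : ℕ => ‖f n‖ * (C ^ n * (n.factorial : ℝ))) :
    FactorialDecay a := by
  intro C hC
  refine Summable.of_nat_of_neg ?_ ?_ <;> simpa [ha] using hf C hC

/-- The bound `(λ/2)^n / n!` on `J_n` and the factorial lower bound on `H_n^{(1)}` leave two
factorials in the denominator. After multiplication by `C^n n!` one survives, giving an exponential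
series. -/
theorem factorialDecay_ampCoeff {lam : ℝ} (hlam : 0 < lam) : FactorialDecay (ampCoeff lam) := by
  refine factorialDecay_of_natAbs
    (f := fun n => -(besselJ n lam / (Real.pi * hankel1 n lam))) (fun n => rfl) fun C hC => ?_
  rw [← summable_nat_add_iff 1]
  have hpi := Real.pi_pos
  have hs := ((Real.summable_pow_div_factorial (C * (lam / 2) ^ 2)).mul_left
    (2 * Real.exp ((lam / 2) ^ 2) * (C * (lam / 2) ^ 2)))
  refine hs.of_norm_bounded_eventually_nat ?_
  filter_upwards [norm_hankel1_succ_ge lam] with n hn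
  have h1 := hn lam hlam le_rfl
  have h2 := abs_besselJ_le (n + 1) hlam.le
  have h0 : 0 < (n.factorial : ℝ) / (2 * Real.pi) * (2 / lam) ^ (n + 1) := by positivity
  rw [Real.norm_of_nonneg (by positivity), norm_neg, norm_div, norm_mul, Complex.norm_real,
    Complex.norm_real, Real.norm_of_nonneg hpi.le, Real.norm_eq_abs]
  calc |besselJ (n + 1) lam| / (Real.pi * ‖hankel1 (n + 1) lam‖) *
        (C ^ (n + 1) * ((n + 1).factorial : ℝ))
      ≤ ((lam / 2) ^ (n + 1) * Real.exp ((lam / 2) ^ 2) / (n + 1).factorial) /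
        (Real.pi * ((n.factorial : ℝ) / (2 * Real.pi) * (2 / lam) ^ (n + 1))) *
        (C ^ (n + 1) * ((n + 1).factorial : ℝ)) := by gcongr
    _ = _ := by
      rw [show (2 : ℝ) / lam = (lam / 2)⁻¹ by rw [inv_div], inv_pow, mul_pow C]
      have hy : 0 < lam / 2 := by positivity
      generalize lam / 2 = y at hy
      field_simp
      ring

theorem FactorialDecay.mul_unimodular {a w : ℤ → ℂ} (ha : FactorialDecay a)
    (hw : ∀ n, ‖w n‖ ≤ 1) : FactorialDecay fun n => a n * w n := by
  intro C hC
  refine (ha C hC).of_nonneg_of_le (fun n => by positivity) fun n => ?_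
  rw [norm_mul]
  gcongr
  exact mul_le_of_le_one_right (norm_nonneg _) (hw n)

theorem FactorialDecay.const_mul {a : ℤ → ℂ} (ha : FactorialDecay a) (c : ℂ) :
    FactorialDecay fun n => c * a n := by
  intro C hC
  refine ((ha C hC).mul_left ‖c‖).congr fun n => ?_
  rw [norm_mul]
  ring

theorem FactorialDecay.index_mul {a : ℤ → ℂ} (ha : FactorialDecay a) :
    FactorialDecay fun n => (n : ℂ) * a n := by
  intro C hC
  refine (ha (2 * C) (by linarith)).of_nonneg_of_le (fun n => by positivity) fun n => ?_
  rw [norm_mul, Complex.norm_intCast, ← Int.cast_abs, ← Nat.cast_natAbs]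
  have h : (n.natAbs : ℝ) ≤ 2 ^ n.natAbs := by exact_mod_cast Nat.lt_two_pow_self.le
  rw [mul_pow]
  calc (n.natAbs : ℝ) * ‖a n‖ * (C ^ n.natAbs * n.natAbs.factorial)
      ≤ 2 ^ n.natAbs * ‖a n‖ * (C ^ n.natAbs * n.natAbs.factorial) := by gcongr
    _ = _ := by ring

theorem FactorialDecay.summable_norm {a : ℤ → ℂ} (ha : FactorialDecay a) :
    Summable fun n => ‖a n‖ := by
  refine (ha 1 le_rfl).of_nonneg_of_le (fun n => norm_nonneg _) fun n => ?_
  refine le_mul_of_one_le_right (norm_nonneg _) ?_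
  rw [one_pow, one_mul]
  exact_mod_cast Nat.factorial_pos _

/-- The trigonometric series with the coefficients `a`. -/
def trigSeries (a : ℤ → ℂ) (t : ℝ) : ℂ :=
  ∑' n : ℤ, a n * Complex.exp (((n * t : ℝ) : ℂ) * Complex.I)

theorem FactorialDecay.hasDerivAt_trigSeries {a : ℤ → ℂ} (ha : FactorialDecay a) (t : ℝ) :
    HasDerivAt (trigSeries a) (Complex.I * trigSeries (fun n => n * a n) t) t := by
  have h := hasDerivAt_tsum (g := fun (n : ℤ) (t : ℝ) =>
      a n * Complex.exp (((n * t : ℝ) : ℂ) * Complex.I))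
    (g' := fun (n : ℤ) (t : ℝ) => Complex.I * (n * a n *
      Complex.exp (((n * t : ℝ) : ℂ) * Complex.I))) ha.index_mul.summable_norm
    (fun n t => by
      have h1 : HasDerivAt (fun t : ℝ => ((n * t : ℝ) : ℂ) * Complex.I) (n * Complex.I) t := by
        have := (((hasDerivAt_id t).const_mul (n : ℝ)).ofReal_comp).mul_const Complex.I
        simpa using this
      refine (h1.cexp.const_mul (a n)).congr_deriv (by ring))
    (fun n t => by
      rw [norm_mul, norm_mul, Complex.norm_I, Complex.norm_exp_ofReal_mul_I, one_mul, mul_one])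
    (y₀ := 0) (Summable.of_norm (by
      simpa [Complex.norm_exp_ofReal_mul_I] using ha.summable_norm)) t
  refine h.congr_deriv ?_
  rw [tsum_mul_left, trigSeries]

theorem FactorialDecay.contDiff_trigSeries {a : ℤ → ℂ} (ha : FactorialDecay a) (k : ℕ) :
    ContDiff ℝ k (trigSeries a) := by
  induction k generalizing a with
  | zero =>
    exact contDiff_zero.2 (continuous_iff_continuousAt.2 fun t =>
      (ha.hasDerivAt_trigSeries t).continuousAt)
  | succ k ih =>
    push_cast
    refine contDiff_succ_iff_deriv.2 ⟨fun t => (ha.hasDerivAt_trigSeries t).differentiableAt,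
      by simp, ?_⟩
    rw [funext fun t => (ha.hasDerivAt_trigSeries t).deriv]
    exact contDiff_const.mul (ih ha.index_mul)

/-! ### The outgoing solution -/

theorem norm_dir (θ : S1) : ‖dir θ‖ = 1 := Circle.norm_coe _

theorem fourier_eq_dir_zpow (n : ℤ) (θ : S1) : (fourier n θ : ℂ) = dir θ ^ n := by
  rw [fourier_apply, AddCircle.toCircle_zsmul, Circle.coe_zpow, dir]

theorem fourier_sub (n : ℤ) (θ ω : S1) : (fourier n (θ - ω) : ℂ) = (dir θ / dir ω) ^ n := by
  rw [fourier_eq_dir_zpow, sub_eq_add_neg, dir, AddCircle.toCircle_add, AddCircle.toCircle_neg,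
    ← div_eq_mul_inv, Circle.coe_div, dir, dir]

theorem norm_fourier_apply (n : ℤ) (θ : S1) : ‖(fourier n θ : ℂ)‖ = 1 := by
  rw [fourier_apply, Circle.norm_coe]

theorem I_zpow_mul_hankelZ (n : ℤ) (x : ℝ) :
    Complex.I ^ n * hankelZ n x = Complex.I ^ n.natAbs * hankel1 n.natAbs x := by
  obtain ⟨k, rfl | rfl⟩ := n.eq_nat_or_neg
  · rw [hankelZ_natCast, zpow_natCast, Int.natAbs_natCast]
  · rw [hankelZ_neg_natCast, Int.natAbs_neg, Int.natAbs_natCast, zpow_neg, zpow_natCast,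
      ← inv_pow, Complex.inv_I, ← mul_assoc, ← mul_pow]
    simp

/-- The convolution kernel `∑ c_n e^{inθ}` of the scattering amplitude. -/
def ampKernel (lam : ℝ) (θ : S1) : ℂ := ∑' n : ℤ, ampCoeff lam n * fourier n θ

theorem summable_ampKernel {lam : ℝ} (hlam : 0 < lam) (θ : S1) :
    Summable fun n : ℤ => ampCoeff lam n * (fourier n θ : ℂ) :=
  Summable.of_norm (by
    simpa only [norm_mul, norm_fourier_apply, mul_one] using
      (factorialDecay_ampCoeff hlam).summable_norm)

theorem continuous_ampKernel {lam : ℝ} (hlam : 0 < lam) : Continuous (ampKernel lam) :=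
  continuous_tsum (fun n => (fourier n).continuous.const_mul _)
    (factorialDecay_ampCoeff hlam).summable_norm
    (fun n θ => by rw [norm_mul, norm_fourier_apply, mul_one])

theorem ampKernel_coe (lam : ℝ) (t : ℝ) : ampKernel lam (t : S1) = trigSeries (ampCoeff lam) t :=
  tsum_congr fun n => by rw [fourier_two_pi]

/-- The coefficients of the expansion of the scattered wave in outgoing modes. -/
def scatteredCoeff (lam : ℝ) (ω : S1) (n : ℤ) : ℂ :=
  Real.pi * ampCoeff lam n * (Complex.I ^ n * dir ω ^ (-n))

theorem factorialDecay_scatteredCoeff {lam : ℝ} (hlam : 0 < lam) (ω : S1) :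
    FactorialDecay (scatteredCoeff lam ω) :=
  ((factorialDecay_ampCoeff hlam).const_mul _).mul_unimodular fun n => by
    rw [norm_mul, norm_zpow, norm_zpow, norm_dir, Complex.norm_I, one_zpow, one_zpow, one_mul]

/-- The scattered wave. -/
def scatteredWave (lam : ℝ) (ω : S1) : ℂ → ℂ := modeSeries lam (scatteredCoeff lam ω)

theorem scatteredCoeff_mul_outgoingMode (lam : ℝ) (ω : S1) (n : ℤ) {z : ℂ} :
    scatteredCoeff lam ω n * outgoingMode lam n z =
      Real.pi * ampCoeff lam n * (Complex.I ^ n.natAbs * hankel1 n.natAbs (lam * ‖z‖)) *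
        (z / ‖z‖ / dir ω) ^ n := by
  rw [← I_zpow_mul_hankelZ, scatteredCoeff, outgoingMode, div_zpow _ (dir ω), zpow_neg]
  ring

/-- On the unit circle the Hankel factor of each mode cancels the denominator of `ampCoeff`, leaving
minus the Jacobi–Anger expansion. -/
theorem scatteredWave_boundary {lam : ℝ} (hlam : 0 < lam) (ω : S1) {z : ℂ} (hz : ‖z‖ = 1) :
    scatteredWave lam ω z = -Complex.exp (Complex.I * ((lam * inner ℝ z (dir ω) : ℝ) : ℂ)) := by
  have h := hasSum_jacobi_anger lam (t := z / dir ω) (by rw [norm_div, norm_dir, hz, div_one])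
  have hre : (z / dir ω).re = inner ℝ z (dir ω) := by
    rw [Complex.inner, Complex.div_re, Complex.normSq_eq_norm_sq, norm_dir]
    simp
    ring
  rw [hre] at h
  rw [← h.tsum_eq, ← tsum_neg, scatteredWave, modeSeries]
  refine tsum_congr fun n => ?_
  rw [scatteredCoeff_mul_outgoingMode, hz, mul_one, Complex.ofReal_one, div_one, ampCoeff]
  have h1 := hankel1_ne_zero n.natAbs hlam
  have h2 : (Real.pi : ℂ) ≠ 0 := by exact_mod_cast Real.pi_ne_zero
  field_simp

theorem outgoingWave_mul {lam r : ℝ} :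
    Real.pi * outgoingWave (lam * r) = Complex.exp (-(Real.pi : ℂ) * Complex.I / 4) *
      (Real.sqrt (2 * Real.pi / (lam * r)) : ℂ) *
      Complex.exp (Complex.I * ((lam * r : ℝ) : ℂ)) := by
  have hpi := Real.pi_pos
  have h : Real.sqrt (2 * Real.pi / (lam * r)) =
      Real.pi * Real.sqrt (2 / (Real.pi * (lam * r))) := by
    rw [show 2 * Real.pi / (lam * r) = Real.pi ^ 2 * (2 / (Real.pi * (lam * r))) by field_simp,
      Real.sqrt_mul (by positivity), Real.sqrt_sq hpi.le]
  rw [h, outgoingWave]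
  push_cast
  ring

/-- The phases `i^|n|` of Jacobi–Anger cancel the `(-i)^|n|` of the Hankel asymptotics, so the
profile is exactly the convolution kernel. The remainders, of size `C^{|n|+1} |n|!`, sum by
factorial decay. -/
theorem scatteredWave_outgoing {lam : ℝ} (hlam : 0 < lam) (ω : S1) :
    ∃ C R : ℝ, 0 < R ∧ ∀ r : ℝ, R ≤ r → ∀ θ : S1,
      ‖scatteredWave lam ω ((r : ℂ) * dir θ) -
        Complex.exp (-(Real.pi : ℂ) * Complex.I / 4) *
          (Real.sqrt (2 * Real.pi / (lam * r)) : ℂ) *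
          Complex.exp (Complex.I * ((lam * r : ℝ) : ℂ)) * ampKernel lam (θ - ω)‖
      ≤ C * r ^ (-(3 / 2) : ℝ) := by
  obtain ⟨C, hC, hb⟩ := exists_hankel1_bounds hlam
  have ha := factorialDecay_ampCoeff hlam
  refine ⟨Real.pi * C * (∑' n : ℤ, ‖ampCoeff lam n‖ * (C ^ n.natAbs * (n.natAbs.factorial : ℝ))) *
    lam ^ (-(3 / 2) : ℝ), 1, one_pos, fun r hr θ => ?_⟩
  have hr0 : 0 < r := one_pos.trans_le hr
  have hnorm : ‖(r : ℂ) * dir θ‖ = r := by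
    rw [norm_mul, norm_dir, mul_one, Complex.norm_real, Real.norm_of_nonneg hr0.le]
  have hz : (r : ℂ) * dir θ ≠ 0 := norm_ne_zero_iff.1 (by rw [hnorm]; exact hr0.ne')
  have hdir : (r : ℂ) * dir θ / (r : ℂ) = dir θ :=
    mul_div_cancel_left₀ _ (by exact_mod_cast hr0.ne')
  rw [← outgoingWave_mul, scatteredWave, modeSeries, ampKernel, ← tsum_mul_left,
    ← ((factorialDecay_scatteredCoeff hlam ω).summable_modeSeries hlam hz).tsum_sub
      ((summable_ampKernel hlam _).mul_left _)]
  have hs := ((ha C hC).mul_left (Real.pi * C)).mul_right ((lam * r) ^ (-(3 / 2) : ℝ))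
  refine (tsum_of_norm_bounded hs.hasSum fun n => ?_).trans_eq ?_
  · rw [scatteredCoeff_mul_outgoingMode, hnorm, hdir, fourier_sub]
    have h1 := (hb n.natAbs (lam * r) (le_mul_of_one_le_right hlam.le hr)).2
    have h2 : (Complex.I : ℂ) ^ n.natAbs * hankel1 n.natAbs (lam * r) - outgoingWave (lam * r) =
        Complex.I ^ n.natAbs * (hankel1 n.natAbs (lam * r) -
          (-Complex.I) ^ n.natAbs * outgoingWave (lam * r)) := by
      rw [mul_sub, ← mul_assoc, ← mul_pow]
      simp
    rw [show Real.pi * ampCoeff lam n * (Complex.I ^ n.natAbs * hankel1 n.natAbs (lam * r)) *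
        (dir θ / dir ω) ^ n - Real.pi * outgoingWave (lam * r) * (ampCoeff lam n *
        (dir θ / dir ω) ^ n) = Real.pi * ampCoeff lam n * (dir θ / dir ω) ^ n *
        (Complex.I ^ n.natAbs * hankel1 n.natAbs (lam * r) - outgoingWave (lam * r)) by ring,
      h2, norm_mul, norm_mul, norm_mul, norm_mul, norm_zpow, norm_div, norm_dir, norm_dir,
      norm_pow, Complex.norm_I, Complex.norm_real, Real.norm_of_nonneg Real.pi_pos.le]
    simp only [div_one, one_zpow, one_pow, mul_one, one_mul]
    calc Real.pi * ‖ampCoeff lam n‖ * ‖hankel1 n.natAbs (lam * r) -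
          (-Complex.I) ^ n.natAbs * outgoingWave (lam * r)‖
        ≤ Real.pi * ‖ampCoeff lam n‖ * (C ^ (n.natAbs + 1) * n.natAbs.factorial *
          (lam * r) ^ (-(3 / 2) : ℝ)) := by gcongr
      _ = _ := by ring
  · rw [tsum_mul_right, tsum_mul_left, Real.mul_rpow hlam.le hr0.le]
    ring

theorem isOutgoingSolution_scatteredWave {lam : ℝ} (hlam : 0 < lam) (ω : S1) :
    IsOutgoingSolution lam ω (scatteredWave lam ω) fun θ => ampKernel lam (θ - ω) where
  smooth := by
    refine contDiffOn_infty.2 fun k =>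
      ((factorialDecay_scatteredCoeff hlam ω).contDiffOn_modeSeries hlam k).mono ?_
    rintro z hz rfl
    simp at hz
  helmholtz z hz := by
    have hz0 : z ≠ 0 := norm_pos_iff.1 (one_pos.trans hz)
    rw [scatteredWave, (factorialDecay_scatteredCoeff hlam ω).laplacian_modeSeries hlam hz0]
    ring
  boundary z hz := scatteredWave_boundary hlam ω hz
  profile_smooth := by
    induction ω using QuotientAddGroup.induction_on with
    | H s =>
      have h : (fun t : ℝ => ampKernel lam ((t : S1) - (s : S1))) =
          fun t => trigSeries (ampCoeff lam) (t - s) := by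
        funext t
        rw [← ampKernel_coe, AddCircle.coe_sub]
      change ContDiff ℝ _ fun t : ℝ => ampKernel lam ((t : S1) - (s : S1))
      rw [h]
      exact contDiff_infty.2 fun k =>
        ((factorialDecay_ampCoeff hlam).contDiff_trigSeries k).comp
          (contDiff_id.sub contDiff_const)
  outgoing := scatteredWave_outgoing hlam ω

/-! ### Radiation condition for radial solutions -/

theorem outgoingWave_ne_zero {x : ℝ} (hx : 0 < x) : outgoingWave x ≠ 0 := by
  rw [← norm_pos_iff, norm_outgoingWave]
  have := Real.pi_pos
  positivity

theorem tendsto_div_outgoingWave {F : ℝ → ℂ} {L : ℂ} {C : ℝ}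
    (h : ∀ᶠ x in atTop, ‖F x - L * outgoingWave x‖ ≤ C * x ^ (-(3 / 2) : ℝ)) :
    Tendsto (fun x => F x / outgoingWave x) atTop (𝓝 L) := by
  rw [tendsto_iff_norm_sub_tendsto_zero]
  have h0 : Tendsto (fun x : ℝ => C * Real.sqrt (Real.pi / 2) * x⁻¹) atTop (𝓝 0) := by
    simpa using tendsto_inv_atTop_zero.const_mul (C * Real.sqrt (Real.pi / 2))
  refine squeeze_zero' (Eventually.of_forall fun x => norm_nonneg _) ?_ h0
  filter_upwards [h, eventually_gt_atTop 0] with x hx hx0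
  have hpi := Real.pi_pos
  have hw := outgoingWave_ne_zero hx0
  rw [show F x / outgoingWave x - L = (F x - L * outgoingWave x) / outgoingWave x by
    field_simp, norm_div, div_le_iff₀ (norm_pos_iff.2 hw)]
  refine hx.trans_eq ?_
  rw [norm_outgoingWave, mul_assoc, mul_assoc, mul_left_comm (Real.sqrt _),
    ← Real.sqrt_mul (by positivity),
    show Real.pi / 2 * (2 / (Real.pi * x)) = x⁻¹ by field_simp, Real.sqrt_eq_rpow,
    ← Real.rpow_neg_one x, ← Real.rpow_mul hx0.le, ← Real.rpow_add hx0]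
  norm_num

theorem tendsto_hankel1_div_outgoingWave (n : ℕ) :
    Tendsto (fun x => hankel1 n x / outgoingWave x) atTop (𝓝 ((-Complex.I) ^ n)) := by
  obtain ⟨C, hC, hb⟩ := exists_hankel1_bounds one_pos
  refine tendsto_div_outgoingWave (C := C ^ (n + 1) * n.factorial) ?_
  filter_upwards [eventually_ge_atTop 1] with x hx
  exact (hb n x hx).2

/-- After removing the outgoing part, `β` times `i e^{-2ix}` must converge. A shift by `π/2` flips
its sign, so the limit is `0`, while its modulus is constantly `|β|`. -/
theorem eq_zero_of_outgoing_combination {n : ℕ} {α β L : ℂ}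
    (h : Tendsto (fun x => (α * hankel1 n x + β * hankel2 n x) / outgoingWave x) atTop (𝓝 L)) :
    β = 0 := by
  set q : ℝ → ℂ := fun x => (starRingEnd ℂ) (outgoingWave x) / outgoingWave x
  have hq : ∀ x, 0 < x → q x = Complex.I * Complex.exp (-(2 * x * Complex.I)) := by
    intro x hx
    have hs : ((Real.sqrt (2 / (Real.pi * x)) : ℝ) : ℂ) ≠ 0 := by
      have := Real.pi_pos
      exact_mod_cast (Real.sqrt_pos.2 (by positivity)).ne'
    have hI : Complex.exp (Real.pi * Complex.I / 4) * Complex.exp (Real.pi * Complex.I / 4) =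
        Complex.I := by
      rw [← Complex.exp_add, show (Real.pi : ℂ) * Complex.I / 4 + Real.pi * Complex.I / 4 =
        Real.pi / 2 * Complex.I by ring, Complex.exp_pi_div_two_mul_I]
    have e1 : Complex.exp (-(2 * x * Complex.I)) =
        Complex.exp (-(Complex.I * x)) * Complex.exp (-(Complex.I * x)) := by
      rw [← Complex.exp_add]
      congr 1
      ring
    have e2 : (starRingEnd ℂ) (outgoingWave x) = (Real.sqrt (2 / (Real.pi * x)) : ℂ) *
        Complex.exp (-(Complex.I * x)) * Complex.exp (Real.pi * Complex.I / 4) := by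
      rw [outgoingWave, map_mul, map_mul, Complex.conj_ofReal, ← Complex.exp_conj,
        ← Complex.exp_conj]
      simp [neg_div, map_ofNat (starRingEnd ℂ) 4]
    simp only [q]
    rw [div_eq_iff (outgoingWave_ne_zero hx), e2, outgoingWave, e1, neg_mul, neg_div,
      Complex.exp_neg (Complex.I * x), Complex.exp_neg (Real.pi * Complex.I / 4)]
    have hE := Complex.exp_ne_zero (Complex.I * x)
    have hA := Complex.exp_ne_zero (Real.pi * Complex.I / 4)
    generalize Complex.exp (Complex.I * x) = E at hE
    generalize Complex.exp (Real.pi * Complex.I / 4) = A at hI hA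
    rw [← hI]
    field_simp
  have h1 := tendsto_hankel1_div_outgoingWave n
  have h2 : Tendsto (fun x => hankel2 n x / (starRingEnd ℂ) (outgoingWave x)) atTop
      (𝓝 (Complex.I ^ n)) := by
    have h3 := (Complex.continuous_conj.tendsto _).comp h1
    simp only [map_pow, map_neg, Complex.conj_I, neg_neg] at h3
    refine h3.congr fun x => ?_
    simp only [Function.comp_apply, map_div₀, star_hankel1]
  have h4 := ((h.sub (h1.const_mul α)).div h2 (pow_ne_zero n Complex.I_ne_zero))
  have h5 : Tendsto (fun x => β * q x) atTop
      (𝓝 ((L - α * (-Complex.I) ^ n) / Complex.I ^ n)) := by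
    refine h4.congr' ?_
    filter_upwards [eventually_gt_atTop 0] with x hx
    have hw := outgoingWave_ne_zero hx
    have hw' : (starRingEnd ℂ) (outgoingWave x) ≠ 0 := (map_ne_zero _).2 hw
    have hh := hankel2_ne_zero n hx
    simp only [Pi.div_apply, q]
    field_simp
    ring
  generalize (L - α * (-Complex.I) ^ n) / Complex.I ^ n = M at h5
  have h6 : Tendsto (fun x => β * q (x + Real.pi / 2)) atTop (𝓝 M) :=
    h5.comp (tendsto_atTop_add_const_right _ _ tendsto_id)
  have h7 : Tendsto (fun x => β * q x) atTop (𝓝 (-M)) := by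
    refine h6.neg.congr' ?_
    filter_upwards [eventually_gt_atTop 0] with x hx
    rw [hq x hx, hq (x + Real.pi / 2) (by have := Real.pi_pos; positivity)]
    have : -(2 * ((x + Real.pi / 2 : ℝ) : ℂ) * Complex.I) =
        -(2 * x * Complex.I) - Real.pi * Complex.I := by push_cast; ring
    rw [this, Complex.exp_sub, Complex.exp_pi_mul_I]
    ring
  have h8 : M = 0 := by
    have := tendsto_nhds_unique h5 h7
    exact self_eq_neg.1 this
  rw [h8] at h5
  have h9 : Tendsto (fun _ : ℝ => ‖β‖) atTop (𝓝 0) := by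
    refine (h5.norm.congr' ?_).trans (by simp)
    filter_upwards [eventually_gt_atTop 0] with x hx
    have := Complex.norm_exp_ofReal_mul_I (-(2 * x))
    rw [hq x hx, norm_mul, norm_mul, Complex.norm_I, one_mul]
    push_cast at this
    rw [neg_mul] at this
    rw [this, mul_one]
  exact norm_eq_zero.1 (tendsto_nhds_unique tendsto_const_nhds h9)

/-- A solution of the radial Helmholtz equation outside the unit disk vanishes if it vanishes on
the boundary and is outgoing. -/
theorem radial_eq_zero {lam : ℝ} (hlam : 0 < lam) (n : ℕ) {v v1 v2 : ℝ → ℂ}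
    (hv : ∀ r, 1 < r → HasDerivAt v (v1 r) r) (hv1 : ∀ r, 1 < r → HasDerivAt v1 (v2 r) r)
    (ode : ∀ r : ℝ, 1 < r → r ^ 2 * v2 r + r * v1 r + (lam ^ 2 * r ^ 2 - n ^ 2) * v r = 0)
    (hc : ContinuousWithinAt v (Set.Ioi 1) 1) (h1 : v 1 = 0) {C : ℝ} {L : ℂ}
    (hout : ∀ᶠ r in atTop, ‖v r - L * outgoingWave (lam * r)‖ ≤ C * r ^ (-(3 / 2) : ℝ))
    {r : ℝ} (hr : 1 ≤ r) : v r = 0 := by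
  have hl : (lam : ℂ) ≠ 0 := by exact_mod_cast hlam.ne'
  set f : ℝ → ℂ := fun x => v (lam⁻¹ * x) with hf
  set f1 : ℝ → ℂ := fun x => (lam : ℂ)⁻¹ * v1 (lam⁻¹ * x) with hf1
  -- In the variable `x = λr`, this combination plays the role of order `n + 1`: it turns the
  -- second-order equation into the first-order system of the Hankel pair.
  set g : ℝ → ℂ := fun x => n / x * f x - f1 x with hg
  have hx1 : ∀ x, lam < x → 1 < lam⁻¹ * x := fun x hx => by
    rw [inv_mul_eq_div, one_lt_div hlam]; exact hx
  have hlin : ∀ x : ℝ, HasDerivAt (fun x => lam⁻¹ * x) lam⁻¹ x := fun x => by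
    simpa using (hasDerivAt_id x).const_mul lam⁻¹
  have df : ∀ x, lam < x → HasDerivAt f (f1 x) x := fun x hx => by
    refine ((hv _ (hx1 x hx)).scomp x (hlin x)).congr_deriv ?_
    rw [Complex.real_smul, Complex.ofReal_inv]
  have df1 : ∀ x, lam < x → HasDerivAt f1 ((lam : ℂ)⁻¹ ^ 2 * v2 (lam⁻¹ * x)) x := fun x hx => by
    refine (((hv1 _ (hx1 x hx)).scomp x (hlin x)).const_mul (lam : ℂ)⁻¹).congr_deriv ?_
    rw [Complex.real_smul, Complex.ofReal_inv]
    ring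
  obtain ⟨α, β, hab⟩ := exists_eq_hankel_of_hasDerivAt (n := n) hlam.le (f := f) (g := g)
    (fun x hx => (df x hx).congr_deriv (by simp only [hg]; ring))
    (fun x hx => by
      have hxc : (x : ℂ) ≠ 0 := by exact_mod_cast (hlam.trans hx).ne'
      have hdiv : HasDerivAt (fun x : ℝ => (n : ℂ) / x) (-n / (x : ℂ) ^ 2) x := by
        have := ((hasDerivAt_inv hxc).comp_ofReal).const_mul (n : ℂ)
        refine this.congr_deriv (by ring)
      refine ((hdiv.mul (df x hx)).sub (df1 x hx)).congr_deriv ?_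
      have ho := ode _ (hx1 x hx)
      push_cast at ho
      simp only [hg, hf1]
      change _ = f x - _
      have e : v (lam⁻¹ * x) = f x := rfl
      rw [e] at ho
      field_simp at ho ⊢
      linear_combination -ho)
  have hβ : β = 0 := by
    refine eq_zero_of_outgoing_combination (n := n) (α := α) (L := L) ?_
    have h2 : Tendsto (fun x => f x / outgoingWave x) atTop (𝓝 L) := by
      refine tendsto_div_outgoingWave (C := C * lam⁻¹ ^ (-(3 / 2) : ℝ)) ?_
      have h3 := (tendsto_id.const_mul_atTop (inv_pos.2 hlam)).eventually hout
      filter_upwards [h3, eventually_gt_atTop 0] with x hx hx0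
      simp only [id] at hx
      rw [mul_inv_cancel_left₀ hlam.ne', Real.mul_rpow (by positivity) hx0.le, ← mul_assoc] at hx
      exact hx
    refine h2.congr' ?_
    filter_upwards [eventually_gt_atTop lam] with x hx
    rw [(hab x hx).1]
  have hval : ∀ s, 1 < s → v s = α * hankel1 n (lam * s) := fun s hs => by
    have := (hab (lam * s) (lt_mul_of_one_lt_right hlam hs)).1
    simp only [hf, hβ, zero_mul, add_zero, inv_mul_cancel_left₀ hlam.ne'] at this
    exact this
  have hα : α = 0 := by
    have h2 : Tendsto (fun s => α * hankel1 n (lam * s)) (𝓝[>] 1) (𝓝 (v 1)) :=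
      hc.tendsto.congr' (by filter_upwards [self_mem_nhdsWithin] with s hs using hval s hs)
    have h3 : ContinuousAt (fun s : ℝ => α * hankel1 n (lam * s)) 1 := by
      have h4 : ContinuousAt (hankel1 n) (lam * 1) :=
        (hasDerivAt_hankel1 n (by rwa [mul_one])).continuousAt
      exact (h4.comp (f := fun s : ℝ => lam * s) (by fun_prop)).const_mul α
    have h5 := tendsto_nhds_unique h2 (h3.tendsto.mono_left nhdsWithin_le_nhds)
    rw [h1, mul_one] at h5
    exact (mul_eq_zero.1 h5.symm).resolve_right (hankel1_ne_zero n hlam)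
  rcases hr.eq_or_lt with rfl | hr
  · exact h1
  · rw [hval r hr, hα, zero_mul]

/-! ### Uniqueness of the outgoing solution -/

theorem hasDerivAt_intervalIntegral_of_continuousOn {F F' : ℝ → ℝ → ℂ} {a b R r : ℝ} (hr : R < r)
    (hF : ContinuousOn (Function.uncurry F) (Set.Ioi R ×ˢ Set.univ))
    (hF' : ContinuousOn (Function.uncurry F') (Set.Ioi R ×ˢ Set.univ))
    (hd : ∀ s, R < s → ∀ t, HasDerivAt (fun s => F s t) (F' s t) s) :
    HasDerivAt (fun s => ∫ t in a..b, F s t) (∫ t in a..b, F' r t) r := by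
  have hsl : ∀ {G : ℝ → ℝ → ℂ}, ContinuousOn (Function.uncurry G) (Set.Ioi R ×ˢ Set.univ) →
      ∀ s, R < s → Continuous (G s) := fun hG s hs =>
    hG.comp_continuous (f := fun t => (s, t)) (by fun_prop) fun t => ⟨hs, trivial⟩
  obtain ⟨m, hm1, hm2⟩ := exists_between hr
  have hK : IsCompact (Set.Icc m (r + 1) ×ˢ Set.uIcc a b) := isCompact_Icc.prod isCompact_uIcc
  obtain ⟨M, hM⟩ := hK.exists_bound_of_continuousOn (hF'.mono
    (Set.prod_mono (fun s hs => hm1.trans_le hs.1) (Set.subset_univ _)))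
  refine (intervalIntegral.hasDerivAt_integral_of_dominated_loc_of_deriv_le
    (s := Set.Icc m (r + 1)) (bound := fun _ => M) (Icc_mem_nhds hm2 (by linarith)) ?_
    ((hsl hF r hr).intervalIntegrable _ _) (hsl hF' r hr).aestronglyMeasurable ?_
    intervalIntegrable_const ?_).2
  · filter_upwards [Ioi_mem_nhds hr] with s hs using (hsl hF s hs).aestronglyMeasurable
  · exact Eventually.of_forall fun t ht s hs => hM (s, t) ⟨hs, Set.uIoc_subset_uIcc ht⟩
  · exact Eventually.of_forall fun t ht s hs => hd s (hm1.trans_le hs.1) t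

/-- The vector `e^{it}`. -/
def expI (t : ℝ) : ℂ := Complex.exp (t * Complex.I)

theorem norm_expI (t : ℝ) : ‖expI t‖ = 1 := Complex.norm_exp_ofReal_mul_I t

theorem continuous_expI : Continuous expI := by unfold expI; fun_prop

theorem hasDerivAt_expI (t : ℝ) : HasDerivAt expI (Complex.I * expI t) t := by
  have h : HasDerivAt (fun t : ℝ => (t : ℂ) * Complex.I) Complex.I t := by
    simpa using (hasDerivAt_id t).ofReal_comp.mul_const Complex.I
  exact h.cexp.congr_deriv (mul_comm _ _)

theorem dir_coe_eq_expI (t : ℝ) : dir (t : S1) = expI t := by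
  have h := fourier_two_pi 1 t
  rw [fourier_eq_dir_zpow, zpow_one] at h
  simpa [expI] using h

theorem expI_two_pi_periodic : expI (2 * Real.pi) = expI 0 := by
  simp [expI]

theorem norm_ofReal_mul_expI {r : ℝ} (hr : 0 ≤ r) (t : ℝ) : ‖(r : ℂ) * expI t‖ = r := by
  rw [norm_mul, norm_expI, mul_one, Complex.norm_real, Real.norm_of_nonneg hr]

theorem expI_eq (t : ℝ) : expI t = (Real.cos t : ℂ) + Real.sin t * Complex.I := by
  rw [expI, Complex.exp_mul_I, Complex.ofReal_cos, Complex.ofReal_sin]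

/-- The angular function `e^{-int}`. -/
def angular (n : ℤ) (t : ℝ) : ℂ := Complex.exp (-(n * t) * Complex.I)

theorem norm_angular (n : ℤ) (t : ℝ) : ‖angular n t‖ = 1 := by
  have := Complex.norm_exp_ofReal_mul_I (-(n * t))
  rw [angular, ← this]
  push_cast
  rfl

theorem continuous_angular (n : ℤ) : Continuous (angular n) := by unfold angular; fun_prop

theorem hasDerivAt_angular (n : ℤ) (t : ℝ) :
    HasDerivAt (angular n) (-(n * Complex.I) * angular n t) t := by
  have h : HasDerivAt (fun t : ℝ => -((n : ℂ) * (t : ℂ)) * Complex.I) (-(n * Complex.I)) t := by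
    have := ((((hasDerivAt_id t).ofReal_comp).const_mul (n : ℂ)).neg).mul_const Complex.I
    refine this.congr_deriv (by simp)
  exact h.cexp.congr_deriv (mul_comm _ _)

theorem angular_two_pi (n : ℤ) : angular n (2 * Real.pi) = angular n 0 := by
  rw [angular, angular]
  have h := Complex.exp_int_mul_two_pi_mul_I (-n)
  push_cast at h ⊢
  rw [show -((n : ℂ) * (2 * Real.pi)) * Complex.I = -n * (2 * Real.pi * Complex.I) by ring, h]
  simp

/-- The trace of a bilinear form is the same in every orthonormal frame. This expresses the
Laplacian through radial and angular second derivatives. -/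
theorem bilinear_expI (B : ℂ →L[ℝ] ℂ →L[ℝ] ℂ) (t : ℝ) :
    B (expI t) (expI t) + B (Complex.I * expI t) (Complex.I * expI t) =
      B 1 1 + B Complex.I Complex.I := by
  have h1 : expI t = Real.cos t • (1 : ℂ) + Real.sin t • Complex.I := by
    rw [expI_eq, Complex.real_smul, Complex.real_smul, mul_one]
  have h2 : Complex.I * expI t = -(Real.sin t) • (1 : ℂ) + Real.cos t • Complex.I := by
    rw [expI_eq, Complex.real_smul, Complex.real_smul, mul_one]
    push_cast
    linear_combination (Complex.sin t) * Complex.I_sq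
  have hcs : ((Real.cos t : ℝ) : ℂ) ^ 2 + ((Real.sin t : ℝ) : ℂ) ^ 2 = 1 := by
    exact_mod_cast Real.cos_sq_add_sin_sq t
  rw [h2, h1]
  simp only [map_add, map_smul, add_apply, smul_apply]
  simp only [Complex.real_smul, Complex.ofReal_neg]
  linear_combination (B 1 1 + B Complex.I Complex.I) * hcs

theorem isOpen_exterior : IsOpen {z : ℂ | 1 < ‖z‖} := isOpen_lt continuous_const continuous_norm

theorem hasFDerivAt_exterior {w : ℂ → ℂ} (hw : ContDiffOn ℝ 2 w {z | 1 < ‖z‖}) {z : ℂ}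
    (hz : 1 < ‖z‖) : HasFDerivAt w (fderiv ℝ w z) z :=
  ((hw.contDiffAt (isOpen_exterior.mem_nhds hz)).differentiableAt (by norm_num)).hasFDerivAt

theorem contDiffOn_fderiv_exterior {w : ℂ → ℂ} (hw : ContDiffOn ℝ 2 w {z | 1 < ‖z‖}) :
    ContDiffOn ℝ 1 (fderiv ℝ w) {z | 1 < ‖z‖} :=
  hw.fderiv_of_isOpen isOpen_exterior (by norm_num)

theorem hasFDerivAt_fderiv_exterior {w : ℂ → ℂ}
    (hw : ContDiffOn ℝ 2 w {z | 1 < ‖z‖}) {z : ℂ} (hz : 1 < ‖z‖) :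
    HasFDerivAt (fderiv ℝ w) (fderiv ℝ (fderiv ℝ w) z) z :=
  (((contDiffOn_fderiv_exterior hw).contDiffAt (isOpen_exterior.mem_nhds hz)).differentiableAt
    (by norm_num)).hasFDerivAt

theorem laplacian_eq_fderiv_fderiv (w : ℂ → ℂ) (z : ℂ) : Laplacian.laplacian w z =
    fderiv ℝ (fderiv ℝ w) z 1 1 + fderiv ℝ (fderiv ℝ w) z Complex.I Complex.I := by
  rw [InnerProductSpace.laplacian_eq_iteratedFDeriv_complexPlane]
  simp [iteratedFDeriv_two_apply]

/-- The bracket is `(∂_t² + n²)` applied to `w(r e^{it})`. Multiplied by `e^{-int}` it is the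
derivative of a `2π`-periodic function. -/
theorem integral_polar_eq_zero {w : ℂ → ℂ} (hw : ContDiffOn ℝ 2 w {z | 1 < ‖z‖}) (n : ℤ) {r : ℝ}
    (hr : 1 < r) : ∫ t in (0 : ℝ)..2 * Real.pi,
      (r ^ 2 * fderiv ℝ (fderiv ℝ w) (r * expI t) (Complex.I * expI t) (Complex.I * expI t) -
        r * fderiv ℝ w (r * expI t) (expI t) + n ^ 2 * w (r * expI t)) * angular n t = 0 := by
  have hU : ∀ t, 1 < ‖(r : ℂ) * expI t‖ := fun t => by
    rwa [norm_ofReal_mul_expI (by linarith)]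
  have hp : ∀ t, HasDerivAt (fun t : ℝ => (r : ℂ) * expI t) (r * (Complex.I * expI t)) t :=
    fun t => (hasDerivAt_expI t).const_mul _
  have hcp : Continuous fun t => (r : ℂ) * expI t := continuous_const.mul continuous_expI
  set W1 : ℝ → ℂ := fun t => fderiv ℝ w (r * expI t) (r * (Complex.I * expI t)) with hW1
  have d0 : ∀ t, HasDerivAt (fun t => w (r * expI t)) (W1 t) t := fun t =>
    (hasFDerivAt_exterior hw (hU t)).comp_hasDerivAt t (hp t)
  have hsm : ∀ z : ℂ, (r : ℂ) * z = r • z := fun z => (Complex.real_smul).symm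
  have d1 : ∀ t, HasDerivAt W1
      (r ^ 2 * fderiv ℝ (fderiv ℝ w) (r * expI t) (Complex.I * expI t) (Complex.I * expI t) -
        r * fderiv ℝ w (r * expI t) (expI t)) t := fun t => by
    have h1 := (hasFDerivAt_fderiv_exterior hw (hU t)).comp_hasDerivAt t (hp t)
    have h2 := h1.clm_apply (((hasDerivAt_expI t).const_mul Complex.I).const_mul (r : ℂ))
    refine h2.congr_deriv ?_
    simp only [Function.comp_apply]
    rw [show Complex.I * (Complex.I * expI t) = -expI t by
      rw [← mul_assoc, Complex.I_mul_I, neg_one_mul]]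
    rw [hsm (Complex.I * expI t), hsm (-expI t)]
    simp only [map_smul, map_neg, smul_apply]
    simp only [Complex.real_smul]
    ring
  have d2 : ∀ t ∈ Set.uIcc 0 (2 * Real.pi), HasDerivAt
      (fun t => W1 t * angular n t + n * Complex.I * (w (r * expI t) * angular n t))
      ((r ^ 2 * fderiv ℝ (fderiv ℝ w) (r * expI t) (Complex.I * expI t) (Complex.I * expI t) -
        r * fderiv ℝ w (r * expI t) (expI t) + n ^ 2 * w (r * expI t)) * angular n t) t :=
    fun t _ => by
      refine (((d1 t).mul (hasDerivAt_angular n t)).add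
        (((d0 t).mul (hasDerivAt_angular n t)).const_mul (n * Complex.I))).congr_deriv ?_
      linear_combination -(n : ℂ) ^ 2 * w (r * expI t) * angular n t * Complex.I_sq
  have hc1 : Continuous fun t => fderiv ℝ w (r * expI t) :=
    (contDiffOn_fderiv_exterior hw).continuousOn.comp_continuous hcp hU
  have hc2 : Continuous fun t => fderiv ℝ (fderiv ℝ w) (r * expI t) :=
    ((contDiffOn_fderiv_exterior hw).continuousOn_fderiv_of_isOpen isOpen_exterior
      (by norm_num)).comp_continuous hcp hU
  have hc0 : Continuous fun t => w (r * expI t) := hw.continuousOn.comp_continuous hcp hU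
  have hcI : Continuous fun t => Complex.I * expI t := continuous_const.mul continuous_expI
  rw [intervalIntegral.integral_eq_sub_of_hasDerivAt d2 (Continuous.intervalIntegrable
    ((((continuous_const.mul ((hc2.clm_apply hcI).clm_apply hcI)).sub
      (continuous_const.mul (hc1.clm_apply continuous_expI))).add
      (continuous_const.mul hc0)).mul (continuous_angular n)) _ _)]
  simp only [hW1, expI_two_pi_periodic, angular_two_pi, sub_self]

/-- With all Fourier coefficients zero the Fourier series is trivially summable, hence converges
pointwise to the continuous function. -/
theorem eq_zero_of_integral_angular_eq_zero {f : S1 → ℂ} (hf : Continuous f)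
    (h : ∀ n : ℤ, ∫ t in (0 : ℝ)..2 * Real.pi, f (t : S1) * angular n t = 0) (θ : S1) :
    f θ = 0 := by
  have h1 : fourierCoeff (⟨f, hf⟩ : C(S1, ℂ)) = 0 := by
    funext n
    rw [fourierCoeff_eq_intervalIntegral _ n 0, zero_add, Pi.zero_apply]
    have : ∫ x in (0 : ℝ)..2 * Real.pi, (fourier (-n) (x : S1) : ℂ) • f x = 0 := by
      rw [← h n]
      refine intervalIntegral.integral_congr fun t _ => ?_
      simp only [fourier_two_pi, angular, smul_eq_mul]
      rw [mul_comm]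
      push_cast
      rw [neg_mul]
    exact (congrArg _ this).trans (smul_zero _)
  have h2 := has_pointwise_sum_fourier_series_of_summable (f := (⟨f, hf⟩ : C(S1, ℂ)))
    (by rw [h1]; exact summable_zero) θ
  rw [h1] at h2
  have h3 : HasSum (fun _ : ℤ => (0 : ℂ)) (f θ) := by simpa using h2
  exact h3.unique hasSum_zero

/-- Each angular Fourier coefficient of `w` satisfies the hypotheses of `radial_eq_zero`, with
leading coefficient the Fourier integral of `c`. Vanishing of all coefficients on every circle gives
`w = 0`. -/
theorem eq_zero_of_helmholtz {lam : ℝ} (hlam : 0 < lam) {w : ℂ → ℂ}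
    (hc : ContinuousOn w (Metric.ball (0 : ℂ) 1)ᶜ) (hw : ContDiffOn ℝ 2 w {z | 1 < ‖z‖})
    (hh : ∀ z, 1 < ‖z‖ → Laplacian.laplacian w z = -(lam : ℂ) ^ 2 * w z)
    (hb : ∀ z, ‖z‖ = 1 → w z = 0) {c : S1 → ℂ} (hcc : Continuous c) {C : ℝ}
    (hout : ∀ᶠ r : ℝ in atTop, ∀ θ : S1,
      ‖w (r * dir θ) - c θ * outgoingWave (lam * r)‖ ≤ C * r ^ (-(3 / 2) : ℝ))
    {z : ℂ} (hz : 1 ≤ ‖z‖) : w z = 0 := by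
  have hpi := Real.pi_pos
  have hmap : Continuous fun p : ℝ × ℝ => (p.1 : ℂ) * expI p.2 :=
    (Complex.continuous_ofReal.comp continuous_fst).mul (continuous_expI.comp continuous_snd)
  have hmaps : Set.MapsTo (fun p : ℝ × ℝ => (p.1 : ℂ) * expI p.2) (Set.Ioi 1 ×ˢ Set.univ)
      {z | 1 < ‖z‖} := fun p hp => by
    have h1 : (1 : ℝ) < p.1 := hp.1
    change 1 < ‖_‖
    rwa [norm_ofReal_mul_expI (by linarith)]
  have hU : ∀ r : ℝ, 1 < r → ∀ t, 1 < ‖(r : ℂ) * expI t‖ := fun r hr t =>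
    hmaps (x := (r, t)) ⟨hr, trivial⟩
  have hcE : Continuous fun p : ℝ × ℝ => expI p.2 := continuous_expI.comp continuous_snd
  have hc0 : ContinuousOn (fun p : ℝ × ℝ => w (p.1 * expI p.2)) (Set.Ioi 1 ×ˢ Set.univ) :=
    hw.continuousOn.comp hmap.continuousOn hmaps
  have hc1 : ContinuousOn (fun p : ℝ × ℝ => fderiv ℝ w (p.1 * expI p.2) (expI p.2))
      (Set.Ioi 1 ×ˢ Set.univ) :=
    ((contDiffOn_fderiv_exterior hw).continuousOn.comp hmap.continuousOn hmaps).clm_apply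
      hcE.continuousOn
  have hc2 : ContinuousOn (fun p : ℝ × ℝ =>
      fderiv ℝ (fderiv ℝ w) (p.1 * expI p.2) (expI p.2) (expI p.2)) (Set.Ioi 1 ×ˢ Set.univ) :=
    ((((contDiffOn_fderiv_exterior hw).continuousOn_fderiv_of_isOpen isOpen_exterior
      (by norm_num)).comp hmap.continuousOn hmaps).clm_apply hcE.continuousOn).clm_apply
      hcE.continuousOn
  have hp : ∀ t r, HasDerivAt (fun r : ℝ => (r : ℂ) * expI t) (expI t) r := fun t r => by
    simpa using (hasDerivAt_id r).ofReal_comp.mul_const (expI t)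
  have key : ∀ n : ℤ, ∀ r : ℝ, 1 ≤ r →
      ∫ t in (0 : ℝ)..2 * Real.pi, w (r * expI t) * angular n t = 0 := by
    intro n r hr
    have hcn : Continuous fun p : ℝ × ℝ => angular n p.2 :=
      (continuous_angular n).comp continuous_snd
    refine radial_eq_zero hlam n.natAbs
      (v := fun r => ∫ t in (0 : ℝ)..2 * Real.pi, w (r * expI t) * angular n t)
      (v1 := fun r => ∫ t in (0 : ℝ)..2 * Real.pi,
        fderiv ℝ w (r * expI t) (expI t) * angular n t)
      (v2 := fun r => ∫ t in (0 : ℝ)..2 * Real.pi,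
        fderiv ℝ (fderiv ℝ w) (r * expI t) (expI t) (expI t) * angular n t)
      ?_ ?_ ?_ ?_ ?_ (C := C * (2 * Real.pi))
      (L := ∫ t in (0 : ℝ)..2 * Real.pi, c (t : S1) * angular n t) ?_ hr
    · intro s hs
      refine hasDerivAt_intervalIntegral_of_continuousOn
        (F := fun r t => w (r * expI t) * angular n t)
        (F' := fun r t => fderiv ℝ w (r * expI t) (expI t) * angular n t) hs
        (hc0.mul hcn.continuousOn)
        (hc1.mul hcn.continuousOn) fun s hs t => ?_
      exact ((hasFDerivAt_exterior hw (hU s hs t)).comp_hasDerivAt s (hp t s)).mul_const _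
    · intro s hs
      refine hasDerivAt_intervalIntegral_of_continuousOn
        (F := fun r t => fderiv ℝ w (r * expI t) (expI t) * angular n t)
        (F' := fun r t => fderiv ℝ (fderiv ℝ w) (r * expI t) (expI t) (expI t) * angular n t) hs
        (hc1.mul hcn.continuousOn)
        (hc2.mul hcn.continuousOn) fun s hs t => ?_
      have h1 := (hasFDerivAt_fderiv_exterior hw (hU s hs t)).comp_hasDerivAt s (hp t s)
      have h2 := (h1.clm_apply (hasDerivAt_const s (expI t))).mul_const (angular n t)
      simpa using h2
    · intro s hs
      have hsl : ∀ {G : ℝ × ℝ → ℂ}, ContinuousOn G (Set.Ioi 1 ×ˢ Set.univ) →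
          IntervalIntegrable (fun t => G (s, t) * angular n t) volume 0 (2 * Real.pi) := fun hG =>
        ((hG.comp_continuous (f := fun t => (s, t)) (by fun_prop) fun t => ⟨hs, trivial⟩).mul
          (continuous_angular n)).intervalIntegrable _ _
      have i0 := hsl hc0
      have i1 := hsl hc1
      have i2 := hsl hc2
      simp only at i0 i1 i2
      have hz := integral_polar_eq_zero hw n hs
      rw [← intervalIntegral.integral_const_mul, ← intervalIntegral.integral_const_mul,
        ← intervalIntegral.integral_const_mul, ← intervalIntegral.integral_add
          (i2.const_mul _) (i1.const_mul _), ← intervalIntegral.integral_add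
          ((i2.const_mul _).add (i1.const_mul _)) (i0.const_mul _), ← neg_eq_zero, ← hz,
        ← intervalIntegral.integral_neg]
      refine intervalIntegral.integral_congr fun t _ => ?_
      have h1 := hh _ (hU s hs t)
      rw [laplacian_eq_fderiv_fderiv, ← bilinear_expI _ t] at h1
      have h2 : ((n.natAbs : ℕ) : ℂ) ^ 2 = (n : ℂ) ^ 2 := by
        rw [← Int.cast_natCast, ← Int.cast_pow, Int.natAbs_sq, Int.cast_pow]
      rw [h2]
      linear_combination (-(s : ℂ) ^ 2 * angular n t) * h1
    -- Replacing `s` by `max 1 s` extends the integrand continuously to all `s`, so continuity up to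
    -- the boundary follows from a global statement.
    · have hcont : Continuous fun s : ℝ => ∫ t in (0 : ℝ)..2 * Real.pi,
          w ((max 1 s : ℝ) * expI t) * angular n t := by
        refine intervalIntegral.continuous_parametric_intervalIntegral_of_continuous'
          (f := fun s t => w ((max 1 s : ℝ) * expI t) * angular n t) ?_ _ _
        refine Continuous.mul ?_ hcn
        refine hc.comp_continuous (f := fun p : ℝ × ℝ => ((max 1 p.1 : ℝ) : ℂ) * expI p.2)
          ((Complex.continuous_ofReal.comp (continuous_const.max continuous_fst)).mul hcE)
          fun p => ?_
        simp [norm_expI, le_abs]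
      refine hcont.continuousAt.continuousWithinAt.congr (s := Set.Ioi 1) (fun s hs => ?_) ?_
      · simp only [max_eq_right (le_of_lt (Set.mem_Ioi.1 hs))]
      · simp only [max_self]
    · refine intervalIntegral.integral_zero_ae (Eventually.of_forall fun t _ => ?_)
      rw [hb _ (norm_ofReal_mul_expI zero_le_one t), zero_mul]
    · filter_upwards [hout, eventually_gt_atTop 1] with s hs hs1
      have i0 : IntervalIntegrable (fun t => w (s * expI t) * angular n t) volume 0
          (2 * Real.pi) :=
        ((hc0.comp_continuous (f := fun t => (s, t)) (by fun_prop) fun t => ⟨hs1, trivial⟩).mul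
          (continuous_angular n)).intervalIntegrable _ _
      have i1 : IntervalIntegrable (fun t : ℝ => c (t : S1) * angular n t) volume 0
          (2 * Real.pi) :=
        ((hcc.comp (AddCircle.continuous_mk' _)).mul (continuous_angular n)).intervalIntegrable _ _
      rw [← intervalIntegral.integral_mul_const, ← intervalIntegral.integral_sub i0
        (i1.mul_const _)]
      refine (intervalIntegral.norm_integral_le_of_norm_le_const
        (C := C * s ^ (-(3 / 2) : ℝ)) fun t _ => ?_).trans_eq ?_
      · have h1 := hs (t : S1)
        rw [dir_coe_eq_expI] at h1
        rw [mul_right_comm, ← sub_mul, norm_mul, norm_angular, mul_one]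
        exact h1
      · rw [sub_zero, abs_of_pos (by positivity)]
        ring
  have hz0 : z ≠ 0 := norm_pos_iff.1 (one_pos.trans_le hz)
  have h1 := eq_zero_of_integral_angular_eq_zero (f := fun θ => w (‖z‖ * dir θ))
    (hc.comp_continuous (continuous_const.mul
      (continuous_subtype_val.comp AddCircle.continuous_toCircle)) fun θ => by
        simpa [norm_dir] using hz) (fun n => by
      simp only [dir_coe_eq_expI]
      exact key n _ hz) (z.arg : S1)
  rwa [dir_coe_eq_expI, expI, Complex.norm_mul_exp_arg_mul_I] at h1

theorem IsOutgoingSolution.continuous_profile {lam : ℝ} {ω : S1} {u : ℂ → ℂ} {b : S1 → ℂ}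
    (h : IsOutgoingSolution lam ω u b) : Continuous b :=
  continuous_coinduced_dom.2 h.profile_smooth.continuous

theorem IsOutgoingSolution.eventually {lam : ℝ} {ω : S1} {u : ℂ → ℂ} {b : S1 → ℂ}
    (h : IsOutgoingSolution lam ω u b) : ∃ C : ℝ, ∀ᶠ r : ℝ in atTop, ∀ θ : S1,
      ‖u (r * dir θ) - Real.pi * b θ * outgoingWave (lam * r)‖ ≤ C * r ^ (-(3 / 2) : ℝ) := by
  obtain ⟨C, R, hR, hb⟩ := h.outgoing
  refine ⟨C, ?_⟩
  filter_upwards [eventually_ge_atTop R] with r hr θ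
  have h1 := hb r hr θ
  rw [← outgoingWave_mul] at h1
  rwa [mul_right_comm]

theorem IsOutgoingSolution.unique {lam : ℝ} (hlam : 0 < lam) {ω : S1} {u u' : ℂ → ℂ}
    {b b' : S1 → ℂ} (h : IsOutgoingSolution lam ω u b) (h' : IsOutgoingSolution lam ω u' b') :
    Set.EqOn u u' (Metric.ball (0 : ℂ) 1)ᶜ ∧ b = b' := by
  have hsub : {z : ℂ | 1 < ‖z‖} ⊆ (Metric.ball (0 : ℂ) 1)ᶜ := fun z (hz : 1 < ‖z‖) => by
    simpa using hz.le
  have h2 : (2 : WithTop ℕ∞) ≤ ((⊤ : ℕ∞) : WithTop ℕ∞) :=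
    WithTop.coe_le_coe.2 (le_top : (2 : ℕ∞) ≤ ⊤)
  have hu : ContDiffOn ℝ 2 u {z | 1 < ‖z‖} := (h.smooth.of_le h2).mono hsub
  have hu' : ContDiffOn ℝ 2 u' {z | 1 < ‖z‖} := (h'.smooth.of_le h2).mono hsub
  obtain ⟨C, hC⟩ := h.eventually
  obtain ⟨C', hC'⟩ := h'.eventually
  have hsum : ∀ r : ℝ, ∀ θ : S1,
      ‖u (r * dir θ) - Real.pi * b θ * outgoingWave (lam * r)‖ ≤ C * r ^ (-(3 / 2) : ℝ) →
      ‖u' (r * dir θ) - Real.pi * b' θ * outgoingWave (lam * r)‖ ≤ C' * r ^ (-(3 / 2) : ℝ) →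
      ‖(u (r * dir θ) - u' (r * dir θ)) - (Real.pi * (b θ - b' θ)) * outgoingWave (lam * r)‖ ≤
        (C + C') * r ^ (-(3 / 2) : ℝ) := fun r θ h1 h2 => by
    have h3 := (norm_sub_le _ _).trans (add_le_add h1 h2)
    rw [add_mul]
    refine le_trans (le_of_eq (congrArg _ ?_)) h3
    ring
  have hz : ∀ z : ℂ, 1 ≤ ‖z‖ → u z - u' z = 0 := fun z hz => by
    refine eq_zero_of_helmholtz hlam (w := u - u') (h.smooth.continuousOn.sub
      h'.smooth.continuousOn) (hu.sub hu') (fun z hz => ?_) (fun z hz => ?_)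
      (c := fun θ => Real.pi * (b θ - b' θ))
      (continuous_const.mul (h.continuous_profile.sub h'.continuous_profile))
      (C := C + C') ?_ hz
    · have hm := isOpen_exterior.mem_nhds hz
      rw [ContDiffAt.laplacian_sub (hu.contDiffAt hm) (hu'.contDiffAt hm), Pi.sub_apply]
      linear_combination h'.helmholtz z hz - h.helmholtz z hz
    · rw [Pi.sub_apply, h.boundary z hz, h'.boundary z hz, sub_self]
    · filter_upwards [hC, hC'] with r h1 h2 θ
      exact hsum r θ (h1 θ) (h2 θ)
  refine ⟨fun z hz' => sub_eq_zero.1 (hz z (by simpa using hz')), funext fun θ => ?_⟩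
  -- Once the two solutions agree, the zero function has leading coefficient `π(b - b')`, which must
  -- vanish.
  have h0 : Tendsto (fun r => (0 : ℂ) / outgoingWave r) atTop (𝓝 (Real.pi * (b θ - b' θ))) := by
    refine tendsto_div_outgoingWave (C := (C + C') * lam⁻¹ ^ (-(3 / 2) : ℝ)) ?_
    have h3 := (tendsto_id.const_mul_atTop (inv_pos.2 hlam)).eventually
      ((hC.and hC').and (eventually_ge_atTop (1 : ℝ)))
    filter_upwards [h3, eventually_gt_atTop 0] with x hx hx0
    simp only [id] at hx
    have h4 := hsum _ θ (hx.1.1 θ) (hx.1.2 θ)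
    rw [hz _ (by rw [norm_mul, norm_dir, mul_one, Complex.norm_real, Real.norm_of_nonneg
      (by positivity)]; exact hx.2), mul_inv_cancel_left₀ hlam.ne',
      Real.mul_rpow (by positivity) hx0.le, ← mul_assoc] at h4
    exact h4
  simp only [zero_div] at h0
  have h5 := tendsto_nhds_unique tendsto_const_nhds h0
  have h6 : (Real.pi : ℂ) ≠ 0 := by exact_mod_cast Real.pi_ne_zero
  exact sub_eq_zero.1 ((mul_eq_zero.1 h5.symm).resolve_left h6)

/-! ### The scattering matrix -/

/-- The amplitude is defined by an arbitrary choice of outgoing solution. Uniqueness of the profile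
identifies it with the explicit one. -/
theorem amplitude_eq {lam : ℝ} (hlam : 0 < lam) (θ ω : S1) :
    amplitude lam θ ω = ampKernel lam (θ - ω) := by
  have h : ∃ v : (ℂ → ℂ) × (S1 → ℂ), IsOutgoingSolution lam ω v.1 v.2 :=
    ⟨(_, _), isOutgoingSolution_scatteredWave hlam ω⟩
  rw [amplitude, dif_pos h]
  exact congrFun (h.choose_spec.unique hlam (isOutgoingSolution_scatteredWave hlam ω)).2 θ

theorem continuous_amplitude {lam : ℝ} (hlam : 0 < lam) :
    Continuous fun p : S1 × S1 => amplitude lam p.1 p.2 := by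
  simp only [amplitude_eq hlam]
  exact (continuous_ampKernel hlam).comp (continuous_fst.sub continuous_snd)

/-- The value at `θ` is the inner product of `f` with the conjugated slice of `k`. Slices depend
continuously on `θ`, so the operator is bounded into continuous functions, which embed in `L²`. -/
theorem exists_isIntegralOperator {k : S1 → S1 → ℂ} (hk : Continuous fun p : S1 × S1 => k p.1 p.2) :
    ∃ T : L2S1 →L[ℂ] L2S1, IsIntegralOperator k T := by
  set K : C(S1, C(S1, ℂ)) := ContinuousMap.curry
    ⟨fun p : S1 × S1 => (starRingEnd ℂ) (k p.1 p.2), Complex.continuous_conj.comp hk⟩ with hK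
  set Φ : C(S1, L2S1) := ⟨fun θ => ContinuousMap.toLp 2 volume ℂ (K θ),
    (ContinuousMap.toLp 2 volume ℂ).continuous.comp K.continuous⟩ with hΦ
  let A : L2S1 →ₗ[ℂ] C(S1, ℂ) :=
    { toFun := fun f => ⟨fun θ => inner ℂ (Φ θ) f, Φ.continuous.inner continuous_const⟩
      map_add' := fun f g => by ext θ; simp [inner_add_right]
      map_smul' := fun c f => by ext θ; simp [inner_smul_right] }
  let B : L2S1 →L[ℂ] C(S1, ℂ) := A.mkContinuous ‖Φ‖ fun f =>
    (ContinuousMap.norm_le _ (by positivity)).2 fun θ =>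
      (norm_inner_le_norm _ _).trans
        (mul_le_mul_of_nonneg_right (Φ.norm_coe_le_norm θ) (norm_nonneg _))
  refine ⟨(ContinuousMap.toLp 2 volume ℂ).comp B, fun f => ?_⟩
  filter_upwards [ContinuousMap.coeFn_toLp (p := 2) (𝕜 := ℂ) (volume : Measure S1) (B f)] with θ hθ
  refine hθ.trans ?_
  change inner ℂ (Φ θ) f = _
  rw [L2.inner_def]
  refine integral_congr_ae ?_
  filter_upwards [ContinuousMap.coeFn_toLp (p := 2) (𝕜 := ℂ) (volume : Measure S1) (K θ)] with ω hω
  rw [RCLike.inner_apply]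
  change f ω * (starRingEnd ℂ) ((ContinuousMap.toLp 2 volume ℂ (K θ) : L2S1) ω) = _
  rw [hω]
  change f ω * (starRingEnd ℂ) ((starRingEnd ℂ) (k θ ω)) = _
  rw [Complex.conj_conj, mul_comm]

theorem isIntegralOperator_integralOperator {k : S1 → S1 → ℂ}
    (hk : Continuous fun p : S1 × S1 => k p.1 p.2) :
    IsIntegralOperator k (integralOperator k) := by
  have h := exists_isIntegralOperator hk
  rw [integralOperator, dif_pos h]
  exact h.choose_spec

theorem integral_fourier (n : ℤ) :
    ∫ θ : S1, (fourier n θ : ℂ) = if n = 0 then 2 * (Real.pi : ℂ) else 0 := by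
  split_ifs with h
  · subst h
    simp [measureReal_def, AddCircle.measure_univ, Real.pi_pos.le]
  · exact integral_eq_zero_of_add_right_eq_neg (fourier_add_half_inv_index h Real.two_pi_pos)

theorem fourier_apply_add (n : ℤ) (θ ω : S1) :
    (fourier n (θ + ω) : ℂ) = fourier n θ * fourier n ω := by
  rw [fourier_apply, smul_add, AddCircle.toCircle_add, Circle.coe_mul, fourier_apply,
    fourier_apply]

theorem fourier_apply_neg (n : ℤ) (θ : S1) : (fourier n (-θ) : ℂ) = fourier (-n) θ := by
  rw [fourier_apply, smul_neg, ← neg_smul, fourier_apply]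

theorem integrable_of_continuous {f : S1 → ℂ} (hf : Continuous f) : Integrable f :=
  hf.integrable_of_hasCompactSupport (HasCompactSupport.of_compactSpace f)

theorem integral_tsum_mul_fourier {c : ℤ → ℂ} (hc : Summable fun n => ‖c n‖) (m : ℤ) :
    ∫ θ : S1, (∑' n : ℤ, c n * (fourier n θ : ℂ)) * fourier (-m) θ = 2 * Real.pi * c m := by
  have hF : ∀ n : ℤ, Integrable fun θ : S1 => c n * (fourier n θ : ℂ) * fourier (-m) θ :=
    fun n => integrable_of_continuous
      ((continuous_const.mul (fourier n).continuous).mul (fourier (-m)).continuous)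
  have h := hasSum_integral_of_summable_integral_norm hF (by
    simp only [norm_mul, norm_fourier_apply, mul_one, integral_const]
    exact hc.const_smul _)
  simp only [tsum_mul_right] at h
  rw [← h.tsum_eq, tsum_eq_single m]
  · simp only [mul_assoc, ← fourier_add, add_neg_cancel, integral_const_mul, integral_fourier]
    simp
    ring
  · intro n hn
    have hn' : n + -m ≠ 0 := by omega
    simp only [mul_assoc, ← fourier_add, integral_const_mul, integral_fourier, if_neg hn', mul_zero]

theorem integral_tsum_sub_mul_fourier {c : ℤ → ℂ} (hc : Summable fun n => ‖c n‖) (m : ℤ)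
    (θ : S1) : ∫ ω : S1, (∑' n : ℤ, c n * (fourier n (θ - ω) : ℂ)) * fourier m ω =
      2 * Real.pi * c m * fourier m θ := by
  rw [← integral_sub_left_eq_self _ volume θ, ← integral_tsum_mul_fourier hc m,
    ← integral_mul_const]
  refine integral_congr_ae (Eventually.of_forall fun ω => ?_)
  simp only [sub_sub_cancel]
  rw [sub_eq_add_neg θ ω, fourier_apply_add, fourier_apply_neg]
  ring

/-- The function `e^{inθ}` as an element of `L²(S¹)`. -/
def expMode (n : ℤ) : L2S1 := ContinuousMap.toLp 2 volume ℂ (fourier n)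

theorem IsIntegralOperator.apply_expMode {c : ℤ → ℂ} (hc : Summable fun n => ‖c n‖)
    {T : L2S1 →L[ℂ] L2S1}
    (hT : IsIntegralOperator (fun θ ω => ∑' n : ℤ, c n * (fourier n (θ - ω) : ℂ)) T) (m : ℤ) :
    T (expMode m) = (2 * Real.pi * c m) • expMode m := by
  have hm := ContinuousMap.coeFn_toLp (p := 2) (𝕜 := ℂ) (volume : Measure S1) (fourier m)
  refine Lp.ext ?_
  filter_upwards [hT (expMode m), Lp.coeFn_smul (2 * Real.pi * c m) (expMode m), hm]
    with θ h1 h2 h3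
  rw [h1, h2, Pi.smul_apply, smul_eq_mul]
  rw [expMode, h3, ← integral_tsum_sub_mul_fourier hc m θ]
  refine integral_congr_ae ?_
  filter_upwards [hm] with ω hω
  simp only [hω]

theorem cosMode_eq (n : ℤ) : cosMode n = (2⁻¹ : ℂ) • (expMode n + expMode (-n)) := by
  rw [cosMode, expMode, expMode, ← map_add, ← map_smul]
  congr 1
  ext θ
  change (((fourier n θ : ℂ).re : ℝ) : ℂ) = 2⁻¹ * ((fourier n θ : ℂ) + (fourier (-n) θ : ℂ))
  rw [fourier_neg, Complex.re_eq_add_conj]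
  ring

theorem sinMode_eq (n : ℤ) :
    sinMode n = (2 * Complex.I)⁻¹ • (expMode n - expMode (-n)) := by
  rw [sinMode, expMode, expMode, ← map_sub, ← map_smul]
  congr 1
  ext θ
  change (((fourier n θ : ℂ).im : ℝ) : ℂ) =
    (2 * Complex.I)⁻¹ * ((fourier n θ : ℂ) - (fourier (-n) θ : ℂ))
  rw [fourier_neg, Complex.im_eq_sub_conj]
  ring

theorem cosMode_ne_zero (n : ℤ) : cosMode n ≠ 0 := by
  intro h
  have h1 : cosFun n = 0 := ContinuousMap.toLp_injective (p := 2) (𝕜 := ℂ) (volume : Measure S1)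
    (by rw [map_zero]; exact h)
  have h2 := cosFun_coe n 0
  rw [h1] at h2
  simp at h2

theorem sinMode_ne_zero {n : ℤ} (hn : n ≠ 0) : sinMode n ≠ 0 := by
  intro h
  have h1 : sinFun n = 0 := ContinuousMap.toLp_injective (p := 2) (𝕜 := ℂ) (volume : Measure S1)
    (by rw [map_zero]; exact h)
  have h2 := sinFun_coe n (Real.pi / 2 / n)
  have hn' : (n : ℝ) ≠ 0 := by exact_mod_cast hn
  rw [h1, mul_div_cancel₀ _ hn'] at h2
  simp at h2

theorem isIntegralOperator_amplitude {lam : ℝ} (hlam : 0 < lam) :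
    IsIntegralOperator (amplitude lam) (scatteringMatrix lam - ContinuousLinearMap.id ℂ L2S1) := by
  rw [scatteringMatrix, add_sub_cancel_left]
  exact isIntegralOperator_integralOperator (continuous_amplitude hlam)

/-- This is `1 - 2J/H^{(1)}` with `2J = H^{(1)} + H^{(2)}`. -/
theorem one_add_ampCoeff {lam : ℝ} (hlam : 0 < lam) (n : ℤ) :
    1 + 2 * Real.pi * ampCoeff lam n = -(hankel2 n.natAbs lam / hankel1 n.natAbs lam) := by
  have h1 := hankel1_ne_zero n.natAbs hlam
  have h2 : (Real.pi : ℂ) ≠ 0 := by exact_mod_cast Real.pi_ne_zero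
  have h3 := hankel1_add_hankel2 n.natAbs lam
  rw [ampCoeff]
  field_simp
  linear_combination h3

theorem scatteringMatrix_expMode {lam : ℝ} (hlam : 0 < lam) (n : ℤ) :
    scatteringMatrix lam (expMode n) =
      (-(hankel2 n.natAbs lam / hankel1 n.natAbs lam)) • expMode n := by
  have h := isIntegralOperator_amplitude hlam
  have e : amplitude lam = fun θ ω => ∑' n : ℤ, ampCoeff lam n * (fourier n (θ - ω) : ℂ) :=
    funext fun θ => funext fun ω => amplitude_eq hlam θ ω
  rw [e] at h
  have h1 := h.apply_expMode (factorialDecay_ampCoeff hlam).summable_norm n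
  rw [sub_apply, ContinuousLinearMap.id_apply, sub_eq_iff_eq_add] at h1
  rw [h1, ← one_add_ampCoeff hlam, add_smul, one_smul, add_comm]

theorem scatteringMatrix_cosMode {lam : ℝ} (hlam : 0 < lam) (n : ℤ) :
    scatteringMatrix lam (cosMode n) =
      (-(hankel2 n.natAbs lam / hankel1 n.natAbs lam)) • cosMode n := by
  rw [cosMode_eq, map_smul, map_add, scatteringMatrix_expMode hlam, scatteringMatrix_expMode hlam,
    Int.natAbs_neg, ← smul_add, smul_comm]

theorem scatteringMatrix_sinMode {lam : ℝ} (hlam : 0 < lam) (n : ℤ) :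
    scatteringMatrix lam (sinMode n) =
      (-(hankel2 n.natAbs lam / hankel1 n.natAbs lam)) • sinMode n := by
  rw [sinMode_eq, map_smul, map_sub, scatteringMatrix_expMode hlam, scatteringMatrix_expMode hlam,
    Int.natAbs_neg, ← smul_sub, smul_comm]

theorem fourier_pi (n : ℤ) : (fourier n ((Real.pi : ℝ) : S1) : ℂ) = (-1) ^ n := by
  rw [fourier_eq_dir_zpow, dir_coe_eq_expI, expI, Complex.exp_pi_mul_I]

theorem reflection_expMode (n : ℤ) : reflection (expMode n) = ((-1 : ℂ) ^ n) • expMode n := by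
  have hm := ContinuousMap.coeFn_toLp (p := 2) (𝕜 := ℂ) (volume : Measure S1) (fourier n)
  have hp := measurePreserving_add_right (volume : Measure S1) ((Real.pi : ℝ) : S1)
  refine Lp.ext ?_
  have h1 := Lp.coeFn_compMeasurePreserving (expMode n) hp
  filter_upwards [h1, Lp.coeFn_smul ((-1 : ℂ) ^ n) (expMode n), hm,
    hp.quasiMeasurePreserving.ae hm] with θ h1 h2 h3 h4
  rw [h2]
  refine h1.trans ?_
  simp only [Function.comp_apply, Pi.smul_apply, smul_eq_mul]
  rw [expMode, h3, h4, fourier_apply_add, fourier_pi, mul_comm]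

theorem reflection_cosMode (n : ℤ) : reflection (cosMode n) = ((-1 : ℂ) ^ n) • cosMode n := by
  rw [cosMode_eq, map_smul, map_add, reflection_expMode, reflection_expMode, zpow_neg, ← inv_zpow,
    inv_neg_one, ← smul_add, smul_comm]

theorem reflection_sinMode (n : ℤ) : reflection (sinMode n) = ((-1 : ℂ) ^ n) • sinMode n := by
  rw [sinMode_eq, map_smul, map_sub, reflection_expMode, reflection_expMode, zpow_neg, ← inv_zpow,
    inv_neg_one, ← smul_sub, smul_comm]

theorem hasEigenvector_of_apply {T : L2S1 →L[ℂ] L2S1} {μ : ℂ} {f : L2S1} (h : T f = μ • f)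
    (hf : f ≠ 0) : Module.End.HasEigenvector (T : L2S1 →ₗ[ℂ] L2S1) μ f :=
  Module.End.hasEigenvector_iff.2 ⟨Module.End.mem_eigenspace_iff.2 h, hf⟩

theorem hasEigenvector_comp_reflection {T : L2S1 →L[ℂ] L2S1} {μ : ℂ} {f : L2S1} {n : ℤ}
    (h : T f = (-μ) • f) (hr : reflection f = ((-1 : ℂ) ^ n) • f) (hf : f ≠ 0) :
    Module.End.HasEigenvector ((T ∘L reflection : L2S1 →L[ℂ] L2S1) : L2S1 →ₗ[ℂ] L2S1)
      ((-1 : ℂ) ^ (n + 1) * μ) f := by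
  refine hasEigenvector_of_apply ?_ hf
  rw [ContinuousLinearMap.comp_apply, hr, map_smul, h, smul_smul,
    zpow_add_one₀ (by norm_num : (-1 : ℂ) ≠ 0)]
  congr 1
  ring

/-! ### Fredholm determinants of convolution operators -/

theorem hasSum_prod_pi {ι : Type*} {m : ℕ} {f : Fin m → ι → ℂ}
    (hf : ∀ i, Summable fun n => ‖f i n‖) :
    (Summable fun ν : Fin m → ι => ‖∏ i, f i (ν i)‖) ∧
      HasSum (fun ν : Fin m → ι => ∏ i, f i (ν i)) (∏ i, ∑' n, f i n) := by
  induction m with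
  | zero =>
    refine ⟨(hasSum_fintype _).summable, ?_⟩
    simp
  | succ m ih =>
    obtain ⟨h1, h2⟩ := ih (f := fun i : Fin m => f i.succ) fun i => hf i.succ
    have h0 := (hf 0).of_norm.hasSum
    set g : (Fin m → ι) → ℂ := fun ν => ∏ i : Fin m, f i.succ (ν i) with hg
    have e : ∀ q : ι × (Fin m → ι),
        ∏ i, f i (Fin.consEquiv (fun _ => ι) q i) = f 0 q.1 * g q.2 := fun q => by
      rw [Fin.prod_univ_succ]
      simp [Fin.consEquiv, hg]
    constructor
    · rw [← (Fin.consEquiv fun _ : Fin (m + 1) => ι).summable_iff]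
      simp only [Function.comp_def, e]
      exact Summable.mul_norm (f := f 0) (g := g) (hf 0) h1
    · rw [← (Fin.consEquiv fun _ : Fin (m + 1) => ι).hasSum_iff, Fin.prod_univ_succ]
      simp only [Function.comp_def, e]
      exact h0.mul h2 (summable_mul_of_summable_norm (f := f 0) (g := g) (hf 0) h1)

theorem integrable_pi_of_continuous {m : ℕ} {f : (Fin m → S1) → ℂ} (hf : Continuous f) :
    Integrable f :=
  hf.integrable_of_hasCompactSupport (HasCompactSupport.of_compactSpace f)

/-- Collecting the factors in each variable `t_i` gives frequency `ν(σ⁻¹ i) - ν(i)`. Orthogonality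
leaves only index families invariant under `σ`. -/
theorem integral_prod_fourier_perm {m : ℕ} (σ : Equiv.Perm (Fin m)) (ν : Fin m → ℤ) :
    ∫ t : Fin m → S1, ∏ i, (fourier (ν i) (t (σ i) - t i) : ℂ) =
      ∏ i, 2 * (Real.pi : ℂ) * (if ν (σ i) = ν i then 1 else 0) := by
  have h1 : ∀ t : Fin m → S1, ∏ i, (fourier (ν i) (t (σ i) - t i) : ℂ) =
      ∏ i, (fourier (ν (σ.symm i) + -ν i) (t i) : ℂ) := fun t => by
    simp only [sub_eq_add_neg, fourier_apply_add, fourier_apply_neg, fourier_add,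
      Finset.prod_mul_distrib]
    congr 1
    rw [← Equiv.prod_comp σ fun i => (fourier (ν (σ.symm i)) (t i) : ℂ)]
    simp
  simp only [h1]
  rw [integral_fintype_prod_volume_eq_prod
      (fun i (s : S1) => (fourier (ν (σ.symm i) + -ν i) s : ℂ)),
    ← Equiv.prod_comp σ]
  refine Finset.prod_congr rfl fun i _ => ?_
  have h2 : ν (σ.symm (σ i)) + -ν (σ i) = 0 ↔ ν (σ i) = ν i := by
    rw [Equiv.symm_apply_apply]
    omega
  simp only [integral_fourier, h2, mul_ite, mul_one, mul_zero]

/-- After integration, the signed sum over permutations is the determinant of the matrix with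
entries `[ν i = ν j]`. It is the identity for injective `ν` and has two equal rows otherwise. -/
theorem hasSum_integral_det {c : ℤ → ℂ} (hc : Summable fun n => ‖c n‖) (m : ℕ) :
    HasSum (fun ν : Fin m → ℤ => if Function.Injective ν then ∏ i, 2 * (Real.pi : ℂ) * c (ν i)
      else 0) (∫ t : Fin m → S1, Matrix.det (Matrix.of fun i j : Fin m =>
        ∑' n : ℤ, c n * (fourier n (t i - t j) : ℂ))) := by
  have hcont : Continuous fun θ : S1 => ∑' n : ℤ, c n * (fourier n θ : ℂ) :=
    continuous_tsum (fun n => (fourier n).continuous.const_mul _) hc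
      (fun n θ => by rw [norm_mul, norm_fourier_apply, mul_one])
  have hsn : ∀ θ : S1, Summable fun n => ‖c n * (fourier n θ : ℂ)‖ := fun θ => by
    simpa only [norm_mul, norm_fourier_apply, mul_one] using hc
  have key : ∀ σ : Equiv.Perm (Fin m), HasSum (fun ν : Fin m → ℤ =>
      (∏ i, 2 * (Real.pi : ℂ) * c (ν i)) * ∏ i, if ν (σ i) = ν i then 1 else 0)
      (∫ t : Fin m → S1, ∏ i, ∑' n : ℤ, c n * (fourier n (t (σ i) - t i) : ℂ)) := fun σ => by
    have h := hasSum_integral_of_summable_integral_norm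
      (F := fun (ν : Fin m → ℤ) (t : Fin m → S1) =>
        ∏ i, c (ν i) * (fourier (ν i) (t (σ i) - t i) : ℂ)) (μ := volume)
      (fun ν => integrable_pi_of_continuous (continuous_finsetProd _ fun i _ =>
        continuous_const.mul ((fourier (ν i)).continuous.comp
          ((continuous_apply _).sub (continuous_apply _))))) (by
        have h1 := (hasSum_prod_pi (f := fun (_ : Fin m) n => c n) fun _ => hc).1
        simp only [norm_prod, norm_mul, norm_fourier_apply, mul_one, integral_const] at h1 ⊢
        exact h1.const_smul _)
    have h2 : ∀ t : Fin m → S1, (∑' ν : Fin m → ℤ, ∏ i, c (ν i) *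
        (fourier (ν i) (t (σ i) - t i) : ℂ)) =
        ∏ i, ∑' n : ℤ, c n * (fourier n (t (σ i) - t i) : ℂ) := fun t =>
      (hasSum_prod_pi fun i => hsn (t (σ i) - t i)).2.tsum_eq
    simp only [h2] at h
    refine h.congr_fun fun ν => ?_
    simp only [Finset.prod_mul_distrib, integral_const_mul, integral_prod_fourier_perm]
    ring
  have h3 : (∫ t : Fin m → S1, Matrix.det (Matrix.of fun i j : Fin m =>
        ∑' n : ℤ, c n * (fourier n (t i - t j) : ℂ))) = ∑ σ : Equiv.Perm (Fin m),
      Equiv.Perm.sign σ •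
        ∫ t : Fin m → S1, ∏ i, ∑' n : ℤ, c n * (fourier n (t (σ i) - t i) : ℂ) := by
    simp only [Matrix.det_apply, Matrix.of_apply]
    rw [integral_finsetSum]
    · refine Finset.sum_congr rfl fun σ _ => ?_
      simp only [Units.smul_def, zsmul_eq_mul, integral_const_mul]
    · intro σ _
      have hσ : Continuous fun t : Fin m → S1 =>
          ∏ i, ∑' n : ℤ, c n * (fourier n (t (σ i) - t i) : ℂ) :=
        continuous_finsetProd _ fun i _ =>
          hcont.comp ((continuous_apply (σ i)).sub (continuous_apply i))
      simp only [Units.smul_def, zsmul_eq_mul]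
      exact (integrable_pi_of_continuous hσ).const_mul _
  rw [h3]
  refine (hasSum_sum fun σ _ => (key σ).const_smul (Equiv.Perm.sign σ)).congr_fun fun ν => ?_
  have h4 : Matrix.det (Matrix.of fun i j : Fin m => if ν i = ν j then (1 : ℂ) else 0) =
      if Function.Injective ν then 1 else 0 := by
    split_ifs with h
    · rw [← Matrix.det_one (n := Fin m)]
      congr 1
      ext i j
      simp [Matrix.one_apply, h.eq_iff]
    · simp only [Function.Injective, not_forall] at h
      obtain ⟨i, j, hij, hne⟩ := h
      refine Matrix.det_zero_of_row_eq hne ?_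
      ext k
      simp [hij]
  rw [Matrix.det_apply] at h4
  simp only [Matrix.of_apply] at h4
  simp only [← mul_smul_comm, ← Finset.mul_sum, h4, mul_ite, mul_one, mul_zero]

theorem card_embedding_fiber {ι : Type*} {m : ℕ} (S : Finset ι) (hS : S.card = m) :
    Nat.card {ν : Fin m ↪ ι // Finset.univ.map ν = S} = m.factorial := by
  classical
  have hmem : ∀ ν : Fin m ↪ ι, Finset.univ.map ν = S ↔ ∀ i, ν i ∈ S := fun ν => by
    constructor
    · rintro rfl i
      simp
    · intro h
      refine Finset.eq_of_subset_of_card_le (fun x hx => ?_) (by simp [hS])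
      obtain ⟨i, _, rfl⟩ := Finset.mem_map.1 hx
      exact h i
  let e : {ν : Fin m ↪ ι // Finset.univ.map ν = S} ≃ (Fin m ↪ S) :=
    { toFun := fun ν => ⟨fun i => ⟨ν.1 i, (hmem ν.1).1 ν.2 i⟩, fun i j h =>
        ν.1.injective (congrArg Subtype.val h)⟩
      invFun := fun μ => ⟨μ.trans (Function.Embedding.subtype _), (hmem _).2 fun i => (μ i).2⟩
      left_inv := fun ν => rfl
      right_inv := fun μ => rfl }
  rw [Nat.card_congr e, Nat.card_eq_fintype_card, Fintype.card_embedding_eq, Fintype.card_coe, hS,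
    Fintype.card_fin, Nat.descFactorial_self]

/-- Every `m`-element set is the image of exactly `m!` embeddings of `Fin m`. This factor cancels
the `1/m!` in Fredholm's formula. -/
theorem tsum_injective_eq {ι : Type*} {a : ι → ℂ} (ha : Summable fun n => ‖a n‖) (m : ℕ)
    [DecidablePred fun ν : Fin m → ι => Function.Injective ν] :
    (∑' ν : Fin m → ι, if Function.Injective ν then ∏ i, a (ν i) else 0) =
      m.factorial * ∑' S : {S : Finset ι // S.card = m}, ∏ n ∈ S.1, a n := by
  classical
  have hs := (hasSum_prod_pi (f := fun (_ : Fin m) n => a n) fun _ => ha).1.of_norm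
  have hs1 : Summable fun ν : Fin m ↪ ι => ∏ i, a (ν i) :=
    hs.comp_injective (i := fun ν : Fin m ↪ ι => (ν : Fin m → ι)) DFunLike.coe_injective
  have h1 : (∑' ν : Fin m → ι, if Function.Injective ν then ∏ i, a (ν i) else 0) =
      ∑' ν : Fin m ↪ ι, ∏ i, a (ν i) := by
    rw [← (Equiv.subtypeInjectiveEquivEmbedding (Fin m) ι).tsum_eq]
    have := tsum_subtype {ν : Fin m → ι | Function.Injective ν} fun ν => ∏ i, a (ν i)
    simp only [Set.indicator_apply, Set.mem_ofPred_eq] at this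
    rw [← this]
    rfl
  let p : (Fin m ↪ ι) → {S : Finset ι // S.card = m} := fun ν => ⟨Finset.univ.map ν, by simp⟩
  have h4 := ((Equiv.sigmaFiberEquiv p).summable_iff.2 hs1).tsum_sigma
  simp only [Function.comp_apply] at h4
  rw [h1, ← (Equiv.sigmaFiberEquiv p).tsum_eq, h4, ← tsum_mul_left]
  refine tsum_congr fun S => ?_
  have h2 : ∀ ν : {ν // p ν = S}, ∏ i, a (Equiv.sigmaFiberEquiv p ⟨S, ν⟩ i) =
      ∏ n ∈ S.1, a n := fun ν => by
    obtain ⟨ν, rfl⟩ := ν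
    simp [p, Equiv.sigmaFiberEquiv]
  have h3 : Nat.card {ν // p ν = S} = m.factorial := by
    rw [← card_embedding_fiber S.1 S.2]
    exact Nat.card_congr (Equiv.subtypeEquivRight fun ν => Subtype.ext_iff)
  have : Finite {ν // p ν = S} := Nat.finite_of_card_ne_zero (by rw [h3]; positivity)
  have := Fintype.ofFinite {ν // p ν = S}
  simp only [h2]
  rw [tsum_const, h3, nsmul_eq_mul]

/-- The `m`-th Fredholm term is the `m`-th elementary symmetric sum of the numbers `2π c_n`. Summing
over `m` is the expansion of the infinite product over finite subsets. -/
theorem fredholmDet_convolution {c : ℤ → ℂ} (hc : Summable fun n => ‖c n‖) :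
    fredholmDet (fun θ ω => ∑' n : ℤ, c n * (fourier n (θ - ω) : ℂ)) =
      ∏' n : ℤ, (1 + 2 * Real.pi * c n) := by
  have ha : Summable fun n => ‖2 * (Real.pi : ℂ) * c n‖ := by
    simpa only [norm_mul] using hc.mul_left _
  have hs := summable_finsetProd_of_summable_norm ha
  have h1 := ((Equiv.sigmaFiberEquiv (Finset.card (α := ℤ))).summable_iff.2 hs).tsum_sigma
  simp only [Function.comp_apply] at h1
  rw [tprod_one_add hs, ← (Equiv.sigmaFiberEquiv (Finset.card (α := ℤ))).tsum_eq, h1, fredholmDet]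
  refine tsum_congr fun m => ?_
  rw [← (hasSum_integral_det hc m).tsum_eq, tsum_injective_eq ha, ← mul_assoc, one_div,
    inv_mul_cancel₀ (by exact_mod_cast m.factorial_ne_zero), one_mul]
  rfl

theorem scatteringDet_eq {lam : ℝ} (hlam : 0 < lam) :
    HasProd (fun n : ℤ => -(hankel2 n.natAbs lam / hankel1 n.natAbs lam)) (scatteringDet lam) := by
  have hc := (factorialDecay_ampCoeff hlam).summable_norm
  have e : amplitude lam = fun θ ω => ∑' n : ℤ, ampCoeff lam n * (fourier n (θ - ω) : ℂ) :=
    funext fun θ => funext fun ω => amplitude_eq hlam θ ω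
  rw [scatteringDet, e, fredholmDet_convolution hc]
  simp only [← one_add_ampCoeff hlam]
  refine (multipliable_one_add_of_summable ?_).hasProd
  simpa only [norm_mul] using hc.mul_left ‖2 * (Real.pi : ℂ)‖

/-! ### The scattering phase -/

/-- The eigenvalue `-H_n^{(2)} / H_n^{(1)}` of the scattering matrix. -/
def scatteringEigenvalue (n : ℕ) (x : ℝ) : ℂ := -(hankel2 n x / hankel1 n x)

/-- The rate `2 / (π² x |H_n^{(1)}(x)|²)` of decrease of the phase of the `n`-th eigenvalue. -/
def phaseDensity (n : ℕ) (x : ℝ) : ℝ := 2 / (Real.pi ^ 2 * x * ‖hankel1 n x‖ ^ 2)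

/-- Over the common denominator `H^{(1)} H^{(2)} = |H^{(1)}|²` the numerator is the Hankel
Wronskian. The result is purely imaginary, so the phase has a real derivative. -/
theorem logDeriv_hankel2_sub_hankel1 (n : ℕ) {x : ℝ} (hx : 0 < x) :
    (n / x * hankel2 n x - hankel2 (n + 1) x) / hankel2 n x -
      (n / x * hankel1 n x - hankel1 (n + 1) x) / hankel1 n x =
    2 * Real.pi * Complex.I * ((-phaseDensity n x : ℝ) : ℂ) := by
  have h1 := hankel1_ne_zero n hx
  have h2 := hankel2_ne_zero n hx
  have hpi : (Real.pi : ℂ) ≠ 0 := by exact_mod_cast Real.pi_ne_zero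
  have hx' : (x : ℂ) ≠ 0 := by exact_mod_cast hx.ne'
  have hw := hankel_wronskian n hx
  have hp : ((phaseDensity n x : ℝ) : ℂ) =
      2 / (Real.pi ^ 2 * x * (hankel1 n x * hankel2 n x)) := by
    rw [hankel1_mul_hankel2, phaseDensity]
    push_cast
    rfl
  rw [Complex.ofReal_neg, hp]
  field_simp at hw ⊢
  linear_combination hw

theorem scatteringEigenvalue_ne_zero (n : ℕ) {x : ℝ} (hx : 0 < x) :
    scatteringEigenvalue n x ≠ 0 :=
  neg_ne_zero.2 (div_ne_zero (hankel2_ne_zero n hx) (hankel1_ne_zero n hx))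

theorem norm_scatteringEigenvalue (n : ℕ) {x : ℝ} (hx : 0 < x) :
    ‖scatteringEigenvalue n x‖ = 1 := by
  rw [scatteringEigenvalue, norm_neg, norm_div, norm_hankel2,
    div_self (norm_ne_zero_iff.2 (hankel1_ne_zero n hx))]

theorem hasDerivAt_scatteringEigenvalue (n : ℕ) {x : ℝ} (hx : 0 < x) :
    HasDerivAt (scatteringEigenvalue n) (2 * Real.pi * Complex.I *
      ((-phaseDensity n x : ℝ) : ℂ) * scatteringEigenvalue n x) x := by
  have h1 := hankel1_ne_zero n hx
  have h2 := hankel2_ne_zero n hx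
  refine (((hasDerivAt_hankel2 n hx).div (hasDerivAt_hankel1 n hx) h1).neg).congr_deriv ?_
  rw [← logDeriv_hankel2_sub_hankel1 n hx, scatteringEigenvalue]
  field_simp

theorem tendsto_scatteringEigenvalue_zero (n : ℕ) :
    Tendsto (scatteringEigenvalue n) (𝓝[>] 0) (𝓝 1) := by
  have h := ((tendsto_besselJ_div_hankel1_zero n).const_mul 2).const_sub 1
  rw [mul_zero, sub_zero] at h
  refine h.congr' ?_
  filter_upwards [self_mem_nhdsWithin] with x hx
  have h1 := hankel1_ne_zero n hx
  rw [scatteringEigenvalue]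
  field_simp
  linear_combination hankel1_add_hankel2 n x

theorem continuousOn_phaseDensity (n : ℕ) : ContinuousOn (phaseDensity n) (Set.Ioi 0) := by
  intro x hx
  have hx : 0 < x := hx
  have h1 := hankel1_ne_zero n hx
  have hpi := Real.pi_pos
  refine (ContinuousAt.div continuousAt_const ((continuousAt_const.mul continuousAt_id).mul
    ((hasDerivAt_hankel1 n hx).continuousAt.norm.pow 2)) ?_).continuousWithinAt
  exact (mul_pos (mul_pos (by positivity) hx) (pow_pos (norm_pos_iff.2 h1) 2)).ne'

/-- A continuous branch, vanishing at `0`, of the phase of the `n`-th eigenvalue. -/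
theorem exists_modePhase (n : ℕ) : ∃ s : ℝ → ℝ, s 0 = 0 ∧ ContinuousOn s (Set.Ici 0) ∧
    ∀ x, 0 < x → HasDerivAt s (-phaseDensity n x) x ∧
      Complex.exp (2 * Real.pi * Complex.I * s x) = scatteringEigenvalue n x := by
  have hpi := Real.pi_pos
  have hlim := tendsto_scatteringEigenvalue_zero n
  -- Near `0` the eigenvalue is close to `1`, so the principal logarithm is a valid branch there
  -- with limit `0`.
  obtain ⟨δ, hδ, hδs⟩ : ∃ δ : ℝ, 0 < δ ∧ ∀ x, 0 < x → x < δ →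
      scatteringEigenvalue n x ∈ Complex.slitPlane := by
    have h := hlim.eventually (Complex.isOpen_slitPlane.mem_nhds Complex.one_mem_slitPlane)
    obtain ⟨δ, hδ, h⟩ := mem_nhdsGT_iff_exists_Ioo_subset.1 h
    exact ⟨δ, hδ, fun x h1 h2 => h ⟨h1, h2⟩⟩
  set a : ℝ := δ / 2
  have ha : 0 < a := by positivity
  have haδ : a < δ := by simp only [a]; linarith
  set h : ℝ → ℝ := fun x => (Complex.log (scatteringEigenvalue n x)).im / (2 * Real.pi)
  have dh : ∀ x, 0 < x → x < δ → HasDerivAt h (-phaseDensity n x) x := fun x hx hxδ => by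
    have h1 := (hasDerivAt_scatteringEigenvalue n hx).clog_real (hδs x hx hxδ)
    rw [mul_div_cancel_right₀ _ (scatteringEigenvalue_ne_zero n hx)] at h1
    have h2 := (Complex.imCLM.hasFDerivAt.comp_hasDerivAt x h1).div_const (2 * Real.pi)
    refine h2.congr_deriv ?_
    rw [div_eq_iff (by positivity)]
    simp
    ring
  -- Integrating the density from the interior point `a` continues the branch to all `x > 0` without
  -- requiring integrability at `0`.
  set F : ℝ → ℝ := fun x => h a - ∫ t in a..x, phaseDensity n t
  have dF : ∀ x, 0 < x → HasDerivAt F (-phaseDensity n x) x := fun x hx => by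
    have hsub : Set.uIcc a x ⊆ Set.Ioi 0 := fun t ht => (lt_min ha hx).trans_le ht.1
    have hx' := (continuousOn_phaseDensity n).continuousAt (Ioi_mem_nhds hx)
    have h1 := intervalIntegral.integral_hasDerivAt_right
      (((continuousOn_phaseDensity n).mono hsub).intervalIntegrable)
      ((continuousOn_phaseDensity n).stronglyMeasurableAtFilter isOpen_Ioi x hx) hx'
    exact h1.const_sub (h a)
  have hFh : Set.EqOn F h (Set.Ioo 0 δ) := by
    refine isOpen_Ioo.eqOn_of_deriv_eq isPreconnected_Ioo
      (fun x hx => (dF x hx.1).differentiableAt.differentiableWithinAt)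
      (fun x hx => (dh x hx.1 hx.2).differentiableAt.differentiableWithinAt)
      (fun x hx => by rw [(dF x hx.1).deriv, (dh x hx.1 hx.2).deriv])
      (x := a) ⟨ha, haδ⟩ ?_
    simp [F]
  set s : ℝ → ℝ := fun x => if x ≤ 0 then 0 else F x
  have hs : ∀ x, 0 < x → s =ᶠ[𝓝 x] F := fun x hx => by
    filter_upwards [Ioi_mem_nhds hx] with y hy
    simp only [s, if_neg (not_le.2 (Set.mem_Ioi.1 hy))]
  have ds : ∀ x, 0 < x → HasDerivAt s (-phaseDensity n x) x := fun x hx =>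
    (dF x hx).congr_of_eventuallyEq (hs x hx)
  have hs0 : s 0 = 0 := by simp [s]
  refine ⟨s, hs0, ?_, fun x hx => ⟨ds x hx, ?_⟩⟩
  · intro x hx
    rcases (Set.mem_Ici.1 hx).eq_or_lt with rfl | hx
    · rw [← continuousWithinAt_Ioi_iff_Ici, ContinuousWithinAt, hs0]
      have h1 : Tendsto h (𝓝[>] 0) (𝓝 0) := by
        have h2 := ((continuousAt_clog Complex.one_mem_slitPlane).tendsto.comp hlim)
        have h3 := ((Complex.continuous_im.tendsto _).comp h2).div_const (2 * Real.pi)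
        simpa using h3
      refine h1.congr' ?_
      filter_upwards [Ioo_mem_nhdsGT hδ] with x hx
      rw [(hs x hx.1).eq_of_nhds, hFh hx]
    · exact (ds x hx).continuousAt.continuousWithinAt
  -- Both sides have the same logarithmic derivative, so their quotient is constant. It equals `1`
  -- at `a`, where the principal logarithm applies.
  · have dQ : ∀ x ∈ Set.Ioi (0 : ℝ), HasDerivAt (fun x => Complex.exp
        (2 * Real.pi * Complex.I * s x) / scatteringEigenvalue n x) 0 x := fun x hx => by
      have h1 := ((ds x hx).ofReal_comp.const_mul (2 * Real.pi * Complex.I : ℂ)).cexp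
      have h0 := scatteringEigenvalue_ne_zero n hx
      refine (h1.div (hasDerivAt_scatteringEigenvalue n hx) h0).congr_deriv ?_
      field_simp
      ring
    have h1 := eq_of_hasDerivAt_zero_Ioi dQ (Set.mem_Ioi.2 hx) (Set.mem_Ioi.2 ha)
    have h2 : Complex.exp (2 * Real.pi * Complex.I * s a) = scatteringEigenvalue n a := by
      rw [(hs a ha).eq_of_nhds, hFh ⟨ha, haδ⟩]
      have h3 : (2 * Real.pi * Complex.I * ((h a : ℝ) : ℂ)) =
          Complex.log (scatteringEigenvalue n a) := by
        have h4 : 2 * Real.pi * h a = (Complex.log (scatteringEigenvalue n a)).im :=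
          mul_div_cancel₀ _ (by positivity)
        rw [show 2 * Real.pi * Complex.I * ((h a : ℝ) : ℂ) =
          ((2 * Real.pi * h a : ℝ) : ℂ) * Complex.I by push_cast; ring, h4]
        apply Complex.ext <;> simp [Complex.log_re, norm_scatteringEigenvalue n ha]
      rw [h3, Complex.exp_log (scatteringEigenvalue_ne_zero n ha)]
    rw [h2, div_self (scatteringEigenvalue_ne_zero n ha)] at h1
    exact (div_eq_one_iff_eq (scatteringEigenvalue_ne_zero n hx)).1 h1

/-! ### Locally uniform convergence of the sum of mode phases -/

theorem phaseDensity_pos (n : ℕ) {x : ℝ} (hx : 0 < x) : 0 < phaseDensity n x := by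
  have := norm_pos_iff.2 (hankel1_ne_zero n hx)
  have := Real.pi_pos
  unfold phaseDensity
  positivity

theorem phaseDensity_succ_le {X : ℝ} (hX : 0 < X) : ∀ᶠ n : ℕ in atTop, ∀ x : ℝ, 0 < x → x ≤ X →
    phaseDensity (n + 1) x ≤ 2 * X * (((X / 2) ^ 2) ^ n / n.factorial) := by
  filter_upwards [norm_hankel1_succ_ge X] with n hn x hx hxX
  have h1 := hn x hx hxX
  have hpi := Real.pi_pos
  have hf : (1 : ℝ) ≤ n.factorial := by exact_mod_cast n.factorial_pos
  calc phaseDensity (n + 1) x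
      ≤ 2 / (Real.pi ^ 2 * x * ((n.factorial : ℝ) / (2 * Real.pi) * (2 / x) ^ (n + 1)) ^ 2) := by
        unfold phaseDensity
        gcongr
    _ = 2 * x * (((x / 2) ^ 2) ^ n / (n.factorial * n.factorial)) := by
        rw [show (2 : ℝ) / x = (x / 2)⁻¹ by rw [inv_div], inv_pow]
        obtain ⟨y, rfl⟩ : ∃ y, x = 2 * y := ⟨x / 2, by ring⟩
        have hy : 0 < y := by linarith
        rw [mul_div_cancel_left₀ _ (two_ne_zero)]
        field_simp
        ring
    _ ≤ 2 * X * (((X / 2) ^ 2) ^ n / n.factorial) := by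
        gcongr
        exact le_mul_of_one_le_left (by positivity) hf

/-- The tail estimate holds only for large `n`. The finitely many remaining terms are bounded by
compactness, which does not affect summability. -/
theorem exists_summable_bound {s : Set ℝ} (hs : IsCompact s) {f : ℕ → ℝ → ℝ} {v : ℕ → ℝ}
    (hf : ∀ n, ContinuousOn (f n) s) (hv : Summable v)
    (h : ∀ᶠ n : ℕ in atTop, ∀ t ∈ s, ‖f (n + 1) t‖ ≤ v n) :
    ∃ u : ℕ → ℝ, Summable u ∧ ∀ n, ∀ t ∈ s, ‖f n t‖ ≤ u n := by
  classical
  choose M hM using fun n => hs.exists_bound_of_continuousOn (hf n)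
  -- The test inside the `if` makes the truncated value `n - 1 = 0` at `n = 0` harmless: `v (n - 1)`
  -- is used only where it is a genuine bound.
  refine ⟨fun n => if ∀ t ∈ s, ‖f n t‖ ≤ v (n - 1) then v (n - 1) else M n, ?_, fun n t ht => ?_⟩
  · rw [← summable_nat_add_iff 1]
    refine hv.abs.of_norm_bounded_eventually_nat ?_
    filter_upwards [h] with n hn
    rw [Nat.add_sub_cancel, if_pos hn, Real.norm_eq_abs]
  · simp only
    split_ifs with hn
    · exact hn t ht
    · exact hM n t ht

theorem Summable.comp_natAbs {E : Type*} [NormedAddCommGroup E] {u : ℕ → E} (hu : Summable u) :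
    Summable fun n : ℤ => u n.natAbs :=
  Summable.of_nat_of_neg (by simpa using hu) (by simpa using hu)

theorem summable_majorant (X : ℝ) : Summable fun n : ℕ =>
    2 * X * (((X / 2) ^ 2) ^ n / (n.factorial : ℝ)) :=
  (Real.summable_pow_div_factorial _).mul_left _

theorem exists_summable_phaseDensity_bound {a X : ℝ} (ha : 0 < a) (haX : a ≤ X) :
    ∃ u : ℕ → ℝ, Summable u ∧ ∀ n, ∀ t ∈ Set.Icc a X, ‖phaseDensity n t‖ ≤ u n := by
  refine exists_summable_bound isCompact_Icc
    (fun n => (continuousOn_phaseDensity n).mono fun t ht => ha.trans_le ht.1)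
    (summable_majorant X) ?_
  filter_upwards [phaseDensity_succ_le (ha.trans_le haX)] with n hn t ht
  have ht0 := ha.trans_le ht.1
  rw [Real.norm_of_nonneg (phaseDensity_pos _ ht0).le]
  exact hn t ht0 ht.2

/-- For large orders the mean value theorem from `s n 0 = 0` turns the density bound into a bound on
the phase. Low orders use only continuity on the closed interval, so no density bound at `0` is
needed for them. -/
theorem exists_summable_modePhase_bound {s : ℕ → ℝ → ℝ} (h0 : ∀ n, s n 0 = 0)
    (hc : ∀ n, ContinuousOn (s n) (Set.Ici 0))
    (hd : ∀ n x, 0 < x → HasDerivAt (s n) (-phaseDensity n x) x) {X : ℝ} (hX : 0 < X) :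
    ∃ u : ℕ → ℝ, Summable u ∧ ∀ n, ∀ t ∈ Set.Icc 0 X, ‖s n t‖ ≤ u n := by
  refine exists_summable_bound isCompact_Icc (fun n => (hc n).mono fun t ht => ht.1)
    ((summable_majorant X).mul_left X) ?_
  filter_upwards [phaseDensity_succ_le hX] with n hn t ht
  have hnn : 0 ≤ 2 * X * (((X / 2) ^ 2) ^ n / (n.factorial : ℝ)) := by positivity
  rcases ht.1.eq_or_lt with rfl | ht0
  · rw [h0, norm_zero]
    positivity
  · obtain ⟨c, hc1, hc2⟩ := exists_hasDerivAt_eq_slope (s (n + 1))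
      (fun x => -phaseDensity (n + 1) x)
      ht0 ((hc (n + 1)).mono fun t ht => ht.1) fun x hx => hd _ x hx.1
    rw [h0, sub_zero, sub_zero, eq_div_iff ht0.ne'] at hc2
    rw [← hc2, norm_mul, norm_neg, Real.norm_of_nonneg (phaseDensity_pos _ hc1.1).le,
      Real.norm_of_nonneg ht0.le, mul_comm]
    have := hn c hc1.1 (hc1.2.le.trans ht.2)
    exact mul_le_mul ht.2 this (phaseDensity_pos _ hc1.1).le hX.le

/-- The sum of the mode phases works: uniform bounds give continuity up to `0` and termwise
differentiation inside. Exponentiating the sum gives the product of eigenvalues, which is the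
determinant by `scatteringDet_eq`. -/
theorem exists_isScatteringPhase : ∃ σ : ℝ → ℝ, IsScatteringPhase σ ∧
    ∀ x, 0 < x → HasDerivAt σ (∑' n : ℤ, -phaseDensity n.natAbs x) x := by
  choose s h0 hc hd using exists_modePhase
  have hb := fun {X : ℝ} (hX : 0 < X) =>
    exists_summable_modePhase_bound h0 hc (fun n x hx => (hd n x hx).1) hX
  have hsum : ∀ x, 0 ≤ x → Summable fun n : ℤ => s n.natAbs x := fun x hx => by
    obtain ⟨u, hu, hb⟩ := hb (X := x + 1) (by linarith)
    exact Summable.of_norm_bounded (Summable.comp_natAbs hu) fun n =>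
      hb _ x ⟨hx, by linarith⟩
  refine ⟨fun x => ∑' n : ℤ, s n.natAbs x, ⟨fun x hx => ?_, ?_, fun x hx => ?_⟩, fun x hx => ?_⟩
  · have hx : 0 ≤ x := hx
    obtain ⟨u, hu, hb⟩ := hb (X := x + 1) (by linarith)
    have h1 : ContinuousOn (fun x => ∑' n : ℤ, s n.natAbs x) (Set.Icc 0 (x + 1)) :=
      continuousOn_tsum (fun n => (hc _).mono fun t ht => ht.1) (Summable.comp_natAbs hu)
        fun n t ht => hb _ t ht
    refine (h1 x ⟨hx, by linarith⟩).mono_of_mem_nhdsWithin ?_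
    rw [← Set.Ici_inter_Iic]
    exact inter_mem_nhdsWithin _ (Iic_mem_nhds (by linarith))
  · simp [h0]
  · have h1 := ((Complex.hasSum_ofReal.2 (hsum x hx.le).hasSum).mul_left
      (2 * Real.pi * Complex.I : ℂ)).cexp
    simp only [Function.comp_def, (hd _ x hx).2] at h1
    exact h1.unique (scatteringDet_eq hx)
  · obtain ⟨u, hu, hb⟩ := exists_summable_phaseDensity_bound (a := x / 2) (X := x + 1)
      (by positivity) (by linarith)
    exact hasDerivAt_tsum_of_isPreconnected (t := Set.Ioo (x / 2) (x + 1)) (y₀ := x)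
      (Summable.comp_natAbs hu) isOpen_Ioo isPreconnected_Ioo
      (fun n y hy => (hd _ y (lt_trans (by positivity) hy.1)).1)
      (fun n y hy => by rw [norm_neg]; exact hb _ y ⟨hy.1.le, hy.2.le⟩)
      ⟨by linarith, by linarith⟩ (hsum x hx.le) ⟨by linarith, by linarith⟩

/-- Two scattering phases differ by a continuous integer-valued function on the positive half-line.
It is locally constant, so the derivative does not depend on the choice. -/
theorem IsScatteringPhase.hasDerivAt {σ : ℝ → ℝ} (hσ : IsScatteringPhase σ) {x : ℝ} (hx : 0 < x) :
    HasDerivAt σ (∑' n : ℤ, -phaseDensity n.natAbs x) x := by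
  obtain ⟨τ, hτ, hd⟩ := exists_isScatteringPhase
  have hint : ∀ y, 0 < y → ∃ k : ℤ, σ y - τ y = k := fun y hy => by
    have h1 : Complex.exp (2 * Real.pi * Complex.I * σ y - 2 * Real.pi * Complex.I * τ y) = 1 := by
      rw [Complex.exp_sub, hσ.exp_eq y hy, hτ.exp_eq y hy, div_self]
      rw [← hτ.exp_eq y hy]
      exact Complex.exp_ne_zero _
    obtain ⟨k, hk⟩ := Complex.exp_eq_one_iff.1 h1
    refine ⟨k, ?_⟩
    have h2 : (2 * Real.pi * Complex.I : ℂ) * ((σ y - τ y : ℝ) : ℂ) =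
        2 * Real.pi * Complex.I * k := by
      push_cast
      linear_combination hk
    have h3 := mul_left_cancel₀ Complex.two_pi_I_ne_zero h2
    exact_mod_cast h3
  have hcont : ContinuousAt (fun y => σ y - τ y) x :=
    (hσ.continuousOn.continuousAt (Ici_mem_nhds hx)).sub
      (hτ.continuousOn.continuousAt (Ici_mem_nhds hx))
  have hev : σ =ᶠ[𝓝 x] fun y => τ y + (σ x - τ x) := by
    filter_upwards [Ioi_mem_nhds hx, hcont (Metric.ball_mem_nhds _ one_pos)] with y hy hy1
    obtain ⟨k, hk⟩ := hint x hx
    obtain ⟨l, hl⟩ := hint y hy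
    have h1 : |(l : ℝ) - k| < 1 := by
      rw [← hk, ← hl, ← Real.dist_eq]
      exact hy1
    have h2 : |l - k| < 1 := by exact_mod_cast h1
    have h3 : l = k := by
      have := Int.abs_lt_one_iff.1 h2
      omega
    rw [hk, ← h3, ← hl]
    ring
  exact ((hd x hx).add_const _).congr_of_eventuallyEq hev

theorem summable_phaseDensity {x : ℝ} (hx : 0 < x) :
    Summable fun n : ℤ => phaseDensity n.natAbs x := by
  obtain ⟨u, hu, hb⟩ := exists_summable_phaseDensity_bound hx le_rfl
  exact Summable.of_norm_bounded (Summable.comp_natAbs hu) fun n => hb _ x ⟨le_rfl, le_rfl⟩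

theorem logDeriv_eq_phaseDensity (n : ℕ) {x : ℝ} (hx : 0 < x) :
    deriv (hankel2 n) x / hankel2 n x - deriv (hankel1 n) x / hankel1 n x =
      2 * Real.pi * Complex.I * ((-phaseDensity n x : ℝ) : ℂ) := by
  rw [(hasDerivAt_hankel1 n hx).deriv, (hasDerivAt_hankel2 n hx).deriv,
    logDeriv_hankel2_sub_hankel1 n hx]

theorem one_div_hankel1_mul_hankel2 (n : ℕ) {x : ℝ} (hx : 0 < x) :
    1 / (hankel1 n x * hankel2 n x) = Real.pi ^ 2 * x / 2 * ((phaseDensity n x : ℝ) : ℂ) := by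
  have h1 : ((‖hankel1 n x‖ : ℝ) : ℂ) ≠ 0 := by
    exact_mod_cast norm_ne_zero_iff.2 (hankel1_ne_zero n hx)
  have hpi : (Real.pi : ℂ) ≠ 0 := by exact_mod_cast Real.pi_ne_zero
  have hx' : (x : ℂ) ≠ 0 := by exact_mod_cast hx.ne'
  rw [hankel1_mul_hankel2, phaseDensity]
  push_cast
  field_simp

end

end DiskScattering

/-! ### Assembly of the main theorem -/

theorem mainTheorem4 :
    -- the objects are well defined: perturbed plane waves, scattering matrix, scattering phase
    (∀ lam : ℝ, 0 < lam →
      (∀ ω : DiskScattering.S1,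
        (∃ (u : ℂ → ℂ) (b : DiskScattering.S1 → ℂ),
          DiskScattering.IsOutgoingSolution lam ω u b) ∧
        (∀ (u u' : ℂ → ℂ) (b b' : DiskScattering.S1 → ℂ),
          DiskScattering.IsOutgoingSolution lam ω u b →
          DiskScattering.IsOutgoingSolution lam ω u' b' →
          Set.EqOn u u' (Metric.ball (0 : ℂ) 1)ᶜ ∧ b = b')) ∧
      Continuous (fun p : DiskScattering.S1 × DiskScattering.S1 =>
        DiskScattering.amplitude lam p.1 p.2) ∧
      DiskScattering.IsIntegralOperator (DiskScattering.amplitude lam)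
        (DiskScattering.scatteringMatrix lam -
          ContinuousLinearMap.id ℂ DiskScattering.L2S1)) ∧
    (∃ σ : ℝ → ℝ, DiskScattering.IsScatteringPhase σ) ∧
    -- the Hankel functions have no zeros on the positive half-line
    (∀ lam : ℝ, 0 < lam → ∀ n : ℕ,
      DiskScattering.hankel1 n lam ≠ 0 ∧ DiskScattering.hankel2 n lam ≠ 0) ∧
    -- eigenfunctions and eigenvalues of `S(lam)`
    (∀ lam : ℝ, 0 < lam → ∀ n : ℤ,
      Module.End.HasEigenvector
        (DiskScattering.scatteringMatrix lam : DiskScattering.L2S1 →ₗ[ℂ] DiskScattering.L2S1)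
        (-(DiskScattering.hankel2 n.natAbs lam / DiskScattering.hankel1 n.natAbs lam))
        (DiskScattering.cosMode n) ∧
      (n ≠ 0 → Module.End.HasEigenvector
        (DiskScattering.scatteringMatrix lam : DiskScattering.L2S1 →ₗ[ℂ] DiskScattering.L2S1)
        (-(DiskScattering.hankel2 n.natAbs lam / DiskScattering.hankel1 n.natAbs lam))
        (DiskScattering.sinMode n))) ∧
    -- eigenfunctions and eigenvalues of `S(lam) J`, with `J` the reflection
    (∀ lam : ℝ, 0 < lam → ∀ n : ℤ,
      Module.End.HasEigenvector
        ((DiskScattering.scatteringMatrix lam ∘L DiskScattering.reflection :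
          DiskScattering.L2S1 →L[ℂ] DiskScattering.L2S1) :
          DiskScattering.L2S1 →ₗ[ℂ] DiskScattering.L2S1)
        ((-1 : ℂ) ^ (n + 1) *
          (DiskScattering.hankel2 n.natAbs lam / DiskScattering.hankel1 n.natAbs lam))
        (DiskScattering.cosMode n) ∧
      (n ≠ 0 → Module.End.HasEigenvector
        ((DiskScattering.scatteringMatrix lam ∘L DiskScattering.reflection :
          DiskScattering.L2S1 →L[ℂ] DiskScattering.L2S1) :
          DiskScattering.L2S1 →ₗ[ℂ] DiskScattering.L2S1)
        ((-1 : ℂ) ^ (n + 1) *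
          (DiskScattering.hankel2 n.natAbs lam / DiskScattering.hankel1 n.natAbs lam))
        (DiskScattering.sinMode n))) ∧
    -- the derivative of the scattering phase
    (∀ σ : ℝ → ℝ, DiskScattering.IsScatteringPhase σ → ∀ lam : ℝ, 0 < lam →
      Summable (fun n : ℤ =>
        deriv (DiskScattering.hankel2 n.natAbs) lam / DiskScattering.hankel2 n.natAbs lam -
        deriv (DiskScattering.hankel1 n.natAbs) lam / DiskScattering.hankel1 n.natAbs lam) ∧
      HasDerivAt (fun x : ℝ => (σ x : ℂ))
        (1 / (2 * (Real.pi : ℂ) * Complex.I) * ∑' n : ℤ,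
          (deriv (DiskScattering.hankel2 n.natAbs) lam / DiskScattering.hankel2 n.natAbs lam -
           deriv (DiskScattering.hankel1 n.natAbs) lam / DiskScattering.hankel1 n.natAbs lam))
        lam ∧
      Summable (fun n : ℤ =>
        1 / (DiskScattering.hankel1 n.natAbs lam * DiskScattering.hankel2 n.natAbs lam)) ∧
      HasDerivAt (fun x : ℝ => (σ x : ℂ))
        (-(2 / ((Real.pi : ℂ) ^ 2 * (lam : ℂ))) * ∑' n : ℤ,
          1 / (DiskScattering.hankel1 n.natAbs lam * DiskScattering.hankel2 n.natAbs lam))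
        lam) := by
  refine ⟨fun lam hlam => ⟨fun ω => ⟨⟨_, _, DiskScattering.isOutgoingSolution_scatteredWave hlam ω⟩,
    fun u u' b b' h h' => h.unique hlam h'⟩, DiskScattering.continuous_amplitude hlam,
    DiskScattering.isIntegralOperator_amplitude hlam⟩, ?_, ?_, ?_, ?_, ?_⟩
  · obtain ⟨σ, hσ, -⟩ := DiskScattering.exists_isScatteringPhase
    exact ⟨σ, hσ⟩
  · exact fun lam hlam n =>
      ⟨DiskScattering.hankel1_ne_zero n hlam, DiskScattering.hankel2_ne_zero n hlam⟩
  · exact fun lam hlam n =>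
      ⟨DiskScattering.hasEigenvector_of_apply (DiskScattering.scatteringMatrix_cosMode hlam n)
        (DiskScattering.cosMode_ne_zero n), fun hn =>
      DiskScattering.hasEigenvector_of_apply (DiskScattering.scatteringMatrix_sinMode hlam n)
        (DiskScattering.sinMode_ne_zero hn)⟩
  · exact fun lam hlam n =>
      ⟨DiskScattering.hasEigenvector_comp_reflection
        (DiskScattering.scatteringMatrix_cosMode hlam n) (DiskScattering.reflection_cosMode n)
        (DiskScattering.cosMode_ne_zero n), fun hn =>
      DiskScattering.hasEigenvector_comp_reflection
        (DiskScattering.scatteringMatrix_sinMode hlam n) (DiskScattering.reflection_sinMode n)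
        (DiskScattering.sinMode_ne_zero hn)⟩
  · intro σ hσ lam hlam
    have hs := Complex.summable_ofReal.2 (DiskScattering.summable_phaseDensity hlam)
    have hd := (hσ.hasDerivAt hlam).ofReal_comp
    have hpi : (Real.pi : ℂ) ≠ 0 := by exact_mod_cast Real.pi_ne_zero
    have hl : (lam : ℂ) ≠ 0 := by exact_mod_cast hlam.ne'
    -- Both series in the statement are constant multiples of the sum of phase densities, so one
    -- derivative formula yields the two.
    simp only [DiskScattering.logDeriv_eq_phaseDensity _ hlam,
      DiskScattering.one_div_hankel1_mul_hankel2 _ hlam, tsum_mul_left]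
    rw [Complex.ofReal_tsum] at hd
    simp only [Complex.ofReal_neg, tsum_neg] at hd ⊢
    refine ⟨hs.neg.mul_left _, hd.congr_deriv ?_, hs.mul_left _, hd.congr_deriv ?_⟩
    · have hI := Complex.I_ne_zero
      field_simp
    · field_simp
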